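/- **Plane graphs and signatures.** A plane straight-line (PSL) graph has a finite set of points in the plane as vertices (distinct $x$-coordinates, distinct $y$-coordinates, no three collinear) and pairwise interior-disjoint segments as edges. The north-degree of a vertex $v$ is the number of edges at $v$ whose other endpoint lies strictly above $v$; south-, east- and west-degree are analogous. A cardinal signature $\sigma$ prescribes these four degrees for each point of a vertex set $V$; a realization of $\sigma$ is a PSL graph on $V$ with exactly these degrees. **Tilings.** Let $w,h\ge 1$. A tiling $X$ assigns to each cell of a $w\times h$ grid a tile type: blank; a single red or a single blue curve joining two of the four sides (routes SE, SW, NS, NW, NE, EW); or one of the tiles I (red SE, blue SW), II (red SE, blue SE), III (red NW, blue NW), IV (red NW, blue NS). Adjacent tiles have the same colors on their common side, no curve leaves the grid (so the curves form cycles), and I–IV occur only together, with I directly above III, II directly to the left of III, and IV directly below II. Tiles II and III are critical. Let $X_R$ ($X_B$) be the set of tiles containing part of a red (blue) cycle. A tile selection is a pair $(S_R,S_B)$ with $S_R\subseteq X_R$, $S_B\subseteq X_B$. It is noncrossing if (1) $t\in S_R\iff t'\in S_R$ whenever a red cycle passes through the common side of adjacent tiles $t,t'$; (2) likewise for blue and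 $S_B$; (3) $t\notin S_R$ or $t\notin S_B$ for each critical tile $t$. **Frame graph.** Subdivide each edge of the $w\times h$ grid graph by three vertices and name the vertices on the boundary cycle of each cell, counterclockwise from its north-east corner, $v_0,b_1,\dots,b_7,v_8,v_7,\dots,v_1$ (north boundary $v_0,b_1,b_2,b_3,b_4$; west $b_4,\dots,b_7,v_8$; south $v_8,\dots,v_4$; east $v_4,\dots,v_0$). Cells whose tile is a single curve with route NS or NE, or is IV, get an interior vertex $p$; cells whose tile is a single curve with route EW or NE get an interior vertex $q$. Add one cone vertex joined to all vertices of the leftmost vertical and of the bottom horizontal grid path. This is the frame graph. Its vertices are placed in general position (as above) so that: - in each cell the $x$-order is $b_4,b_5,b_6,b_7,v_8,p,b_3,b_2,b_1,v_0,v_1,v_2,v_3,q,v_7,v_6,v_5,v_4$ and the $y$-order is $v_4,v_5,v_6,v_7,v_8,q,v_3,v_2,v_1,v_0,b_1,b_2,b_3,p,b_7,b_6,b_5,b_4$ (omitting absent $p,q$); - each edge of a vertical path $\alpha$ has all other vertices that are not east of the southmost vertex of $\alpha$ strictly on the west side of its line, and each edge of a horizontal path $\beta$ has all other vertices that are not north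 of the westmost vertex of $\beta$ strictly on the south side of its line; - cells are square-like: all vertices of a cell not on its west (south) boundary lie strictly east (north) of the line through each edge of that boundary; - $p$ lies south-west of the line $b_7b_1$ and north-east of the line $b_7v_0$; $q$ lies south-west of the line $v_7v_1$ and north-east of the line $v_7v_0$; - the cone vertex lies south and west of all other vertices. **Gadgets.** The gadget of a tile type is an edge-colored graph $U$ on the vertices of a cell with colors black, light/dark red, light/dark blue. Its black edges are the 16 boundary edges and the following (here $a{:}x,y,\dots$ means $ax,ay,\dots$): - blank: $v_8{:}b_3,b_2,b_1,v_0,v_1,v_2,v_3$; $b_3{:}b_5,b_6,b_7$; $v_3{:}v_5,v_6,v_7$. - SE: $v_8{:}b_3,b_2,b_1,v_0,v_1$; $b_3{:}b_5,b_6,b_7$; $v_1v_7,v_2v_6,v_2v_5,v_3v_5$. - SW: $v_6{:}b_3,b_2,b_1,v_0,v_1,v_2,v_3$; $b_3b_5,b_5v_6,b_6v_7,b_7v_7,v_3v_5$. - NW: $v_8{:}b_2,b_1,v_0,v_1,v_2,v_3$; $v_3{:}v_5,v_6,v_7$; $b_3b_5,b_2b_6,b_2b_7$. - NS: $p{:}b_7,b_2,b_1,v_0,v_1,v_2,v_3,v_6$;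 $b_3{:}b_5,b_6,b_7$; $b_7v_7,v_3v_5,v_3v_6$. - NE: $p{:}b_7,b_2,b_1,v_0,v_1,q$; $b_3{:}b_5,b_6,b_7$; $v_3{:}v_5,v_6,v_7$; $b_7v_7,qv_7,qv_1,v_2v_7$. - EW: $q{:}v_7,v_1,v_0,b_1,b_2,b_3,b_5$; $v_3{:}v_5,v_6,v_7$; $b_3b_5,b_6v_7,b_7v_7,v_2v_7$. - I: $v_6{:}b_3,b_2,b_1,v_0,v_1$; $b_3b_5,b_5v_6,b_6v_7,b_7v_7,v_2v_5,v_3v_5$. - II: $v_8{:}b_3,b_2,b_1,v_0,v_1,v_2$; $b_3{:}b_5,b_6,b_7$; $v_2v_7,v_3v_5$. - III: $v_8{:}b_1,v_0,v_1,v_2,v_3$; $v_3{:}v_5,v_6,v_7$; $b_1b_7,b_3b_6,b_3b_5$. - IV: $p{:}b_7,b_1,v_0,v_1,v_2,v_3,v_6$; $b_7v_7,b_2b_7,b_2b_6,b_3b_5,v_3v_5,v_3v_6$. The colored edges of the red single-curve tiles are (light | dark): SE $v_2v_7\mid v_1v_6$; SW $b_5v_7\mid b_6v_6$; NW $b_2b_5\mid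 b_3b_6$; NS $b_7b_2,pv_7\mid b_7v_6,pb_3$; NE $b_7b_2,pv_7,qv_2\mid b_7q,pb_3,v_1v_7$; EW $v_7b_5,qv_2\mid v_7v_1,qb_6$. For blue single-curve tiles replace red by blue and exchange light and dark. For I: red $v_2v_6\mid v_1v_5$, blue $b_6v_6\mid b_5v_7$. For II: red $v_3v_7\mid v_2v_6$, blue $v_2v_5\mid v_3v_6$. For III: red $b_1b_6\mid b_2b_7$, blue $b_3b_7\mid b_2b_6$. For IV: red $b_2b_5\mid b_3b_6$, blue $b_7v_6,pb_2\mid b_7b_1,pv_7$. A local coloring $\chi$ consists of black, one shade of red and one shade of blue; $U^\chi$ is the subgraph of $U$ of the edges with colors in $\chi$. The intended realizations of a gadget are the graphs $U^\chi$ without crossing edges. The signature $\sigma$ has as vertex set the vertices of the frame graph. Inserting the graph $U$ of each tile in its cell, the degree of $v$ in each cardinal direction is the number of incident black edges plus half the number of incident colored edges in that direction. Let $\mathcal R$ be the set of realizations of $\sigma$ that contain, for every cell, an intended realization of its gadget. For an assignment $\varphi$ of local colorings to tiles, $F(\varphi)$ is the union of the frame graph and the graphs $U^{\varphi(t)}$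 of all tiles $t$. **Theorem.** For a tile selection $(S_R,S_B)$ let $\varphi_{S_R,S_B}(t)$ consist of black, light red if $t\in S_R$ and dark red otherwise, and light blue if $t\in S_B$ and dark blue otherwise. For every tiling $X$ and every placement as above, the map $(S_R,S_B)\mapsto F(\varphi_{S_R,S_B})$ is a bijection from the noncrossing tile selections of $X$ onto $\mathcal R$. -/

import Mathlib

/-! ## Plane straight-line graphs, cardinal degrees and cardinal signatures -/

/-- The four cardinal directions; they also name the four sides of a tile. -/
inductive Direction
  | north | south | east | west
  deriving DecidableEq

/-- `d.Sees a b`: the point `b` lies strictly in direction `d` of the point `a`. -/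
def Direction.Sees : Direction → ℝ × ℝ → ℝ × ℝ → Prop
  | .north, a, b => a.2 < b.2
  | .south, a, b => b.2 < a.2
  | .east, a, b => a.1 < b.1
  | .west, a, b => b.1 < a.1

/-- Points have distinct `x`-coordinates, distinct `y`-coordinates, and no three are collinear. -/
structure GeneralPosition {V : Type} (pos : V → ℝ × ℝ) : Prop where
  x_injective : Function.Injective fun v => (pos v).1
  y_injective : Function.Injective fun v => (pos v).2
  not_collinear : ∀ u v w : V, u ≠ v → v ≠ w → u ≠ w →
    ¬ Collinear ℝ ({pos u, pos v, pos w} : Set (ℝ × ℝ))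

/-- Distinct edges of `G`, drawn as straight segments, are interior-disjoint. -/
def NoncrossingEdges {V : Type} (pos : V → ℝ × ℝ) (G : SimpleGraph V) : Prop :=
  ∀ a b c d : V, G.Adj a b → G.Adj c d → s(a, b) ≠ s(c, d) →
    Disjoint (openSegment ℝ (pos a) (pos b)) (openSegment ℝ (pos c) (pos d))

/-- `G`, on the points `pos v` (`v : V`), is a plane straight-line (PSL) graph. As usual in this
setting, the vertices of a PSL graph are in general position with distinct coordinates. -/
structure IsPSL {V : Type} (pos : V → ℝ × ℝ) (G : SimpleGraph V) : Prop where
  generalPosition : GeneralPosition pos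
  noncrossing : NoncrossingEdges pos G

/-- The `d`-degree of `v`: the number of edges at `v` whose other endpoint lies strictly
in direction `d` of `v`. -/
noncomputable def cardinalDegree {V : Type} (pos : V → ℝ × ℝ) (G : SimpleGraph V)
    (d : Direction) (v : V) : ℕ :=
  {u : V | G.Adj v u ∧ d.Sees (pos v) (pos u)}.ncard

/-- `G` is a realization of the cardinal signature `(V, σ)`. -/
structure IsRealization {V : Type} (pos : V → ℝ × ℝ) (σ : Direction → V → ℕ)
    (G : SimpleGraph V) : Prop where
  isPSL : IsPSL pos G
  degree_eq : ∀ d v, cardinalDegree pos G d v = σ d v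

/-- Positive iff `c` lies strictly to the left of the directed line from `a` to `b`. -/
def orient (a b c : ℝ × ℝ) : ℝ :=
  (b.1 - a.1) * (c.2 - a.2) - (b.2 - a.2) * (c.1 - a.1)

/-! ## Tiles and tilings -/

inductive WireColor
  | red | blue
  deriving DecidableEq

/-- The pairs of sides of a tile that a curve can connect. -/
inductive Route
  | SE | SW | NS | NW | NE | EW
  deriving DecidableEq

/-- The two sides of the tile that a route connects. -/
def Route.ends : Route → List Direction
  | .SE => [.south, .east]
  | .SW => [.south, .west]
  | .NS => [.north, .south]
  | .NW => [.north, .west]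
  | .NE => [.north, .east]
  | .EW => [.east, .west]

/-- The seventeen tile types: the empty tile, a single red or blue curve along one of the six
routes, and the four tiles `crossingI, …, crossingIV`, each with a red and a blue curve. -/
inductive TileType
  | blank
  | path (r : Route) (c : WireColor)
  | crossingI
  | crossingII
  | crossingIII
  | crossingIV
  deriving DecidableEq

/-- The route of the curve of a given color through a tile, if there is one. -/
def TileType.route : TileType → WireColor → Option Route
  | .blank, _ => none
  | .path r c, c' => if c' = c then some r else none
  | .crossingI, .red => some .SE
  | .crossingI, .blue => some .SW
  | .crossingII, .red => some .SE
  | .crossingII, .blue => some .SE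
  | .crossingIII, .red => some .NW
  | .crossingIII, .blue => some .NW
  | .crossingIV, .red => some .NW
  | .crossingIV, .blue => some .NS

/-- The curve of color `c` passes through side `d` of the tile. -/
def TileType.Uses (τ : TileType) (c : WireColor) (d : Direction) : Prop :=
  ∃ r, τ.route c = some r ∧ d ∈ r.ends

/-- In the critical tiles the red and the blue curve intersect. -/
def TileType.IsCritical (τ : TileType) : Prop := τ = .crossingII ∨ τ = .crossingIII

/-- Positions in the grid: column (from the left) and row (from the bottom). -/
abbrev Tile (w h : ℕ) : Type := Fin w × Fin h

/-- A tiling of the `w × h` grid. Boundaries of adjacent tiles match up and no curve leaves the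
grid, so that the curves form red and blue cycles. The four crossing tiles only appear together, in
the arrangement
```
        I
   II  III
   IV
```
-/
structure Tiling (w h : ℕ) where
  type : Tile w h → TileType
  match_horizontal : ∀ (i i' : Fin w) (j : Fin h) (c : WireColor), (i : ℕ) + 1 = i' →
    ((type (i, j)).Uses c .east ↔ (type (i', j)).Uses c .west)
  match_vertical : ∀ (i : Fin w) (j j' : Fin h) (c : WireColor), (j : ℕ) + 1 = j' →
    ((type (i, j)).Uses c .north ↔ (type (i, j')).Uses c .south)
  closed_west : ∀ (i : Fin w) (j : Fin h) (c : WireColor), (i : ℕ) = 0 →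
    ¬ (type (i, j)).Uses c .west
  closed_east : ∀ (i : Fin w) (j : Fin h) (c : WireColor), (i : ℕ) + 1 = w →
    ¬ (type (i, j)).Uses c .east
  closed_south : ∀ (i : Fin w) (j : Fin h) (c : WireColor), (j : ℕ) = 0 →
    ¬ (type (i, j)).Uses c .south
  closed_north : ∀ (i : Fin w) (j : Fin h) (c : WireColor), (j : ℕ) + 1 = h →
    ¬ (type (i, j)).Uses c .north
  crossing_II_III : ∀ (i i' : Fin w) (j : Fin h), (i : ℕ) + 1 = i' →
    (type (i, j) = .crossingII ↔ type (i', j) = .crossingIII)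
  crossing_III_I : ∀ (i : Fin w) (j j' : Fin h), (j : ℕ) + 1 = j' →
    (type (i, j) = .crossingIII ↔ type (i, j') = .crossingI)
  crossing_IV_II : ∀ (i : Fin w) (j j' : Fin h), (j : ℕ) + 1 = j' →
    (type (i, j) = .crossingIV ↔ type (i, j') = .crossingII)

/-- The tiles that contain part of a cycle of color `c` (the sets `X_R` and `X_B`). -/
def Tiling.tilesWith {w h : ℕ} (X : Tiling w h) (c : WireColor) : Set (Tile w h) :=
  {t | (X.type t).route c ≠ none}

/-- A tile selection `(S_R, S_B)`. -/
def Tiling.IsTileSelection {w h : ℕ} (X : Tiling w h) (S : Set (Tile w h) × Set (Tile w h)) :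
    Prop :=
  S.1 ⊆ X.tilesWith .red ∧ S.2 ⊆ X.tilesWith .blue

/-- A cycle of color `c` passes through the common boundary of the adjacent tiles `t`, `t'`, where
`t'` is the east or the north neighbour of `t`. -/
def Tiling.Linked {w h : ℕ} (X : Tiling w h) (c : WireColor) (t t' : Tile w h) : Prop :=
  ((t.1 : ℕ) + 1 = t'.1 ∧ t.2 = t'.2 ∧ (X.type t).Uses c .east) ∨
  (t.1 = t'.1 ∧ (t.2 : ℕ) + 1 = t'.2 ∧ (X.type t).Uses c .north)

/-- The three constraints that make a tile selection noncrossing. -/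
structure Tiling.IsNoncrossing {w h : ℕ} (X : Tiling w h)
    (S : Set (Tile w h) × Set (Tile w h)) : Prop where
  red_signal : ∀ t t', X.Linked .red t t' → (t ∈ S.1 ↔ t' ∈ S.1)
  blue_signal : ∀ t t', X.Linked .blue t t' → (t ∈ S.2 ↔ t' ∈ S.2)
  critical : ∀ t, (X.type t).IsCritical → t ∉ S.1 ∨ t ∉ S.2

/-! ## Gadgets -/

/-- Names of the vertices of a frame cell: `v0, …, v8` and `b1, …, b7` (written with a bar on
paper) on the boundary, and the optional interior vertices `p` and `q`. -/
inductive CellVertex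
  | v0 | v1 | v2 | v3 | v4 | v5 | v6 | v7 | v8
  | b1 | b2 | b3 | b4 | b5 | b6 | b7
  | p | q
  deriving DecidableEq

inductive Shade
  | light | dark
  deriving DecidableEq

def Shade.swap : Shade → Shade
  | .light => .dark
  | .dark => .light

/-- The colors of the edges of a gadget: black, and light or dark red or blue. -/
inductive EdgeColor
  | black
  | wire (c : WireColor) (s : Shade)
  deriving DecidableEq

/-- A local coloring: black, one shade of red, and one shade of blue. -/
structure LocalColoring where
  red : Shade
  blue : Shade

/-- The three colors of a local coloring. -/
def LocalColoring.colors (χ : LocalColoring) : Set EdgeColor :=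
  {.black, .wire .red χ.red, .wire .blue χ.blue}

/-- The tile types whose gadget has the interior vertex `p`. -/
def TileType.hasP : TileType → Bool
  | .path .NS _ => true
  | .path .NE _ => true
  | .crossingIV => true
  | _ => false

/-- The tile types whose gadget has the interior vertex `q`. -/
def TileType.hasQ : TileType → Bool
  | .path .EW _ => true
  | .path .NE _ => true
  | _ => false

/-- The edges from `a` to all vertices of the list `l`. -/
def fan (a : CellVertex) (l : List CellVertex) : List (CellVertex × CellVertex) :=
  l.map fun b => (a, b)

namespace CellVertex

/-- The boundary cycle of a frame cell. -/
def boundaryEdges : List (CellVertex × CellVertex) :=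
  [(v0, b1), (b1, b2), (b2, b3), (b3, b4), (b4, b5), (b5, b6), (b6, b7), (b7, v8),
   (v8, v7), (v7, v6), (v6, v5), (v5, v4), (v4, v3), (v3, v2), (v2, v1), (v1, v0)]

/-- Black interior edges of the gadgets with a single curve. -/
def pathBlack : Route → List (CellVertex × CellVertex)
  | .SE => fan v8 [b3, b2, b1, v0, v1] ++ fan b3 [b5, b6, b7] ++
      [(v1, v7), (v2, v6), (v2, v5), (v3, v5)]
  | .SW => fan v6 [b3, b2, b1, v0, v1, v2, v3] ++
      [(b3, b5), (b5, v6), (b6, v7), (b7, v7), (v3, v5)]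
  | .NW => fan v8 [b2, b1, v0, v1, v2, v3] ++ fan v3 [v5, v6, v7] ++
      [(b3, b5), (b2, b6), (b2, b7)]
  | .NS => fan p [b7, b2, b1, v0, v1, v2, v3, v6] ++ fan b3 [b5, b6, b7] ++
      [(b7, v7), (v3, v5), (v3, v6)]
  | .NE => fan p [b7, b2, b1, v0, v1, q] ++ fan b3 [b5, b6, b7] ++ fan v3 [v5, v6, v7] ++
      [(b7, v7), (q, v7), (q, v1), (v2, v7)]
  | .EW => fan q [v7, v1, v0, b1, b2, b3, b5] ++ fan v3 [v5, v6, v7] ++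
      [(b3, b5), (b6, v7), (b7, v7), (v2, v7)]

/-- Colored edges of the gadgets with a single red curve. -/
def pathRed : Route → Shade → List (CellVertex × CellVertex)
  | .SE, .light => [(v2, v7)]
  | .SE, .dark => [(v1, v6)]
  | .SW, .light => [(b5, v7)]
  | .SW, .dark => [(b6, v6)]
  | .NW, .light => [(b2, b5)]
  | .NW, .dark => [(b3, b6)]
  | .NS, .light => [(b7, b2), (p, v7)]
  | .NS, .dark => [(b7, v6), (p, b3)]
  | .NE, .light => [(b7, b2), (p, v7), (q, v2)]
  | .NE, .dark => [(b7, q), (p, b3), (v1, v7)]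
  | .EW, .light => [(v7, b5), (q, v2)]
  | .EW, .dark => [(v7, v1), (q, b6)]

/-- The colored edges of each gadget. A gadget with a single blue curve is obtained from its red
counterpart by exchanging both the colors and the shades. -/
def wireEdges : TileType → WireColor → Shade → List (CellVertex × CellVertex)
  | .blank, _, _ => []
  | .path r .red, .red, s => pathRed r s
  | .path _ .red, .blue, _ => []
  | .path r .blue, .blue, s => pathRed r s.swap
  | .path _ .blue, .red, _ => []
  | .crossingI, .red, .light => [(v2, v6)]
  | .crossingI, .red, .dark => [(v1, v5)]
  | .crossingI, .blue, .light => [(b6, v6)]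
  | .crossingI, .blue, .dark => [(b5, v7)]
  | .crossingII, .red, .light => [(v3, v7)]
  | .crossingII, .red, .dark => [(v2, v6)]
  | .crossingII, .blue, .light => [(v2, v5)]
  | .crossingII, .blue, .dark => [(v3, v6)]
  | .crossingIII, .red, .light => [(b1, b6)]
  | .crossingIII, .red, .dark => [(b2, b7)]
  | .crossingIII, .blue, .light => [(b3, b7)]
  | .crossingIII, .blue, .dark => [(b2, b6)]
  | .crossingIV, .red, .light => [(b2, b5)]
  | .crossingIV, .red, .dark => [(b3, b6)]
  | .crossingIV, .blue, .light => [(b7, v6), (p, b2)]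
  | .crossingIV, .blue, .dark => [(b7, b1), (p, v7)]

/-- The black interior edges of each gadget. -/
def innerBlack : TileType → List (CellVertex × CellVertex)
  | .blank => fan v8 [b3, b2, b1, v0, v1, v2, v3] ++ fan b3 [b5, b6, b7] ++ fan v3 [v5, v6, v7]
  | .path r _ => pathBlack r
  | .crossingI => fan v6 [b3, b2, b1, v0, v1] ++
      [(b3, b5), (b5, v6), (b6, v7), (b7, v7), (v2, v5), (v3, v5)]
  | .crossingII => fan v8 [b3, b2, b1, v0, v1, v2] ++ fan b3 [b5, b6, b7] ++
      [(v2, v7), (v3, v5)]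
  | .crossingIII => fan v8 [b1, v0, v1, v2, v3] ++ fan v3 [v5, v6, v7] ++
      [(b1, b7), (b3, b6), (b3, b5)]
  | .crossingIV => fan p [b7, b1, v0, v1, v2, v3, v6] ++
      [(b7, v7), (b7, b2), (b6, b2), (b3, b5), (v3, v5), (v3, v6)]

/-- The vertices of a frame cell in the order of increasing `x`-coordinate. -/
def xOrder : List CellVertex :=
  [b4, b5, b6, b7, v8, p, b3, b2, b1, v0, v1, v2, v3, q, v7, v6, v5, v4]

/-- The vertices of a frame cell in the order of increasing `y`-coordinate. -/
def yOrder : List CellVertex :=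
  [v4, v5, v6, v7, v8, q, v3, v2, v1, v0, b1, b2, b3, p, b7, b6, b5, b4]

/-- The west and south boundaries of a frame cell. -/
def westBoundary : List CellVertex := [b4, b5, b6, b7, v8]
def southBoundary : List CellVertex := [v4, v5, v6, v7, v8]

end CellVertex

/-- The edges of a given color of the edge-colored graph `U` of the gadget of a tile type. -/
def TileType.gadgetEdges (τ : TileType) : EdgeColor → List (CellVertex × CellVertex)
  | .black => CellVertex.boundaryEdges ++ CellVertex.innerBlack τ
  | .wire c s => CellVertex.wireEdges τ c s

/-! ## The frame graph -/

namespace Tiling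

variable {w h : ℕ}

/-- The vertices of the frame graph of a tiling. The vertical paths are numbered `i = 0, …, w`
from left to right and the horizontal paths `j = 0, …, h` from bottom to top. -/
inductive Vertex (X : Tiling w h) : Type
  /-- the common vertex of vertical path `i` and horizontal path `j` -/
  | corner (i : Fin (w + 1)) (j : Fin (h + 1))
  /-- the three subdivision vertices, from north to south, on vertical path `i` in row `j` -/
  | vert (i : Fin (w + 1)) (j : Fin h) (k : Fin 3)
  /-- the three subdivision vertices, from west to east, on horizontal path `j` in column `i` -/
  | horiz (i : Fin w) (j : Fin (h + 1)) (k : Fin 3)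
  | innerP (t : Tile w h) (ht : (X.type t).hasP = true)
  | innerQ (t : Tile w h) (ht : (X.type t).hasQ = true)
  | cone

/-- There are finitely many vertices, so the cardinalities in cardinal degrees are genuine. -/
instance (X : Tiling w h) : Finite X.Vertex := by
  let f : X.Vertex →
      (Fin (w + 1) × Fin (h + 1)) ⊕ (Fin (w + 1) × Fin h × Fin 3) ⊕
        (Fin w × Fin (h + 1) × Fin 3) ⊕ Tile w h ⊕ Tile w h ⊕ Unit
    | .corner i j => .inl (i, j)
    | .vert i j k => .inr (.inl (i, j, k))
    | .horiz i j k => .inr (.inr (.inl (i, j, k)))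
    | .innerP t _ => .inr (.inr (.inr (.inl t)))
    | .innerQ t _ => .inr (.inr (.inr (.inr (.inl t))))
    | .cone => .inr (.inr (.inr (.inr (.inr ()))))
  refine Finite.of_injective f ?_
  intro x y hxy
  cases x <;> cases y <;> simp_all [f]

/-- The part of vertical path `i` in row `j`, from north to south. -/
def vertPath (X : Tiling w h) (i : Fin (w + 1)) (j : Fin h) : Fin 5 → X.Vertex :=
  ![.corner i j.succ, .vert i j 0, .vert i j 1, .vert i j 2, .corner i j.castSucc]

/-- The part of horizontal path `j` in column `i`, from west to east. -/
def horizPath (X : Tiling w h) (i : Fin w) (j : Fin (h + 1)) : Fin 5 → X.Vertex :=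
  ![.corner i.castSucc j, .horiz i j 0, .horiz i j 1, .horiz i j 2, .corner i.succ j]

/-- The vertex with a given name in the frame cell of tile `t`; `none` if the gadget
of the tile has no such vertex. -/
def cellVertex (X : Tiling w h) (t : Tile w h) : CellVertex → Option X.Vertex
  | .v0 => some (.corner t.1.succ t.2.succ)
  | .v1 => some (.vert t.1.succ t.2 0)
  | .v2 => some (.vert t.1.succ t.2 1)
  | .v3 => some (.vert t.1.succ t.2 2)
  | .v4 => some (.corner t.1.succ t.2.castSucc)
  | .v5 => some (.horiz t.1 t.2.castSucc 2)
  | .v6 => some (.horiz t.1 t.2.castSucc 1)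
  | .v7 => some (.horiz t.1 t.2.castSucc 0)
  | .v8 => some (.corner t.1.castSucc t.2.castSucc)
  | .b1 => some (.horiz t.1 t.2.succ 2)
  | .b2 => some (.horiz t.1 t.2.succ 1)
  | .b3 => some (.horiz t.1 t.2.succ 0)
  | .b4 => some (.corner t.1.castSucc t.2.succ)
  | .b5 => some (.vert t.1.castSucc t.2 0)
  | .b6 => some (.vert t.1.castSucc t.2 1)
  | .b7 => some (.vert t.1.castSucc t.2 2)
  | .p => if ht : (X.type t).hasP = true then some (.innerP t ht) else none
  | .q => if ht : (X.type t).hasQ = true then some (.innerQ t ht) else none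

/-- A placement of the vertices of the frame graph in the plane. -/
structure FramePlacement (X : Tiling w h) where
  pos : X.Vertex → ℝ × ℝ
  generalPosition : GeneralPosition pos
  /-- the prescribed order of `x`-coordinates in each frame cell -/
  x_order : ∀ t, (CellVertex.xOrder.filterMap (X.cellVertex t)).Pairwise
    fun x y => (pos x).1 < (pos y).1
  /-- the prescribed order of `y`-coordinates in each frame cell -/
  y_order : ∀ t, (CellVertex.yOrder.filterMap (X.cellVertex t)).Pairwise
    fun x y => (pos x).2 < (pos y).2
  /-- Vertical path `i` is a convex chain on the convex hull of all vertices that are not east of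
  its southmost vertex: all these vertices lie strictly on the west side of the line through any
  edge of the path (except for the endpoints of that edge). -/
  vert_hull : ∀ (i : Fin (w + 1)) (j : Fin h) (k : Fin 4) (z : X.Vertex),
    z ≠ X.vertPath i j k.castSucc → z ≠ X.vertPath i j k.succ →
    (pos z).1 ≤ (pos (.corner i 0)).1 →
    0 < orient (pos (X.vertPath i j k.succ)) (pos (X.vertPath i j k.castSucc)) (pos z)
  /-- Horizontal path `j` is a convex chain on the convex hull of all vertices that are not north
  of its westmost vertex. -/
  horiz_hull : ∀ (i : Fin w) (j : Fin (h + 1)) (k : Fin 4) (z : X.Vertex),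
    z ≠ X.horizPath i j k.castSucc → z ≠ X.horizPath i j k.succ →
    (pos z).2 ≤ (pos (.corner 0 j)).2 →
    0 < orient (pos (X.horizPath i j k.succ)) (pos (X.horizPath i j k.castSucc)) (pos z)
  /-- Frame cells are square-like: the remaining vertices of a cell lie strictly east of the line
  through any edge of its west boundary … -/
  square_west : ∀ (t : Tile w h) (k : Fin 4), ∀ a ∉ CellVertex.westBoundary,
    ∀ z ∈ X.cellVertex t a,
    orient (pos (X.vertPath t.1.castSucc t.2 k.succ))
      (pos (X.vertPath t.1.castSucc t.2 k.castSucc)) (pos z) < 0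
  /-- … and strictly north of the line through any edge of its south boundary. -/
  square_south : ∀ (t : Tile w h) (k : Fin 4), ∀ a ∉ CellVertex.southBoundary,
    ∀ z ∈ X.cellVertex t a,
    orient (pos (X.horizPath t.1 t.2.castSucc k.succ))
      (pos (X.horizPath t.1 t.2.castSucc k.castSucc)) (pos z) < 0
  /-- An interior vertex `p` lies south-west of the line `b7 b1` (hence of the segment `b3 b7`)
  and north-east of the line `b7 v0`. -/
  p_place : ∀ (t : Tile w h) (ht : (X.type t).hasP = true),
    orient (pos (.vert t.1.castSucc t.2 2)) (pos (.horiz t.1 t.2.succ 2))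
      (pos (.innerP t ht)) < 0 ∧
    0 < orient (pos (.vert t.1.castSucc t.2 2)) (pos (.corner t.1.succ t.2.succ))
      (pos (.innerP t ht))
  /-- An interior vertex `q` lies south-west of the line `v7 v1` (hence of the segment `v3 v7`)
  and north-east of the line `v7 v0`. -/
  q_place : ∀ (t : Tile w h) (ht : (X.type t).hasQ = true),
    0 < orient (pos (.horiz t.1 t.2.castSucc 0)) (pos (.vert t.1.succ t.2 0))
      (pos (.innerQ t ht)) ∧
    orient (pos (.horiz t.1 t.2.castSucc 0)) (pos (.corner t.1.succ t.2.succ))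
      (pos (.innerQ t ht)) < 0
  /-- The cone vertex lies to the south and west of all other vertices. -/
  cone_place : ∀ z : X.Vertex, z ≠ .cone →
    (pos .cone).1 < (pos z).1 ∧ (pos .cone).2 < (pos z).2

/-- The frame graph: all vertical and horizontal paths, and the edges from the cone vertex to all
vertices of the leftmost vertical and of the bottom horizontal path. -/
def frameGraph (X : Tiling w h) : SimpleGraph X.Vertex :=
  SimpleGraph.fromRel fun x y =>
    (∃ i j, ∃ k : Fin 4, x = X.vertPath i j k.castSucc ∧ y = X.vertPath i j k.succ) ∨
    (∃ i j, ∃ k : Fin 4, x = X.horizPath i j k.castSucc ∧ y = X.horizPath i j k.succ) ∨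
    (x = .cone ∧ ∃ j k, y = X.vertPath 0 j k) ∨
    (x = .cone ∧ ∃ i k, y = X.horizPath i 0 k)

/-- The edges of a given color of the gadget graph `U` inserted in the frame cell of `t`. -/
def colorGraph (X : Tiling w h) (t : Tile w h) (e : EdgeColor) : SimpleGraph X.Vertex :=
  SimpleGraph.fromRel fun x y =>
    ∃ ab ∈ (X.type t).gadgetEdges e, X.cellVertex t ab.1 = some x ∧ X.cellVertex t ab.2 = some y

/-- The subgraph `U^χ` of the gadget graph in the frame cell of `t`. -/
def gadgetGraph (X : Tiling w h) (t : Tile w h) (χ : LocalColoring) : SimpleGraph X.Vertex :=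
  ⨆ e ∈ χ.colors, X.colorGraph t e

/-- The intended realizations of the gadget of `t`: the graphs `U^χ` without crossing edges. -/
def intendedRealizations (X : Tiling w h) (pos : X.Vertex → ℝ × ℝ) (t : Tile w h) :
    Set (SimpleGraph X.Vertex) :=
  {H | ∃ χ, H = X.gadgetGraph t χ ∧ NoncrossingEdges pos H}

/-- All black edges: the frame graph together with the black edges of all gadgets. -/
def blackGraph (X : Tiling w h) : SimpleGraph X.Vertex :=
  X.frameGraph ⊔ ⨆ t, X.colorGraph t .black

/-- All colored edges of all gadgets. -/
def wireGraph (X : Tiling w h) : SimpleGraph X.Vertex :=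
  ⨆ t, ⨆ c, ⨆ s, X.colorGraph t (.wire c s)

/-- The cardinal signature `σ` of the tiling: in each direction, the number of incident black
edges plus half the number of incident colored edges. -/
noncomputable def signature (X : Tiling w h) (pos : X.Vertex → ℝ × ℝ)
    (d : Direction) (v : X.Vertex) : ℕ :=
  cardinalDegree pos X.blackGraph d v + cardinalDegree pos X.wireGraph d v / 2

/-- The graph `F(φ)`, for an assignment `φ` of local colorings to the tiles. -/
def framedGraph (X : Tiling w h) (φ : Tile w h → LocalColoring) : SimpleGraph X.Vertex :=
  X.frameGraph ⊔ ⨆ t, X.gadgetGraph t (φ t)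

/-- The class `R`: the realizations of `σ` that contain, for every frame cell, an intended
realization of its gadget. -/
def intendedClass (X : Tiling w h) (pos : X.Vertex → ℝ × ℝ) : Set (SimpleGraph X.Vertex) :=
  {G | IsRealization pos (X.signature pos) G ∧ ∀ t, ∃ H ∈ X.intendedRealizations pos t, H ≤ G}

end Tiling

open Classical in
/-- The assignment of local colorings given by a tile selection `(S_R, S_B)`: light red iff
`t ∈ S_R`, and light blue iff `t ∈ S_B`. -/
noncomputable def selectionColoring {w h : ℕ} (S : Set (Tile w h) × Set (Tile w h))
    (t : Tile w h) : LocalColoring where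
  red := if t ∈ S.1 then .light else .dark
  blue := if t ∈ S.2 then .light else .dark

/-! ## Orientation and separation of segments -/

/-! The graph `F(φ)` splits into three edge-disjoint pieces: the star at the cone vertex, the black
edges of all cells (which include the grid paths of the frame), and the colored edges chosen by `φ`.
The proof combines the geometry of such a union with a count of colored edges at each vertex.

Geometry. Edges of different cells are separated by the line through a boundary edge of one of the
cells: each grid path is a convex chain with everything on its far side beyond the line of each of
its edges, and square-likeness puts the cell on the near side. The same argument handles cone edges.
Inside one cell the placement conditions fix the orientation of enough vertex triples
(`CellGeometry.hasSign_side`) to reduce noncrossing to a finite check (`TileType.separated_of_mem`).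
The check fails only for a critical tile with both shades light, and there a red and a blue edge do
cross (`bothLight_of_noncrossing`).

Degrees. A curve passing through a side of a cell attaches to two subdivision vertices of that side.
At each of them one of the adjacent tiles contributes a light edge and the other a dark edge, in the
same direction. If the two tiles use the same shade, exactly one of these edges is chosen. Hence
consistent shades choose half of the colored edges in every direction at every vertex (`balanced`),
which is what the signature demands. So noncrossing selections give members of the class.

Conversely, let a realization contain `U^χ` in every cell. Edges to the cone go only south and west,
so in the north and east directions the gadgets alone must respect the signature. The chosen colored
degrees are thus at most half of the total there, and the counts at the vertices of a side force
equal shades on both sides of it (`shade_eq_of_le`); between tiles II and III this uses that neither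
is doubly light. With consistent shades the gadgets use up exactly their share of the signature. The
remaining edges have the degrees of the cone star, and a star at the lowest vertex is determined by
its degrees (`eq_of_cardinalDegree_eq_of_star`). So the realization is `F(φ)`.

Injectivity holds because a tile crossed by a curve has an edge of each shade of its color, and no
other cell or color contains that edge (`colorGraph_unique`). -/

theorem orient_rotate (a b c : ℝ × ℝ) : orient b c a = orient a b c := by
  unfold orient; ring

theorem orient_swap (a b c : ℝ × ℝ) : orient b a c = -orient a b c := by
  unfold orient; ring

theorem orient_swap_right (a b c : ℝ × ℝ) : orient a c b = -orient a b c := by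
  unfold orient; ring

theorem orient_self_left (a b : ℝ × ℝ) : orient a b a = 0 := by
  unfold orient; ring

theorem orient_self_right (a b : ℝ × ℝ) : orient a b b = 0 := by
  unfold orient; ring

/-- Points to the left of `z` are ordered by the slopes of their lines to `z`, and the sign of
`orient` compares these slopes. The identity `key` expresses transitivity without dividing. -/
theorem orient_trans_right {a b c z : ℝ × ℝ} (ha : a.1 < z.1) (hb : b.1 < z.1) (hc : c.1 < z.1)
    (h₁ : 0 < orient a b z) (h₂ : 0 < orient b c z) : 0 < orient a c z := by
  have key : orient a c z * (z.1 - b.1) =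
      orient a b z * (z.1 - c.1) + orient b c z * (z.1 - a.1) := by
    unfold orient; ring
  have h : 0 < orient a c z * (z.1 - b.1) := by
    rw [key]
    exact add_pos (mul_pos h₁ (sub_pos.2 hc)) (mul_pos h₂ (sub_pos.2 ha))
  exact pos_of_mul_pos_left h (sub_pos.2 hb).le

theorem orient_trans_right_neg {a b c z : ℝ × ℝ} (ha : a.1 < z.1) (hb : b.1 < z.1)
    (hc : c.1 < z.1) (h₁ : orient a b z < 0) (h₂ : orient b c z < 0) : orient a c z < 0 := by
  have h := orient_trans_right hc hb ha (a := c) (b := b) (c := a) (z := z)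
    (by rw [orient_swap]; linarith) (by rw [orient_swap]; linarith)
  rw [orient_swap] at h; linarith

theorem orient_trans_left {a b c z : ℝ × ℝ} (ha : z.1 < a.1) (hb : z.1 < b.1) (hc : z.1 < c.1)
    (h₁ : 0 < orient z a b) (h₂ : 0 < orient z b c) : 0 < orient z a c := by
  have key : orient z a c * (b.1 - z.1) =
      orient z a b * (c.1 - z.1) + orient z b c * (a.1 - z.1) := by
    unfold orient; ring
  have h : 0 < orient z a c * (b.1 - z.1) := by
    rw [key]
    exact add_pos (mul_pos h₁ (sub_pos.2 hc)) (mul_pos h₂ (sub_pos.2 ha))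
  exact pos_of_mul_pos_left h (sub_pos.2 hb).le

theorem orient_trans_left_neg {a b c z : ℝ × ℝ} (ha : z.1 < a.1) (hb : z.1 < b.1)
    (hc : z.1 < c.1) (h₁ : orient z a b < 0) (h₂ : orient z b c < 0) : orient z a c < 0 := by
  have h := orient_trans_left hc hb ha (a := c) (b := b) (c := a) (z := z)
    (by rw [orient_swap_right]; linarith) (by rw [orient_swap_right]; linarith)
  rw [orient_swap_right] at h; linarith

/-- If `a` and `c` lie on either side of a point `b` and below a line through `b`, then
`b` lies above the segment from `a` to `c`. -/
theorem orient_neg_of_below {a b b' c : ℝ × ℝ} (hab : a.1 < b.1) (hbc : b.1 < c.1)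
    (hb : b.1 < b'.1) (ha : orient b b' a < 0) (hc : orient b b' c ≤ 0) : orient a b c < 0 := by
  have key : orient a b c * (b'.1 - b.1) =
      orient b b' a * (c.1 - b.1) + orient b b' c * (b.1 - a.1) := by
    unfold orient; ring
  have h : orient a b c * (b'.1 - b.1) < 0 := by
    rw [key]
    exact add_neg_of_neg_of_nonpos (mul_neg_of_neg_of_pos ha (sub_pos.2 hbc))
      (mul_nonpos_of_nonpos_of_nonneg hc (sub_pos.2 hab).le)
  exact neg_of_mul_neg_left h (sub_pos.2 hb).le

theorem orient_combo (u v c d : ℝ × ℝ) {r s : ℝ} (hrs : r + s = 1) :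
    orient u v (r • c + s • d) = r * orient u v c + s * orient u v d := by
  obtain rfl : s = 1 - r := by linarith
  simp only [orient, Prod.fst_add, Prod.snd_add, Prod.smul_fst, Prod.smul_snd, smul_eq_mul]
  ring

/-! ### Separated and crossing segments. -/

theorem disjoint_openSegment_of_line {u v a b c d : ℝ × ℝ}
    (ha : orient u v a ≤ 0) (hb : orient u v b ≤ 0)
    (hc : 0 ≤ orient u v c) (hd : 0 ≤ orient u v d)
    (h : (orient u v a < 0 ∨ orient u v b < 0) ∨ (0 < orient u v c ∨ 0 < orient u v d)) :
    Disjoint (openSegment ℝ a b) (openSegment ℝ c d) := by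
  rw [Set.disjoint_left]
  rintro z ⟨r, s, hr, hs, hrs, rfl⟩ ⟨r', s', hr', hs', hrs', hz⟩
  have e := congrArg (orient u v) hz
  rw [orient_combo _ _ _ _ hrs, orient_combo _ _ _ _ hrs'] at e
  have h1 := mul_nonneg hr'.le hc
  have h2 := mul_nonneg hs'.le hd
  have h3 := mul_nonneg hr.le (neg_nonneg.2 ha)
  have h4 := mul_nonneg hs.le (neg_nonneg.2 hb)
  rcases h with (h | h) | (h | h)
  · have := mul_pos hr (neg_pos.2 h); linarith
  · have := mul_pos hs (neg_pos.2 h); linarith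
  · have := mul_pos hr' h; linarith
  · have := mul_pos hs' h; linarith

theorem disjoint_openSegment_of_pos {a b c d : ℝ × ℝ}
    (hc : 0 ≤ orient a b c) (hd : 0 ≤ orient a b d)
    (h : 0 < orient a b c ∨ 0 < orient a b d) :
    Disjoint (openSegment ℝ a b) (openSegment ℝ c d) :=
  disjoint_openSegment_of_line (orient_self_left a b).le (orient_self_right a b).le hc hd (.inr h)

theorem disjoint_openSegment_of_neg {a b c d : ℝ × ℝ}
    (hc : orient a b c ≤ 0) (hd : orient a b d ≤ 0)
    (h : orient a b c < 0 ∨ orient a b d < 0) :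
    Disjoint (openSegment ℝ a b) (openSegment ℝ c d) :=
  (disjoint_openSegment_of_line hc hd (orient_self_left a b).ge (orient_self_right a b).ge
    (.inl h)).symm

theorem not_disjoint_openSegment {a b c d : ℝ × ℝ}
    (hc : 0 < orient a b c) (hd : orient a b d < 0)
    (ha : orient c d a < 0) (hb : 0 < orient c d b) :
    ¬ Disjoint (openSegment ℝ a b) (openSegment ℝ c d) := by
  rw [Set.not_disjoint_iff]
  set p := orient a b c
  set q := orient a b d
  set r := orient c d a
  set s := orient c d b
  have hsum : p - q = s - r := by simp only [p, q, r, s, orient]; ring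
  have hpq : 0 < p - q := by linarith
  have hne : p - q ≠ 0 := hpq.ne'
  -- The common point of the two lines: its weights on `a`, `b` are proportional to the signed
  -- distances from the line `cd`, those on `c`, `d` to the distances from `ab`. By `hsum` both
  -- pairs have the same normalizing factor.
  refine ⟨(s / (p - q)) • a + (-r / (p - q)) • b,
    ⟨_, _, div_pos hb hpq, div_pos (by linarith) hpq, by field_simp; linarith, rfl⟩,
    ⟨-q / (p - q), p / (p - q), div_pos (by linarith) hpq, div_pos hc hpq, by field_simp; ring,
      ?_⟩⟩
  ext
  · simp only [Prod.fst_add, Prod.smul_fst, smul_eq_mul]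
    field_simp
    simp only [p, q, r, s, orient]; ring
  · simp only [Prod.snd_add, Prod.smul_snd, smul_eq_mul]
    field_simp
    simp only [p, q, r, s, orient]; ring

theorem collinear_of_orient_eq_zero {a b c : ℝ × ℝ} (hab : a.1 ≠ b.1) (h : orient a b c = 0) :
    Collinear ℝ ({a, b, c} : Set (ℝ × ℝ)) := by
  rw [collinear_iff_of_mem (p₀ := a) (by simp)]
  have h0 : b.1 - a.1 ≠ 0 := sub_ne_zero.2 hab.symm
  refine ⟨b - a, ?_⟩
  intro z hz
  simp only [Set.mem_insert_iff, Set.mem_singleton_iff] at hz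
  rcases hz with rfl | rfl | rfl
  · exact ⟨0, by simp⟩
  · exact ⟨1, by simp⟩
  · refine ⟨(z.1 - a.1) / (b.1 - a.1), ?_⟩
    unfold orient at h
    ext
    · simp only [vadd_eq_add, Prod.fst_add, Prod.smul_fst, Prod.fst_sub, smul_eq_mul]
      field_simp; ring
    · simp only [vadd_eq_add, Prod.snd_add, Prod.smul_snd, Prod.snd_sub, smul_eq_mul]
      field_simp; linarith

theorem GeneralPosition.orient_ne_zero {V : Type} {pos : V → ℝ × ℝ} (h : GeneralPosition pos)
    {u v w : V} (huv : u ≠ v) (hvw : v ≠ w) (huw : u ≠ w) :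
    orient (pos u) (pos v) (pos w) ≠ 0 := fun h0 =>
  h.not_collinear u v w huv hvw huw
    (collinear_of_orient_eq_zero (fun e => huv (h.x_injective e)) h0)

theorem GeneralPosition.disjoint_of_common_end {V : Type} {pos : V → ℝ × ℝ}
    (h : GeneralPosition pos) {a b c : V} (hab : a ≠ b) (hac : a ≠ c) (hbc : b ≠ c) :
    Disjoint (openSegment ℝ (pos a) (pos b)) (openSegment ℝ (pos a) (pos c)) := by
  rcases lt_or_gt_of_ne (h.orient_ne_zero hab hbc hac) with hs | hs
  · exact disjoint_openSegment_of_neg (orient_self_left _ _).le hs.le (.inr hs)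
  · exact disjoint_openSegment_of_pos (orient_self_left _ _).ge hs.le (.inr hs)

/-! ## Combinatorial orientations in a frame cell -/

namespace CellVertex

/-- The index of a vertex in the `x`-order of a frame cell. -/
def xRank : CellVertex → ℕ
  | b4 => 0 | b5 => 1 | b6 => 2 | b7 => 3 | v8 => 4 | p => 5 | b3 => 6 | b2 => 7 | b1 => 8
  | v0 => 9 | v1 => 10 | v2 => 11 | v3 => 12 | q => 13 | v7 => 14 | v6 => 15 | v5 => 16 | v4 => 17

/-- The index of a vertex in the `y`-order of a frame cell. -/
def yRank : CellVertex → ℕ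
  | v4 => 0 | v5 => 1 | v6 => 2 | v7 => 3 | v8 => 4 | q => 5 | v3 => 6 | v2 => 7 | v1 => 8
  | v0 => 9 | b1 => 10 | b2 => 11 | b3 => 12 | p => 13 | b7 => 14 | b6 => 15 | b5 => 16 | b4 => 17

theorem xRank_injective : Function.Injective xRank := by
  intro a b h; cases a <;> cases b <;> first | rfl | simp [xRank] at h

/-- Membership in the west boundary. -/
def isWest : CellVertex → Bool
  | b4 | b5 | b6 | b7 | v8 => true
  | _ => false

/-- Membership in the south boundary. -/
def isSouth : CellVertex → Bool
  | v4 | v5 | v6 | v7 | v8 => true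
  | _ => false

/-- The part of `turn` where `b` lies neither on the west nor on the south boundary. -/
def innerTurn : CellVertex → CellVertex → CellVertex → Option Bool
  | v8, p, v7 | v8, p, v6 => some false
  -- Patterns are tried in order, so this line keeps `v8` out of the claims below, which need the
  -- first vertex among `b4`, …, `b7`.
  | v8, p, _ => none
  | _, p, b3 | _, p, b2 | _, p, b1 => some true
  | b7, p, _ => some false
  | _, p, _ => none
  | v1, q, _ | v2, q, _ | v3, q, _ => some true
  | _, q, v7 => some false
  | _, q, _ => none
  | _, _, _ => some false

/-- For `a`, `b`, `c` in `x`-order: `some true` if `a`, `b`, `c` make a left turn in every placement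
of a frame cell, `some false` if they always make a right turn, `none` if no claim is made. -/
def turn (a b c : CellVertex) : Option Bool :=
  if b.isWest then some (!c.isWest)
  else if b.isSouth then some (!a.isSouth)
  else innerTurn a b c

/-- The sign of `orient` at the triple `x`, `y`, `z`, where it is determined. -/
def side (x y z : CellVertex) : Option Bool :=
  if x.xRank < y.xRank then
    if y.xRank < z.xRank then turn x y z
    else if z.xRank < x.xRank then turn z x y
    else if x.xRank < z.xRank ∧ z.xRank < y.xRank then (turn x z y).map not
    else none
  else if y.xRank < x.xRank then
    if x.xRank < z.xRank then (turn y x z).map not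
    else if z.xRank < y.xRank then (turn z y x).map not
    else if y.xRank < z.xRank ∧ z.xRank < x.xRank then turn y z x
    else none
  else none

/-- An undetermined orientation counts as failure, so a positive answer is always a certificate. -/
def sameSide (x y z w : CellVertex) : Bool :=
  match side x y z, side x y w with
  | some s, some t => s == t
  | _, _ => false

/-- The edges `e` and `f` have a common end, or the ends of one of them lie on the same
side of the other. -/
def separated (e f : CellVertex × CellVertex) : Bool :=
  e.1 == f.1 || e.1 == f.2 || e.2 == f.1 || e.2 == f.2 ||
    sameSide e.1 e.2 f.1 f.2 || sameSide f.1 f.2 e.1 e.2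

end CellVertex

namespace TileType

def all : List TileType :=
  [blank, path .SE .red, path .SW .red, path .NS .red, path .NW .red, path .NE .red, path .EW .red,
    path .SE .blue, path .SW .blue, path .NS .blue, path .NW .blue, path .NE .blue,
    path .EW .blue, crossingI, crossingII, crossingIII, crossingIV]

theorem mem_all (τ : TileType) : τ ∈ all := by
  cases τ with
  | path r c => cases r <;> cases c <;> decide
  | _ => decide

def isCritical : TileType → Bool
  | crossingII | crossingIII => true
  | _ => false

end TileType

def LocalColoring.shade (χ : LocalColoring) : WireColor → Shade
  | .red => χ.red
  | .blue => χ.blue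

def LocalColoring.all : List LocalColoring :=
  [⟨.light, .light⟩, ⟨.light, .dark⟩, ⟨.dark, .light⟩, ⟨.dark, .dark⟩]

theorem LocalColoring.mem_all (χ : LocalColoring) : χ ∈ LocalColoring.all := by
  rcases χ with ⟨_ | _, _ | _⟩ <;> simp [LocalColoring.all]

/-- The edges of `U^χ`. -/
def TileType.coloredEdges (τ : TileType) (χ : LocalColoring) : List (CellVertex × CellVertex) :=
  τ.gadgetEdges .black ++ τ.gadgetEdges (.wire .red χ.red) ++ τ.gadgetEdges (.wire .blue χ.blue)


/-- A finite check over tile types, local colorings and pairs of edges. It carries the whole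
noncrossing argument inside a cell; all geometry enters through the soundness of `side`. -/
theorem TileType.separated_of_mem (τ : TileType) (χ : LocalColoring)
    (h : ¬ (τ.isCritical = true ∧ χ.red = .light ∧ χ.blue = .light))
    {e f : CellVertex × CellVertex} (he : e ∈ τ.coloredEdges χ) (hf : f ∈ τ.coloredEdges χ) :
    CellVertex.separated e f = true := by
  have key : ∀ τ ∈ TileType.all, ∀ χ ∈ LocalColoring.all,
      ¬ (τ.isCritical = true ∧ χ.red = .light ∧ χ.blue = .light) →
      ∀ e ∈ τ.coloredEdges χ, ∀ f ∈ τ.coloredEdges χ, CellVertex.separated e f = true := by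
    decide +kernel
  exact key τ τ.mem_all χ χ.mem_all h e he f hf

/-! ## Geometry of a frame cell -/

namespace CellVertex

/-- The edges of the west boundary, from north to south. -/
def westEdges : List (CellVertex × CellVertex) := [(b4, b5), (b5, b6), (b6, b7), (b7, v8)]

/-- The edges of the south boundary, from west to east. -/
def southEdges : List (CellVertex × CellVertex) := [(v8, v7), (v7, v6), (v6, v5), (v5, v4)]

/-- The edges of the north and east boundaries, from west to east. -/
def outerEdges : List (CellVertex × CellVertex) :=
  [(b4, b3), (b3, b2), (b2, b1), (b1, v0), (v0, v1), (v1, v2), (v2, v3), (v3, v4)]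

end CellVertex

open CellVertex

/-- The conditions on the placement of the vertices of a frame cell, some of which are absent. -/
structure CellGeometry (f : CellVertex → ℝ × ℝ) (present : CellVertex → Prop) : Prop where
  present_of_ne : ∀ a, a ≠ p → a ≠ q → present a
  x_lt : ∀ {a b}, present a → present b → a.xRank < b.xRank → (f a).1 < (f b).1
  y_lt : ∀ {a b}, present a → present b → a.yRank < b.yRank → (f a).2 < (f b).2
  west_out : ∀ e ∈ westEdges, ∀ z, present z → z.isWest = false →
    0 < orient (f e.1) (f e.2) (f z)
  south_out : ∀ e ∈ southEdges, ∀ z, present z → z.isSouth = false →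
    0 < orient (f e.1) (f e.2) (f z)
  west_chain : ∀ e ∈ westEdges, ∀ z, z.isWest = true → z ≠ e.1 → z ≠ e.2 →
    orient (f e.1) (f e.2) (f z) < 0
  south_chain : ∀ e ∈ southEdges, ∀ z, z.isSouth = true → z ≠ e.1 → z ≠ e.2 →
    orient (f e.1) (f e.2) (f z) < 0
  outer : ∀ e ∈ outerEdges, ∀ z, present z → z ≠ e.1 → z ≠ e.2 →
    orient (f e.1) (f e.2) (f z) < 0
  p_place : present p → orient (f b7) (f b1) (f p) < 0 ∧ 0 < orient (f b7) (f v0) (f p)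
  q_place : present q → 0 < orient (f v7) (f v1) (f q) ∧ orient (f v7) (f v0) (f q) < 0

/-- The sign of `r` is as stated by `s`. -/
def HasSign (s : Option Bool) (r : ℝ) : Prop := (s = some true → 0 < r) ∧ (s = some false → r < 0)

theorem HasSign.neg {s : Option Bool} {r : ℝ} (h : HasSign s r) : HasSign (s.map not) (-r) := by
  rcases s with _ | _ | _ <;> simp_all [HasSign]

theorem hasSign_none (r : ℝ) : HasSign none r := by simp [HasSign]

theorem hasSign_true {r : ℝ} : HasSign (some true) r ↔ 0 < r := by simp [HasSign]

theorem hasSign_false {r : ℝ} : HasSign (some false) r ↔ r < 0 := by simp [HasSign]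

theorem orient_trans_right_y {a b c z : ℝ × ℝ} (ha : a.2 < z.2) (hb : b.2 < z.2) (hc : c.2 < z.2)
    (h₁ : 0 < orient a b z) (h₂ : 0 < orient b c z) : 0 < orient a c z := by
  have key : orient a c z * (z.2 - b.2) =
      orient a b z * (z.2 - c.2) + orient b c z * (z.2 - a.2) := by
    unfold orient; ring
  have h : 0 < orient a c z * (z.2 - b.2) := by
    rw [key]
    exact add_pos (mul_pos h₁ (sub_pos.2 hc)) (mul_pos h₂ (sub_pos.2 ha))
  exact pos_of_mul_pos_left h (sub_pos.2 hb).le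

namespace CellGeometry

variable {f : CellVertex → ℝ × ℝ} {present : CellVertex → Prop}

/-! ### Turns at the boundary vertices of a cell. -/

theorem present_west (H : CellGeometry f present) {a : CellVertex} (h : a.isWest = true) :
    present a := H.present_of_ne a (by rintro rfl; cases h) (by rintro rfl; cases h)

theorem present_south (H : CellGeometry f present) {a : CellVertex} (h : a.isSouth = true) :
    present a := H.present_of_ne a (by rintro rfl; cases h) (by rintro rfl; cases h)

/-- Seen from a vertex to the east, the slopes along the west boundary are monotone, so the sign
known for its edges passes to its chords by transitivity. -/
theorem orient_west_out (H : CellGeometry f present) {a b c : CellVertex}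
    (ha : a.isWest = true) (hb : b.isWest = true) (hc : c.isWest = false) (pc : present c)
    (hab : a.xRank < b.xRank) : 0 < orient (f a) (f b) (f c) := by
  have hx : ∀ d, d.isWest = true → (f d).1 < (f c).1 := fun d hd =>
    H.x_lt (H.present_west hd) pc
      (by cases d <;> cases c <;> first | cases hd; done | cases hc; done | decide)
  have h₁ := H.west_out (b4, b5) (by decide) c pc hc
  have h₂ := H.west_out (b5, b6) (by decide) c pc hc
  have h₃ := H.west_out (b6, b7) (by decide) c pc hc
  have h₄ := H.west_out (b7, v8) (by decide) c pc hc
  have x4 := hx b4 rfl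
  have x5 := hx b5 rfl
  have x6 := hx b6 rfl
  have x7 := hx b7 rfl
  have x8 := hx v8 rfl
  have h₁₂ := orient_trans_right x4 x5 x6 h₁ h₂
  have h₂₃ := orient_trans_right x5 x6 x7 h₂ h₃
  have h₃₄ := orient_trans_right x6 x7 x8 h₃ h₄
  have h₁₃ := orient_trans_right x4 x6 x7 h₁₂ h₃
  have h₂₄ := orient_trans_right x5 x7 x8 h₂₃ h₄
  have h₁₄ := orient_trans_right x4 x7 x8 h₁₃ h₄
  cases a <;> first
    | cases ha; done
    | (cases b <;> first | cases hb; done | assumption | exact absurd hab (by decide))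

theorem orient_west_chain (H : CellGeometry f present) {a b c : CellVertex}
    (ha : a.isWest = true) (hb : b.isWest = true) (hc : c.isWest = true)
    (hab : a.xRank < b.xRank) (hbc : b.xRank < c.xRank) : orient (f a) (f b) (f c) < 0 := by
  have hx : ∀ d e, d.isWest = true → e.isWest = true → d.xRank < e.xRank → (f d).1 < (f e).1 :=
    fun d e hd he h => H.x_lt (H.present_west hd) (H.present_west he) h
  have x45 := hx b4 b5 rfl rfl (by decide)
  have x56 := hx b5 b6 rfl rfl (by decide)
  have x67 := hx b6 b7 rfl rfl (by decide)
  have x78 := hx b7 v8 rfl rfl (by decide)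
  have t1 := H.west_chain (b4, b5) (by decide) b6 rfl (by decide) (by decide)
  have t2 := H.west_chain (b4, b5) (by decide) b7 rfl (by decide) (by decide)
  have t3 := H.west_chain (b4, b5) (by decide) v8 rfl (by decide) (by decide)
  have t4 := H.west_chain (b5, b6) (by decide) b7 rfl (by decide) (by decide)
  have t5 := H.west_chain (b5, b6) (by decide) v8 rfl (by decide) (by decide)
  have t6 := H.west_chain (b6, b7) (by decide) v8 rfl (by decide) (by decide)
  have t7 := orient_trans_right_neg (by linarith) (by linarith) (by linarith) t2 t4
  have t8 := orient_trans_right_neg (by linarith) (by linarith) (by linarith) t3 t5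
  have t9 := orient_trans_right_neg (by linarith) (by linarith) (by linarith) t5 t6
  have t10 := orient_trans_right_neg (by linarith) (by linarith) (by linarith) t8 t6
  cases a <;> first
    | cases ha; done
    | (cases b <;> first
        | cases hb; done
        | exact absurd hab (by decide)
        | (cases c <;> first | cases hc; done | assumption | exact absurd hbc (by decide)))

theorem orient_south_chain (H : CellGeometry f present) {a b c : CellVertex}
    (ha : a.isSouth = true) (hb : b.isSouth = true) (hc : c.isSouth = true)
    (hab : a.xRank < b.xRank) (hbc : b.xRank < c.xRank) : orient (f a) (f b) (f c) < 0 := by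
  have hx : ∀ d e, d.isSouth = true → e.isSouth = true → d.xRank < e.xRank → (f d).1 < (f e).1 :=
    fun d e hd he h => H.x_lt (H.present_south hd) (H.present_south he) h
  have x45 := hx v8 v7 rfl rfl (by decide)
  have x56 := hx v7 v6 rfl rfl (by decide)
  have x67 := hx v6 v5 rfl rfl (by decide)
  have x78 := hx v5 v4 rfl rfl (by decide)
  have t1 := H.south_chain (v8, v7) (by decide) v6 rfl (by decide) (by decide)
  have t2 := H.south_chain (v8, v7) (by decide) v5 rfl (by decide) (by decide)
  have t3 := H.south_chain (v8, v7) (by decide) v4 rfl (by decide) (by decide)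
  have t4 := H.south_chain (v7, v6) (by decide) v5 rfl (by decide) (by decide)
  have t5 := H.south_chain (v7, v6) (by decide) v4 rfl (by decide) (by decide)
  have t6 := H.south_chain (v6, v5) (by decide) v4 rfl (by decide) (by decide)
  have t7 := orient_trans_right_neg (by linarith) (by linarith) (by linarith) t2 t4
  have t8 := orient_trans_right_neg (by linarith) (by linarith) (by linarith) t3 t5
  have t9 := orient_trans_right_neg (by linarith) (by linarith) (by linarith) t5 t6
  have t10 := orient_trans_right_neg (by linarith) (by linarith) (by linarith) t8 t6
  cases a <;> first
    | cases ha; done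
    | (cases b <;> first
        | cases hb; done
        | exact absurd hab (by decide)
        | (cases c <;> first | cases hc; done | assumption | exact absurd hbc (by decide)))

/-- The mirror image of `orient_west_out`. Transitivity needs `a` to lie to the left of the whole
chain, which can fail for `v8`; hence that vertex is excluded. -/
theorem orient_south_out (H : CellGeometry f present) {a b c : CellVertex}
    (ha : a.isSouth = false) (hb : b.isSouth = true) (hc : c.isSouth = true) (hbw : b ≠ v8)
    (pa : present a) (hab : a.xRank < b.xRank) (hbc : b.xRank < c.xRank) :
    0 < orient (f a) (f b) (f c) := by
  have hx : ∀ d, d.isSouth = true → d ≠ v8 → (f a).1 < (f d).1 := fun d hd hd' =>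
    H.x_lt pa (H.present_south hd)
      (by
        cases d <;> first
          | cases hd; done
          | exact absurd rfl hd'
          | (cases a <;> first | cases ha; done | decide))
  have h₂ := H.south_out (v7, v6) (by decide) a pa ha
  have h₃ := H.south_out (v6, v5) (by decide) a pa ha
  have h₄ := H.south_out (v5, v4) (by decide) a pa ha
  rw [orient_rotate] at h₂ h₃ h₄
  have x4 := hx v4 rfl (by decide)
  have x5 := hx v5 rfl (by decide)
  have x6 := hx v6 rfl (by decide)
  have x7 := hx v7 rfl (by decide)
  have h₂₃ := orient_trans_left x7 x6 x5 h₂ h₃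
  have h₃₄ := orient_trans_left x6 x5 x4 h₃ h₄
  have h₂₄ := orient_trans_left x7 x5 x4 h₂₃ h₄
  cases b <;> first
    | cases hb; done
    | exact absurd rfl hbw
    | (cases c <;> first | cases hc; done | assumption | exact absurd hbc (by decide))

/-- The north and east boundaries together form a concave chain above all other vertices of the
cell. The line from `b` to its successor `b'` on that chain leaves `a` and `c` weakly below, so `b`
lies above the segment `ac`. -/
theorem orient_outer (H : CellGeometry f present) {a b c : CellVertex}
    (hb : b = b3 ∨ b = b2 ∨ b = b1 ∨ b = v0 ∨ b = v1 ∨ b = v2 ∨ b = v3)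
    (pa : present a) (pc : present c)
    (hab : a.xRank < b.xRank) (hbc : b.xRank < c.xRank) : orient (f a) (f b) (f c) < 0 := by
  have key : ∀ b', (b, b') ∈ outerEdges → present b → present b' → b.xRank < b'.xRank →
      orient (f a) (f b) (f c) < 0 := by
    intro b' hbb' pb pb' hr
    refine orient_neg_of_below (H.x_lt pa pb hab) (H.x_lt pb pc hbc) (H.x_lt pb pb' hr)
      (H.outer _ hbb' a pa (by rintro rfl; exact hab.false)
        (by rintro rfl; exact (hab.trans hr).false)) ?_
    by_cases h : c = b'
    · rw [h, orient_self_right]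
    · exact (H.outer _ hbb' c pc (by rintro rfl; exact hbc.false) h).le
  have pr : ∀ d, d ≠ p → d ≠ q → present d := H.present_of_ne
  rcases hb with rfl | rfl | rfl | rfl | rfl | rfl | rfl
  · exact key b2 (by decide) (pr _ (by decide) (by decide)) (pr _ (by decide) (by decide))
      (by decide)
  · exact key b1 (by decide) (pr _ (by decide) (by decide)) (pr _ (by decide) (by decide))
      (by decide)
  · exact key v0 (by decide) (pr _ (by decide) (by decide)) (pr _ (by decide) (by decide))
      (by decide)
  · exact key v1 (by decide) (pr _ (by decide) (by decide)) (pr _ (by decide) (by decide))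
      (by decide)
  · exact key v2 (by decide) (pr _ (by decide) (by decide)) (pr _ (by decide) (by decide))
      (by decide)
  · exact key v3 (by decide) (pr _ (by decide) (by decide)) (pr _ (by decide) (by decide))
      (by decide)
  · exact key v4 (by decide) (pr _ (by decide) (by decide)) (pr _ (by decide) (by decide))
      (by decide)

theorem present_outer (H : CellGeometry f present) {b : CellVertex}
    (hb : b = b3 ∨ b = b2 ∨ b = b1 ∨ b = v0 ∨ b = v1 ∨ b = v2 ∨ b = v3) : present b := by
  apply H.present_of_ne <;> rcases hb with rfl | rfl | rfl | rfl | rfl | rfl | rfl <;> decide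

/-! ### Turns at the interior vertices `p` and `q`. -/

/-- The placement of `p` gives the turn at `b7`, `p`, `b1`. The far end moves from `b1` back to `b2`
and `b3` by transitivity around `b7`, and then the near end moves up the west boundary by
transitivity around `c`. -/
theorem orient_p_outer (H : CellGeometry f present) (hp : present p) {a c : CellVertex}
    (ha : a.isWest = true) (ha' : a ≠ v8) (hc : c = b3 ∨ c = b2 ∨ c = b1) :
    0 < orient (f a) (f p) (f c) := by
  have p7 : present b7 := H.present_west rfl
  have p1 : present b1 := H.present_outer (by decide)
  have pc : present c := H.present_outer (by tauto)
  have cW : c.isWest = false := by rcases hc with rfl | rfl | rfl <;> rfl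
  have h7p : b7.xRank < p.xRank := by decide
  have h71 : b7.xRank < b1.xRank := by decide
  have h7c : b7.xRank < c.xRank := by rcases hc with rfl | rfl | rfl <;> decide
  have hpc : p.xRank < c.xRank := by rcases hc with rfl | rfl | rfl <;> decide
  have h₁ : 0 < orient (f b7) (f p) (f b1) := by
    have := (H.p_place hp).1
    rw [orient_swap_right] at this; linarith
  have h₂ : 0 < orient (f b7) (f p) (f c) := by
    by_cases hc1 : c = b1
    · rwa [hc1]
    · have := H.orient_outer (a := b7) (b := c) (c := b1) (by tauto) p7 p1 h7c
        (by rcases hc with rfl | rfl | rfl <;> first | decide | exact absurd rfl hc1)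
      rw [orient_swap_right] at this
      exact orient_trans_left (H.x_lt p7 hp h7p) (H.x_lt p7 p1 h71) (H.x_lt p7 pc h7c) h₁
        (by linarith)
  by_cases ha7 : a = b7
  · rwa [ha7]
  · have har : a.xRank < b7.xRank := by
      cases a <;> first | cases ha; done | decide | exact absurd rfl ha' | exact absurd rfl ha7
    exact orient_trans_right (H.x_lt (H.present_west ha) pc (har.trans h7c))
      (H.x_lt p7 pc h7c) (H.x_lt hp pc hpc) (H.orient_west_out ha rfl cW pc har) h₂

/-- Around `b7` the slopes decrease from `p` to `v0` by the placement of `p`, and from `v0` to every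
later vertex by concavity of the outer boundary. -/
theorem orient_b7_p (H : CellGeometry f present) (hp : present p) {c : CellVertex}
    (pc : present c) (hc : v0.xRank ≤ c.xRank) : orient (f b7) (f p) (f c) < 0 := by
  have p7 : present b7 := H.present_west rfl
  have p0 : present v0 := H.present_outer (by decide)
  have h₁ : orient (f b7) (f p) (f v0) < 0 := by
    have := (H.p_place hp).2
    rw [orient_swap_right] at this; linarith
  rcases hc.eq_or_lt with h | h
  · rwa [← xRank_injective h]
  · exact orient_trans_left_neg (H.x_lt p7 hp (by decide)) (H.x_lt p7 p0 (by decide))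
      (H.x_lt p7 pc (lt_trans (by decide) h)) h₁
      (H.orient_outer (by decide) p7 pc (by decide) h)

theorem orient_q_outer (H : CellGeometry f present) (hq : present q) {a c : CellVertex}
    (ha : a = v1 ∨ a = v2 ∨ a = v3) (hc : c.isSouth = true) (hc' : c ≠ v8) :
    0 < orient (f a) (f q) (f c) := by
  have p7 : present v7 := H.present_south rfl
  have p1 : present v1 := H.present_outer (by decide)
  have pa : present a := H.present_outer (by tauto)
  have aS : a.isSouth = false := by rcases ha with rfl | rfl | rfl <;> rfl
  have ha7 : a.xRank < v7.xRank := by rcases ha with rfl | rfl | rfl <;> decide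
  have haq : a.xRank < q.xRank := by rcases ha with rfl | rfl | rfl <;> decide
  have h₁ : 0 < orient (f v1) (f q) (f v7) := by
    have := (H.q_place hq).1
    rwa [← orient_rotate] at this
  have h₂ : 0 < orient (f a) (f q) (f v7) := by
    by_cases ha1 : a = v1
    · rwa [ha1]
    · have := H.orient_outer (a := v1) (b := a) (c := v7) (by tauto) p1 p7
        (by rcases ha with rfl | rfl | rfl <;> first | decide | exact absurd rfl ha1) ha7
      rw [orient_swap] at this
      exact orient_trans_right (H.x_lt pa p7 ha7) (H.x_lt p1 p7 (by decide))
        (H.x_lt hq p7 (by decide)) (by linarith) h₁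
  by_cases hc7 : c = v7
  · rwa [hc7]
  · have hcr : v7.xRank < c.xRank := by
      cases c <;> first | cases hc; done | decide | exact absurd rfl hc' | exact absurd rfl hc7
    exact orient_trans_left (H.x_lt pa hq haq) (H.x_lt pa p7 ha7)
      (H.x_lt pa (H.present_south hc) (ha7.trans hcr)) h₂
      (H.orient_south_out aS rfl hc (by decide) pa ha7 hcr)

theorem orient_q_v7 (H : CellGeometry f present) (hq : present q) {a : CellVertex}
    (pa : present a) (ha : a.xRank ≤ v0.xRank) : orient (f a) (f q) (f v7) < 0 := by
  have p7 : present v7 := H.present_south rfl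
  have p0 : present v0 := H.present_outer (by decide)
  have h₁ : orient (f v0) (f q) (f v7) < 0 := by
    have := (H.q_place hq).2
    rwa [← orient_rotate] at this
  rcases ha.eq_or_lt with h | h
  · rwa [xRank_injective h]
  · exact orient_trans_right_neg (H.x_lt pa p7 (lt_trans h (by decide)))
      (H.x_lt p0 p7 (by decide)) (H.x_lt hq p7 (by decide))
      (H.orient_outer (by decide) pa p7 h (by decide)) h₁

theorem orient_v8_p (H : CellGeometry f present) (hp : present p) :
    orient (f v8) (f p) (f v7) < 0 ∧ orient (f v8) (f p) (f v6) < 0 := by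
  have h₁ := H.south_out (v8, v7) (by decide) p hp rfl
  have h₂ := H.south_out (v7, v6) (by decide) p hp rfl
  -- Transitivity is taken in the `y`-coordinate here: `p` is above `v8`, `v7` and `v6`, but not to
  -- the right of all three.
  have h₃ := orient_trans_right_y (H.y_lt (H.present_south rfl) hp (by decide))
    (H.y_lt (H.present_south rfl) hp (by decide)) (H.y_lt (H.present_south rfl) hp (by decide))
    h₁ h₂
  rw [orient_swap_right] at h₁ h₃
  constructor <;> simp only at h₁ h₃ <;> linarith

theorem hasSign_turn (H : CellGeometry f present) {a b c : CellVertex} (pa : present a)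
    (pb : present b) (pc : present c) (hab : a.xRank < b.xRank) (hbc : b.xRank < c.xRank) :
    HasSign (turn a b c) (orient (f a) (f b) (f c)) := by
  by_cases hW : b.isWest = true
  · have haW : a.isWest = true := by
      cases b <;> first | cases hW; done | (cases a <;> first | rfl | exact absurd hab (by decide))
    rw [turn, if_pos hW]
    cases hc : c.isWest
    · exact hasSign_true.2 (H.orient_west_out haW hW hc pc hab)
    · exact hasSign_false.2 (H.orient_west_chain haW hW hc hab hbc)
  by_cases hS : b.isSouth = true
  · have hcS : c.isSouth = true := by
      cases b <;> first
        | cases hS; done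
        | exact absurd rfl hW
        | (cases c <;> first | rfl | exact absurd hbc (by decide))
    rw [turn, if_neg hW, if_pos hS]
    cases ha : a.isSouth
    · exact hasSign_true.2 (H.orient_south_out ha hS hcS (by rintro rfl; exact hW rfl) pa hab hbc)
    · exact hasSign_false.2 (H.orient_south_chain ha hS hcS hab hbc)
  by_cases hbp : b = p
  · subst hbp
    cases a <;> first
      | exact absurd hab (by decide)
      | (cases c <;> first
          | exact absurd hbc (by decide)
          | exact hasSign_none _
          | exact hasSign_true.2 (H.orient_p_outer pb rfl (by decide) (by decide))
          | exact hasSign_false.2 (H.orient_b7_p pb pc (by decide))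
          | exact hasSign_false.2 (H.orient_v8_p pb).1
          | exact hasSign_false.2 (H.orient_v8_p pb).2)
  by_cases hbq : b = q
  · subst hbq
    cases a <;> first
      | exact absurd hab (by decide)
      | (cases c <;> first
          | exact absurd hbc (by decide)
          | exact hasSign_none _
          | exact hasSign_true.2 (H.orient_q_outer pb (by decide) rfl (by decide))
          | exact hasSign_false.2 (H.orient_q_v7 pb pa (by decide)))
  have hb : b = b3 ∨ b = b2 ∨ b = b1 ∨ b = v0 ∨ b = v1 ∨ b = v2 ∨ b = v3 := by
    cases b <;> simp_all [isWest, isSouth]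
  have ht : turn a b c = some false := by
    rcases hb with rfl | rfl | rfl | rfl | rfl | rfl | rfl <;> cases a <;> rfl
  rw [ht]
  exact hasSign_false.2 (H.orient_outer hb pa pc hab hbc)

theorem hasSign_side (H : CellGeometry f present) {x y z : CellVertex} (px : present x)
    (py : present y) (pz : present z) : HasSign (side x y z) (orient (f x) (f y) (f z)) := by
  unfold side
  split_ifs with h₁ h₂ h₃ h₄ h₅ h₆ h₇ h₈
  · exact H.hasSign_turn px py pz h₁ h₂
  · rw [orient_rotate (f z)]; exact H.hasSign_turn pz px py h₃ h₁
  · rw [orient_swap_right (f x) (f z)]; exact (H.hasSign_turn px pz py h₄.1 h₄.2).neg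
  · exact hasSign_none _
  · rw [orient_swap (f y)]; exact (H.hasSign_turn py px pz h₅ h₆).neg
  · rw [orient_rotate (f z), orient_swap_right (f z) (f y)]
    exact (H.hasSign_turn pz py px h₇ h₅).neg
  · rw [← orient_rotate (f x)]; exact H.hasSign_turn py pz px h₈.1 h₈.2
  · exact hasSign_none _
  · exact hasSign_none _

theorem disjoint_of_sameSide (H : CellGeometry f present) {x y z w : CellVertex} (px : present x)
    (py : present y) (pz : present z) (pw : present w) (h : sameSide x y z w = true) :
    Disjoint (openSegment ℝ (f x) (f y)) (openSegment ℝ (f z) (f w)) := by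
  have h₁ := H.hasSign_side px py pz
  have h₂ := H.hasSign_side px py pw
  unfold sameSide at h
  split at h
  · next s t hs ht =>
    rw [hs] at h₁
    rw [ht, ← eq_of_beq h] at h₂
    cases s
    · exact disjoint_openSegment_of_neg (hasSign_false.1 h₁).le (hasSign_false.1 h₂).le
        (.inl (hasSign_false.1 h₁))
    · exact disjoint_openSegment_of_pos (hasSign_true.1 h₁).le (hasSign_true.1 h₂).le
        (.inl (hasSign_true.1 h₁))
  · cases h

theorem disjoint_of_separated (H : CellGeometry f present) {e e' : CellVertex × CellVertex}
    (p₁ : present e.1) (p₂ : present e.2) (p₁' : present e'.1) (p₂' : present e'.2)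
    (h : separated e e' = true) (h₁ : e.1 ≠ e'.1) (h₂ : e.1 ≠ e'.2) (h₃ : e.2 ≠ e'.1)
    (h₄ : e.2 ≠ e'.2) :
    Disjoint (openSegment ℝ (f e.1) (f e.2)) (openSegment ℝ (f e'.1) (f e'.2)) := by
  simp only [separated, beq_eq_false_iff_ne.2 h₁, beq_eq_false_iff_ne.2 h₂,
    beq_eq_false_iff_ne.2 h₃, beq_eq_false_iff_ne.2 h₄, Bool.false_or, Bool.or_eq_true] at h
  rcases h with h | h
  · exact H.disjoint_of_sameSide p₁ p₂ p₁' p₂' h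
  · exact (H.disjoint_of_sameSide p₁' p₂' p₁ p₂ h).symm

theorem not_disjoint_of_side (H : CellGeometry f present) {x y z w : CellVertex} (px : present x)
    (py : present y) (pz : present z) (pw : present w) (h₁ : side x y z = some true)
    (h₂ : side x y w = some false) (h₃ : side z w x = some false) (h₄ : side z w y = some true) :
    ¬ Disjoint (openSegment ℝ (f x) (f y)) (openSegment ℝ (f z) (f w)) :=
  not_disjoint_openSegment ((H.hasSign_side px py pz).1 h₁) ((H.hasSign_side px py pw).2 h₂)
    ((H.hasSign_side pz pw px).2 h₃) ((H.hasSign_side pz pw py).1 h₄)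

end CellGeometry

/-! ## Frame cells in a placement -/

/-- In a nonempty grid every grid line bounds a cell, so frame paths can be studied inside cells. -/
theorem Fin.exists_castSucc_or_succ {n : ℕ} (hn : 0 < n) (i : Fin (n + 1)) :
    ∃ i' : Fin n, i = i'.castSucc ∨ i = i'.succ := by
  induction i using Fin.cases with
  | zero => exact ⟨⟨0, hn⟩, .inl rfl⟩
  | succ i => exact ⟨i, .inr rfl⟩

namespace Tiling

variable {w h : ℕ} {X : Tiling w h}

theorem cellVertex_of_ne (X : Tiling w h) (t : Tile w h) (a : CellVertex) (hp : a ≠ p)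
    (hq : a ≠ q) : (X.cellVertex t a).isSome = true := by
  cases a <;> first | rfl | contradiction

theorem exists_of_westEdges (X : Tiling w h) (t : Tile w h) {e : CellVertex × CellVertex}
    (he : e ∈ westEdges) : ∃ k : Fin 4,
      X.cellVertex t e.1 = some (X.vertPath t.1.castSucc t.2 k.castSucc) ∧
      X.cellVertex t e.2 = some (X.vertPath t.1.castSucc t.2 k.succ) := by
  fin_cases he
  exacts [⟨0, rfl, rfl⟩, ⟨1, rfl, rfl⟩, ⟨2, rfl, rfl⟩, ⟨3, rfl, rfl⟩]

theorem exists_of_southEdges (X : Tiling w h) (t : Tile w h) {e : CellVertex × CellVertex}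
    (he : e ∈ southEdges) : ∃ k : Fin 4,
      X.cellVertex t e.1 = some (X.horizPath t.1 t.2.castSucc k.castSucc) ∧
      X.cellVertex t e.2 = some (X.horizPath t.1 t.2.castSucc k.succ) := by
  fin_cases he
  exacts [⟨0, rfl, rfl⟩, ⟨1, rfl, rfl⟩, ⟨2, rfl, rfl⟩, ⟨3, rfl, rfl⟩]

theorem exists_of_outerEdges (X : Tiling w h) (t : Tile w h) {e : CellVertex × CellVertex}
    (he : e ∈ outerEdges) : ∃ k : Fin 4,
      (X.cellVertex t e.1 = some (X.horizPath t.1 t.2.succ k.castSucc) ∧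
      X.cellVertex t e.2 = some (X.horizPath t.1 t.2.succ k.succ)) ∨
      (X.cellVertex t e.1 = some (X.vertPath t.1.succ t.2 k.castSucc) ∧
      X.cellVertex t e.2 = some (X.vertPath t.1.succ t.2 k.succ)) := by
  fin_cases he
  exacts [⟨0, .inl ⟨rfl, rfl⟩⟩, ⟨1, .inl ⟨rfl, rfl⟩⟩, ⟨2, .inl ⟨rfl, rfl⟩⟩, ⟨3, .inl ⟨rfl, rfl⟩⟩,
    ⟨0, .inr ⟨rfl, rfl⟩⟩, ⟨1, .inr ⟨rfl, rfl⟩⟩, ⟨2, .inr ⟨rfl, rfl⟩⟩, ⟨3, .inr ⟨rfl, rfl⟩⟩]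

namespace FramePlacement

variable (P : X.FramePlacement)

/-! ### Coordinates of the vertices of a placement. -/

theorem x_lt_of_xRank {t : Tile w h} {a b : CellVertex} {x y : X.Vertex}
    (ha : X.cellVertex t a = some x) (hb : X.cellVertex t b = some y)
    (hab : a.xRank < b.xRank) : (P.pos x).1 < (P.pos y).1 := by
  have key := List.pairwise_filterMap.1 (P.x_order t)
  rw [List.pairwise_iff_getElem] at key
  have hr : ∀ a : CellVertex, ∃ h : a.xRank < xOrder.length, xOrder[a.xRank] = a := by
    intro a; cases a <;> exact ⟨by decide, rfl⟩
  obtain ⟨h₁, e₁⟩ := hr a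
  obtain ⟨h₂, e₂⟩ := hr b
  exact key _ _ h₁ h₂ hab x (by rw [e₁]; exact ha) y (by rw [e₂]; exact hb)

theorem y_lt_of_yRank {t : Tile w h} {a b : CellVertex} {x y : X.Vertex}
    (ha : X.cellVertex t a = some x) (hb : X.cellVertex t b = some y)
    (hab : a.yRank < b.yRank) : (P.pos x).2 < (P.pos y).2 := by
  have key := List.pairwise_filterMap.1 (P.y_order t)
  rw [List.pairwise_iff_getElem] at key
  have hr : ∀ a : CellVertex, ∃ h : a.yRank < yOrder.length, yOrder[a.yRank] = a := by
    intro a; cases a <;> exact ⟨by decide, rfl⟩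
  obtain ⟨h₁, e₁⟩ := hr a
  obtain ⟨h₂, e₂⟩ := hr b
  exact key _ _ h₁ h₂ hab x (by rw [e₁]; exact ha) y (by rw [e₂]; exact hb)

theorem cellVertex_injective (P : X.FramePlacement) {t : Tile w h} {a b : CellVertex} {x : X.Vertex}
    (ha : X.cellVertex t a = some x) (hb : X.cellVertex t b = some x) : a = b := by
  rcases lt_trichotomy a.xRank b.xRank with hr | hr | hr
  · exact absurd (P.x_lt_of_xRank ha hb hr) (lt_irrefl _)
  · exact xRank_injective hr
  · exact absurd (P.x_lt_of_xRank hb ha hr) (lt_irrefl _)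

theorem x_le_of_xRank {t : Tile w h} {a b : CellVertex} {x y : X.Vertex}
    (ha : X.cellVertex t a = some x) (hb : X.cellVertex t b = some y)
    (hab : a.xRank ≤ b.xRank) : (P.pos x).1 ≤ (P.pos y).1 := by
  rcases hab.eq_or_lt with h | h
  · rw [xRank_injective h, hb] at ha
    rw [Option.some_injective _ ha]
  · exact (P.x_lt_of_xRank ha hb h).le

theorem y_le_of_yRank {t : Tile w h} {a b : CellVertex} {x y : X.Vertex}
    (ha : X.cellVertex t a = some x) (hb : X.cellVertex t b = some y)
    (hab : a.yRank ≤ b.yRank) : (P.pos x).2 ≤ (P.pos y).2 := by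
  rcases hab.eq_or_lt with h | h
  · have : a = b := by cases a <;> cases b <;> first | rfl | simp [yRank] at h
    rw [this, hb] at ha
    rw [Option.some_injective _ ha]
  · exact (P.y_lt_of_yRank ha hb h).le

theorem corner_x_antitone (hw : 0 < w) (i : Fin (w + 1)) :
    Antitone fun j => (P.pos (.corner i j)).1 := by
  rw [Fin.antitone_iff_succ_le]
  intro j
  obtain ⟨i, rfl | rfl⟩ := Fin.exists_castSucc_or_succ hw i
  · exact (P.x_lt_of_xRank (t := (i, j)) (a := b4) (b := v8) rfl rfl (by decide)).le
  · exact (P.x_lt_of_xRank (t := (i, j)) (a := v0) (b := v4) rfl rfl (by decide)).le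

theorem corner_x_monotone (hh : 0 < h) (j : Fin (h + 1)) :
    Monotone fun i => (P.pos (.corner i j)).1 := by
  rw [Fin.monotone_iff_le_succ]
  intro i
  obtain ⟨j, rfl | rfl⟩ := Fin.exists_castSucc_or_succ hh j
  · exact (P.x_lt_of_xRank (t := (i, j)) (a := v8) (b := v4) rfl rfl (by decide)).le
  · exact (P.x_lt_of_xRank (t := (i, j)) (a := b4) (b := v0) rfl rfl (by decide)).le

theorem corner_y_monotone (hw : 0 < w) (i : Fin (w + 1)) :
    Monotone fun j => (P.pos (.corner i j)).2 := by
  rw [Fin.monotone_iff_le_succ]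
  intro j
  obtain ⟨i, rfl | rfl⟩ := Fin.exists_castSucc_or_succ hw i
  · exact (P.y_lt_of_yRank (t := (i, j)) (a := v8) (b := b4) rfl rfl (by decide)).le
  · exact (P.y_lt_of_yRank (t := (i, j)) (a := v4) (b := v0) rfl rfl (by decide)).le

theorem corner_y_antitone (hh : 0 < h) (j : Fin (h + 1)) :
    Antitone fun i => (P.pos (.corner i j)).2 := by
  rw [Fin.antitone_iff_succ_le]
  intro i
  obtain ⟨j, rfl | rfl⟩ := Fin.exists_castSucc_or_succ hh j
  · exact (P.y_lt_of_yRank (t := (i, j)) (a := v4) (b := v8) rfl rfl (by decide)).le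
  · exact (P.y_lt_of_yRank (t := (i, j)) (a := v0) (b := b4) rfl rfl (by decide)).le

/-- Vertical paths lead east as they go south, and the bottom path leads east. So the southmost
vertex of a path bounds everything on it and to its left; this supplies the hypothesis of
`vert_hull`. -/
theorem corner_x_le (hw : 0 < w) (hh : 0 < h) {i i' : Fin (w + 1)} (hi : i ≤ i')
    (j : Fin (h + 1)) : (P.pos (.corner i j)).1 ≤ (P.pos (.corner i' 0)).1 :=
  (P.corner_x_antitone hw i (Fin.zero_le j)).trans (P.corner_x_monotone hh 0 hi)

theorem corner_y_le (hw : 0 < w) (hh : 0 < h) {j j' : Fin (h + 1)} (hj : j ≤ j')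
    (i : Fin (w + 1)) : (P.pos (.corner i j)).2 ≤ (P.pos (.corner 0 j')).2 :=
  (P.corner_y_antitone hh j (Fin.zero_le i)).trans (P.corner_y_monotone hw 0 hj)

/-- The corner `v4` is the eastmost vertex of its cell, which reduces the bound to corners. -/
theorem x_le_corner (hw : 0 < w) (hh : 0 < h) {t : Tile w h} {a : CellVertex} {x : X.Vertex}
    (ha : X.cellVertex t a = some x) {i : Fin (w + 1)} (hi : t.1.succ ≤ i) :
    (P.pos x).1 ≤ (P.pos (.corner i 0)).1 :=
  (P.x_le_of_xRank (b := v4) ha rfl (by cases a <;> decide)).trans (P.corner_x_le hw hh hi _)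

theorem y_le_corner (hw : 0 < w) (hh : 0 < h) {t : Tile w h} {a : CellVertex} {x : X.Vertex}
    (ha : X.cellVertex t a = some x) {j : Fin (h + 1)} (hj : t.2.succ ≤ j) :
    (P.pos x).2 ≤ (P.pos (.corner 0 j)).2 :=
  (P.y_le_of_yRank (b := b4) ha rfl (by cases a <;> decide)).trans (P.corner_y_le hw hh hj _)

/-- The position of a vertex of a frame cell. -/
def cellPos (t : Tile w h) (a : CellVertex) : ℝ × ℝ :=
  -- An absent `p` or `q` gets the dummy position 0; `CellGeometry` makes claims about present
  -- vertices only.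
  ((X.cellVertex t a).map P.pos).getD 0

theorem cellPos_eq {t : Tile w h} {a : CellVertex} {x : X.Vertex}
    (ha : X.cellVertex t a = some x) : P.cellPos t a = P.pos x := by
  simp [cellPos, ha]

theorem cellGeometry (hw : 0 < w) (hh : 0 < h) (t : Tile w h) :
    CellGeometry (P.cellPos t) fun a => (X.cellVertex t a).isSome = true where
  present_of_ne := X.cellVertex_of_ne t
  x_lt := by
    intro a b pa pb hab
    obtain ⟨x, hx⟩ := Option.isSome_iff_exists.1 pa
    obtain ⟨y, hy⟩ := Option.isSome_iff_exists.1 pb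
    rw [P.cellPos_eq hx, P.cellPos_eq hy]
    exact P.x_lt_of_xRank hx hy hab
  y_lt := by
    intro a b pa pb hab
    obtain ⟨x, hx⟩ := Option.isSome_iff_exists.1 pa
    obtain ⟨y, hy⟩ := Option.isSome_iff_exists.1 pb
    rw [P.cellPos_eq hx, P.cellPos_eq hy]
    exact P.y_lt_of_yRank hx hy hab
  west_out := by
    intro e he z pz hz
    obtain ⟨x, hx⟩ := Option.isSome_iff_exists.1 pz
    obtain ⟨k, h₁, h₂⟩ := X.exists_of_westEdges t he
    rw [P.cellPos_eq h₁, P.cellPos_eq h₂, P.cellPos_eq hx, orient_swap, neg_pos]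
    exact P.square_west t k z (by rintro hz'; cases z <;> simp_all [westBoundary, isWest]) x hx
  south_out := by
    intro e he z pz hz
    obtain ⟨x, hx⟩ := Option.isSome_iff_exists.1 pz
    obtain ⟨k, h₁, h₂⟩ := X.exists_of_southEdges t he
    rw [P.cellPos_eq h₁, P.cellPos_eq h₂, P.cellPos_eq hx, orient_swap, neg_pos]
    exact P.square_south t k z (by rintro hz'; cases z <;> simp_all [southBoundary, isSouth]) x hx
  west_chain := by
    intro e he z hz h₁ h₂
    obtain ⟨x, hx⟩ := Option.isSome_iff_exists.1
      (X.cellVertex_of_ne t z (by rintro rfl; cases hz) (by rintro rfl; cases hz))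
    obtain ⟨k, e₁, e₂⟩ := X.exists_of_westEdges t he
    rw [P.cellPos_eq e₁, P.cellPos_eq e₂, P.cellPos_eq hx, orient_swap, neg_lt_zero]
    refine P.vert_hull _ _ k x (fun hh => h₁ (P.cellVertex_injective hx (hh ▸ e₁)))
      (fun hh => h₂ (P.cellVertex_injective hx (hh ▸ e₂))) ?_
    exact (P.x_le_of_xRank (b := v8) hx rfl
      (by cases z <;> first | decide | cases hz)).trans (P.corner_x_le hw hh le_rfl _)
  south_chain := by
    intro e he z hz h₁ h₂
    obtain ⟨x, hx⟩ := Option.isSome_iff_exists.1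
      (X.cellVertex_of_ne t z (by rintro rfl; cases hz) (by rintro rfl; cases hz))
    obtain ⟨k, e₁, e₂⟩ := X.exists_of_southEdges t he
    rw [P.cellPos_eq e₁, P.cellPos_eq e₂, P.cellPos_eq hx, orient_swap, neg_lt_zero]
    refine P.horiz_hull _ _ k x (fun hh => h₁ (P.cellVertex_injective hx (hh ▸ e₁)))
      (fun hh => h₂ (P.cellVertex_injective hx (hh ▸ e₂))) ?_
    exact (P.y_le_of_yRank (b := v8) hx rfl
      (by cases z <;> first | decide | cases hz)).trans (P.corner_y_le hw hh le_rfl _)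
  outer := by
    intro e he z pz h₁ h₂
    obtain ⟨x, hx⟩ := Option.isSome_iff_exists.1 pz
    obtain ⟨k, ⟨e₁, e₂⟩ | ⟨e₁, e₂⟩⟩ := X.exists_of_outerEdges t he
    · rw [P.cellPos_eq e₁, P.cellPos_eq e₂, P.cellPos_eq hx, orient_swap, neg_lt_zero]
      exact P.horiz_hull _ _ k x (fun hh => h₁ (P.cellVertex_injective hx (hh ▸ e₁)))
        (fun hh => h₂ (P.cellVertex_injective hx (hh ▸ e₂))) (P.y_le_corner hw hh hx le_rfl)
    · rw [P.cellPos_eq e₁, P.cellPos_eq e₂, P.cellPos_eq hx, orient_swap, neg_lt_zero]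
      exact P.vert_hull _ _ k x (fun hh => h₁ (P.cellVertex_injective hx (hh ▸ e₁)))
        (fun hh => h₂ (P.cellVertex_injective hx (hh ▸ e₂))) (P.x_le_corner hw hh hx le_rfl)
  p_place := by
    intro hp
    by_cases ht : (X.type t).hasP = true
    · have e : X.cellVertex t p = some (.innerP t ht) := dif_pos ht
      rw [P.cellPos_eq e]
      exact P.p_place t ht
    · simp [cellVertex, ht] at hp
  q_place := by
    intro hq
    by_cases ht : (X.type t).hasQ = true
    · have e : X.cellVertex t q = some (.innerQ t ht) := dif_pos ht
      rw [P.cellPos_eq e]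
      exact P.q_place t ht
    · simp [cellVertex, ht] at hq

/-- The line through one of the boundary edges in `L` separates the edge `uv` from the edge
`e` of the frame cell. -/
theorem disjoint_of_boundary {t : Tile w h} {u v x y : X.Vertex} {e : CellVertex × CellVertex}
    {L : List (CellVertex × CellVertex)} {m : CellVertex → Bool}
    (hull : ∀ d ∈ L, ∀ z, z = u ∨ z = v → X.cellVertex t d.1 ≠ some z →
      X.cellVertex t d.2 ≠ some z → orient (P.cellPos t d.1) (P.cellPos t d.2) (P.pos z) < 0)
    (out : ∀ d ∈ L, ∀ z, (X.cellVertex t z).isSome = true → m z = false →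
      0 < orient (P.cellPos t d.1) (P.cellPos t d.2) (P.cellPos t z))
    (cover : ∀ a, ∃ d ∈ L, m a = true → a = d.1 ∨ a = d.2)
    (he : m e.1 = true → m e.2 = true → e ∈ L)
    (hx : X.cellVertex t e.1 = some x) (hy : X.cellVertex t e.2 = some y)
    (huv : u ≠ v) (hne : s(u, v) ≠ s(x, y)) :
    Disjoint (openSegment ℝ (P.pos u) (P.pos v)) (openSegment ℝ (P.pos x) (P.pos y)) := by
  have hull' : ∀ d ∈ L, ∀ z, z = u ∨ z = v →
      orient (P.cellPos t d.1) (P.cellPos t d.2) (P.pos z) ≤ 0 := by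
    intro d hd z hz
    by_cases h₁ : X.cellVertex t d.1 = some z
    · rw [P.cellPos_eq h₁, orient_self_left]
    by_cases h₂ : X.cellVertex t d.2 = some z
    · rw [P.cellPos_eq h₂, orient_self_right]
    exact (hull d hd z hz h₁ h₂).le
  -- If the cell edge lies in the boundary, its own line separates; otherwise the line of a boundary
  -- edge through its possible boundary end does.
  by_cases hW : m e.1 = true ∧ m e.2 = true
  · have heW := he hW.1 hW.2
    have h₁ := hull e heW u (.inl rfl)
    have h₂ := hull e heW v (.inr rfl)
    have h₁' := hull' e heW u (.inl rfl)
    have h₂' := hull' e heW v (.inr rfl)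
    rw [P.cellPos_eq hx, P.cellPos_eq hy] at h₁ h₂ h₁' h₂'
    rw [hx, hy] at h₁ h₂
    refine disjoint_openSegment_of_line h₁' h₂' (orient_self_left _ _).ge
      (orient_self_right _ _).ge (.inl ?_)
    -- If neither `u` nor `v` is strictly beyond the line of `xy`, then both are ends of `xy`, and
    -- the two edges coincide.
    by_contra! hcon
    have hu : x = u ∨ y = u := by
      by_contra! hc
      exact (h₁ (by simpa using hc.1) (by simpa using hc.2)).not_ge hcon.1
    have hv : x = v ∨ y = v := by
      by_contra! hc
      exact (h₂ (by simpa using hc.1) (by simpa using hc.2)).not_ge hcon.2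
    rcases hu with rfl | rfl <;> rcases hv with rfl | rfl
    · exact huv rfl
    · exact hne rfl
    · exact hne Sym2.eq_swap
    · exact huv rfl
  · obtain ⟨d, hd, hd₁, hd₂⟩ : ∃ d ∈ L, (m e.1 = true → e.1 = d.1 ∨ e.1 = d.2) ∧
        (m e.2 = true → e.2 = d.1 ∨ e.2 = d.2) := by
      by_cases ha : m e.1 = true
      · obtain ⟨d, hd, h⟩ := cover e.1
        exact ⟨d, hd, h, fun hb => absurd ⟨ha, hb⟩ hW⟩
      · obtain ⟨d, hd, h⟩ := cover e.2
        exact ⟨d, hd, fun ha' => absurd ha' ha, h⟩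
    have weak : ∀ a z, X.cellVertex t a = some z → (m a = true → a = d.1 ∨ a = d.2) →
        0 ≤ orient (P.cellPos t d.1) (P.cellPos t d.2) (P.pos z) ∧
        (m a = false → 0 < orient (P.cellPos t d.1) (P.cellPos t d.2) (P.pos z)) := by
      intro a z hz ha
      rw [← P.cellPos_eq hz]
      have hs := out d hd a (by simp [hz])
      refine ⟨?_, hs⟩
      cases haW : m a
      · exact (hs haW).le
      · rcases ha haW with rfl | rfl
        · rw [orient_self_left]
        · rw [orient_self_right]
    have hx' := weak _ _ hx hd₁
    have hy' := weak _ _ hy hd₂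
    refine disjoint_openSegment_of_line (hull' d hd u (.inl rfl)) (hull' d hd v (.inr rfl))
      hx'.1 hy'.1 (.inr ?_)
    cases h₁ : m e.1
    · exact .inl (hx'.2 h₁)
    · exact .inr (hy'.2 (by simpa [h₁] using hW))

/-- An edge whose ends are not east of the southmost vertex of a vertical path is disjoint
from the edges of the gadgets immediately to the east of that path. -/
theorem disjoint_of_west (hw : 0 < w) (hh : 0 < h) {t : Tile w h} {u v x y : X.Vertex}
    {e : CellVertex × CellVertex}
    (he : e.1.isWest = true → e.2.isWest = true → e ∈ westEdges)
    (hu : (P.pos u).1 ≤ (P.pos (.corner t.1.castSucc 0)).1)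
    (hv : (P.pos v).1 ≤ (P.pos (.corner t.1.castSucc 0)).1)
    (hx : X.cellVertex t e.1 = some x) (hy : X.cellVertex t e.2 = some y)
    (huv : u ≠ v) (hne : s(u, v) ≠ s(x, y)) :
    Disjoint (openSegment ℝ (P.pos u) (P.pos v)) (openSegment ℝ (P.pos x) (P.pos y)) := by
  refine P.disjoint_of_boundary ?_ (P.cellGeometry hw hh t).west_out (m := isWest)
    (fun a => by cases a <;> decide) he hx hy huv hne
  intro d hd z hz h₁ h₂
  obtain ⟨k, e₁, e₂⟩ := X.exists_of_westEdges t hd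
  rw [P.cellPos_eq e₁, P.cellPos_eq e₂, orient_swap, neg_lt_zero]
  exact P.vert_hull _ _ k z (fun h => h₁ (by rw [e₁, h])) (fun h => h₂ (by rw [e₂, h]))
    (by rcases hz with rfl | rfl <;> assumption)

/-- An edge whose ends are not north of the westmost vertex of a horizontal path is disjoint
from the edges of the gadgets immediately to the north of that path. -/
theorem disjoint_of_south (hw : 0 < w) (hh : 0 < h) {t : Tile w h} {u v x y : X.Vertex}
    {e : CellVertex × CellVertex}
    (he : e.1.isSouth = true → e.2.isSouth = true → e ∈ southEdges)
    (hu : (P.pos u).2 ≤ (P.pos (.corner 0 t.2.castSucc)).2)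
    (hv : (P.pos v).2 ≤ (P.pos (.corner 0 t.2.castSucc)).2)
    (hx : X.cellVertex t e.1 = some x) (hy : X.cellVertex t e.2 = some y)
    (huv : u ≠ v) (hne : s(u, v) ≠ s(x, y)) :
    Disjoint (openSegment ℝ (P.pos u) (P.pos v)) (openSegment ℝ (P.pos x) (P.pos y)) := by
  refine P.disjoint_of_boundary ?_ (P.cellGeometry hw hh t).south_out (m := isSouth)
    (fun a => by cases a <;> decide) he hx hy huv hne
  intro d hd z hz h₁ h₂
  obtain ⟨k, e₁, e₂⟩ := X.exists_of_southEdges t hd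
  rw [P.cellPos_eq e₁, P.cellPos_eq e₂, orient_swap, neg_lt_zero]
  exact P.horiz_hull _ _ k z (fun h => h₁ (by rw [e₁, h])) (fun h => h₂ (by rw [e₂, h]))
    (by rcases hz with rfl | rfl <;> assumption)

end FramePlacement

end Tiling

/-! ## Decomposition of the framed graphs -/

/-- Excludes chords of the west and south boundaries. Since these boundaries bulge into the cell,
such a chord would leave the cell and defeat the separation by boundary lines. -/
theorem TileType.mem_boundaryEdges_of_mem (τ : TileType) (χ : LocalColoring)
    {e : CellVertex × CellVertex} (he : e ∈ τ.coloredEdges χ) :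
    (e.1.isWest = true → e.2.isWest = true → e ∈ westEdges) ∧
    (e.1.isSouth = true → e.2.isSouth = true → e ∈ southEdges) := by
  have key₁ : ∀ τ ∈ TileType.all, ∀ χ ∈ LocalColoring.all, ∀ e ∈ τ.coloredEdges χ,
    (e.1.isWest && e.2.isWest) = true → e ∈ westEdges := by decide +kernel
  have key₂ : ∀ τ ∈ TileType.all, ∀ χ ∈ LocalColoring.all, ∀ e ∈ τ.coloredEdges χ,
    (e.1.isSouth && e.2.isSouth) = true → e ∈ southEdges := by decide +kernel
  exact ⟨fun h₁ h₂ => key₁ τ τ.mem_all χ χ.mem_all e he (by rw [h₁, h₂]; rfl),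
    fun h₁ h₂ => key₂ τ τ.mem_all χ χ.mem_all e he (by rw [h₁, h₂]; rfl)⟩

namespace Tiling

variable {w h : ℕ} (X : Tiling w h)

/-- The edges at the cone vertex. -/
def coneGraph : SimpleGraph X.Vertex :=
  SimpleGraph.fromRel fun x y => x = .cone ∧
    ((∃ j k, y = X.vertPath 0 j k) ∨ ∃ i k, y = X.horizPath i 0 k)

/-- The black edges of all gadgets. -/
def cellGraph : SimpleGraph X.Vertex := ⨆ t, X.colorGraph t .black

/-- The colored edges of all gadgets whose shades are given by `φ`. -/
def shadedGraph (φ : Tile w h → LocalColoring) : SimpleGraph X.Vertex :=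
  ⨆ t, ⨆ c, X.colorGraph t (.wire c ((φ t).shade c))

theorem colorGraph_adj {t : Tile w h} {e : EdgeColor} {x y : X.Vertex} :
    (X.colorGraph t e).Adj x y ↔ x ≠ y ∧ ∃ ab ∈ (X.type t).gadgetEdges e,
      (X.cellVertex t ab.1 = some x ∧ X.cellVertex t ab.2 = some y) ∨
      (X.cellVertex t ab.1 = some y ∧ X.cellVertex t ab.2 = some x) := by
  simp only [colorGraph, SimpleGraph.fromRel_adj, and_or_left, exists_or]

theorem exists_westEdges_of_vertPath (t : Tile w h) (k : Fin 4) : ∃ ab ∈ boundaryEdges,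
    X.cellVertex t ab.1 = some (X.vertPath t.1.castSucc t.2 k.castSucc) ∧
    X.cellVertex t ab.2 = some (X.vertPath t.1.castSucc t.2 k.succ) := by
  fin_cases k
  exacts [⟨(b4, b5), by decide, rfl, rfl⟩, ⟨(b5, b6), by decide, rfl, rfl⟩,
    ⟨(b6, b7), by decide, rfl, rfl⟩, ⟨(b7, v8), by decide, rfl, rfl⟩]

theorem exists_eastEdges_of_vertPath (t : Tile w h) (k : Fin 4) : ∃ ab ∈ boundaryEdges,
    X.cellVertex t ab.1 = some (X.vertPath t.1.succ t.2 k.succ) ∧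
    X.cellVertex t ab.2 = some (X.vertPath t.1.succ t.2 k.castSucc) := by
  fin_cases k
  exacts [⟨(v1, v0), by decide, rfl, rfl⟩, ⟨(v2, v1), by decide, rfl, rfl⟩,
    ⟨(v3, v2), by decide, rfl, rfl⟩, ⟨(v4, v3), by decide, rfl, rfl⟩]

theorem exists_southEdges_of_horizPath (t : Tile w h) (k : Fin 4) : ∃ ab ∈ boundaryEdges,
    X.cellVertex t ab.1 = some (X.horizPath t.1 t.2.castSucc k.castSucc) ∧
    X.cellVertex t ab.2 = some (X.horizPath t.1 t.2.castSucc k.succ) := by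
  fin_cases k
  exacts [⟨(v8, v7), by decide, rfl, rfl⟩, ⟨(v7, v6), by decide, rfl, rfl⟩,
    ⟨(v6, v5), by decide, rfl, rfl⟩, ⟨(v5, v4), by decide, rfl, rfl⟩]

theorem exists_northEdges_of_horizPath (t : Tile w h) (k : Fin 4) : ∃ ab ∈ boundaryEdges,
    X.cellVertex t ab.1 = some (X.horizPath t.1 t.2.succ k.succ) ∧
    X.cellVertex t ab.2 = some (X.horizPath t.1 t.2.succ k.castSucc) := by
  fin_cases k
  exacts [⟨(b3, b4), by decide, rfl, rfl⟩, ⟨(b2, b3), by decide, rfl, rfl⟩,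
    ⟨(b1, b2), by decide, rfl, rfl⟩, ⟨(v0, b1), by decide, rfl, rfl⟩]

variable {X}

/-- Every path edge of the frame is a black boundary edge of some cell. Only the cone edges then
remain from the frame, and the pieces of `framedGraph_eq` are edge-disjoint, so their degrees add.
-/
theorem frameGraph_le (hw : 0 < w) (hh : 0 < h) : X.frameGraph ≤ X.coneGraph ⊔ X.cellGraph := by
  have key : ∀ x y : X.Vertex, x ≠ y →
      ((∃ i j, ∃ k : Fin 4, x = X.vertPath i j k.castSucc ∧ y = X.vertPath i j k.succ) ∨
      (∃ i j, ∃ k : Fin 4, x = X.horizPath i j k.castSucc ∧ y = X.horizPath i j k.succ) ∨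
      (x = .cone ∧ ∃ j k, y = X.vertPath 0 j k) ∨
      (x = .cone ∧ ∃ i k, y = X.horizPath i 0 k)) → (X.coneGraph ⊔ X.cellGraph).Adj x y := by
    intro x y hxy hr
    have cell : ∀ t : Tile w h, (∃ ab ∈ boundaryEdges,
        (X.cellVertex t ab.1 = some x ∧ X.cellVertex t ab.2 = some y) ∨
        (X.cellVertex t ab.1 = some y ∧ X.cellVertex t ab.2 = some x)) →
        (X.coneGraph ⊔ X.cellGraph).Adj x y := by
      rintro t ⟨ab, hab, hs⟩
      refine .inr ?_
      simp only [cellGraph, SimpleGraph.iSup_adj]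
      exact ⟨t, (X.colorGraph_adj).2 ⟨hxy, ab, List.mem_append_left _ hab, hs⟩⟩
    rcases hr with ⟨i, j, k, rfl, rfl⟩ | ⟨i, j, k, rfl, rfl⟩ | ⟨rfl, hr⟩ | ⟨rfl, hr⟩
    · obtain ⟨i, rfl | rfl⟩ := Fin.exists_castSucc_or_succ hw i
      · obtain ⟨ab, hab, h⟩ := X.exists_westEdges_of_vertPath (i, j) k
        exact cell _ ⟨ab, hab, .inl h⟩
      · obtain ⟨ab, hab, h⟩ := X.exists_eastEdges_of_vertPath (i, j) k
        exact cell _ ⟨ab, hab, .inr h⟩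
    · obtain ⟨j, rfl | rfl⟩ := Fin.exists_castSucc_or_succ hh j
      · obtain ⟨ab, hab, h⟩ := X.exists_southEdges_of_horizPath (i, j) k
        exact cell _ ⟨ab, hab, .inl h⟩
      · obtain ⟨ab, hab, h⟩ := X.exists_northEdges_of_horizPath (i, j) k
        exact cell _ ⟨ab, hab, .inr h⟩
    · exact .inl ((SimpleGraph.fromRel_adj _ _ _).2 ⟨hxy, .inl ⟨rfl, .inl hr⟩⟩)
    · exact .inl ((SimpleGraph.fromRel_adj _ _ _).2 ⟨hxy, .inl ⟨rfl, .inr hr⟩⟩)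
  intro x y hxy
  obtain ⟨hne, hr | hr⟩ := (SimpleGraph.fromRel_adj _ _ _).1 hxy
  · exact key x y hne hr
  · exact (key y x hne.symm hr).symm

theorem coneGraph_le : X.coneGraph ≤ X.frameGraph := by
  intro x y hxy
  obtain ⟨hne, hr⟩ := (SimpleGraph.fromRel_adj _ _ _).1 hxy
  refine (SimpleGraph.fromRel_adj _ _ _).2 ⟨hne, ?_⟩
  rcases hr with ⟨h, h' | h'⟩ | ⟨h, h' | h'⟩
  · exact .inl (.inr (.inr (.inl ⟨h, h'⟩)))
  · exact .inl (.inr (.inr (.inr ⟨h, h'⟩)))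
  · exact .inr (.inr (.inr (.inl ⟨h, h'⟩)))
  · exact .inr (.inr (.inr (.inr ⟨h, h'⟩)))

theorem frameGraph_sup (hw : 0 < w) (hh : 0 < h) :
    X.frameGraph ⊔ X.cellGraph = X.coneGraph ⊔ X.cellGraph :=
  le_antisymm (sup_le (frameGraph_le hw hh) le_sup_right) (sup_le_sup_right coneGraph_le _)

theorem blackGraph_eq (hw : 0 < w) (hh : 0 < h) :
    X.blackGraph = X.coneGraph ⊔ X.cellGraph := frameGraph_sup hw hh

theorem gadgetGraph_eq (t : Tile w h) (χ : LocalColoring) :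
    X.gadgetGraph t χ = X.colorGraph t .black ⊔ ⨆ c, X.colorGraph t (.wire c (χ.shade c)) := by
  ext x y
  simp only [gadgetGraph, LocalColoring.colors, SimpleGraph.iSup_adj, SimpleGraph.sup_adj,
    Set.mem_insert_iff, Set.mem_singleton_iff, exists_prop]
  constructor
  · rintro ⟨e, rfl | rfl | rfl, h⟩
    · exact .inl h
    · exact .inr ⟨.red, h⟩
    · exact .inr ⟨.blue, h⟩
  · rintro (h | ⟨_ | _, h⟩)
    · exact ⟨_, .inl rfl, h⟩
    · exact ⟨_, .inr (.inl rfl), h⟩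
    · exact ⟨_, .inr (.inr rfl), h⟩

theorem iSup_gadgetGraph (φ : Tile w h → LocalColoring) :
    ⨆ t, X.gadgetGraph t (φ t) = X.cellGraph ⊔ X.shadedGraph φ := by
  simp only [gadgetGraph_eq, cellGraph, shadedGraph, iSup_sup_eq]

theorem framedGraph_eq (hw : 0 < w) (hh : 0 < h) (φ : Tile w h → LocalColoring) :
    X.framedGraph φ = X.coneGraph ⊔ X.cellGraph ⊔ X.shadedGraph φ := by
  rw [framedGraph, iSup_gadgetGraph, ← sup_assoc, frameGraph_sup hw hh]

/-- The local colorings with the opposite shades. -/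
def oppositeShades (φ : Tile w h → LocalColoring) (t : Tile w h) : LocalColoring :=
  ⟨(φ t).red.swap, (φ t).blue.swap⟩

theorem wireGraph_eq (φ : Tile w h → LocalColoring) :
    X.wireGraph = X.shadedGraph φ ⊔ X.shadedGraph (oppositeShades φ) := by
  have aux : ∀ (χ : LocalColoring) (c : WireColor) (G : Shade → SimpleGraph X.Vertex),
      ⨆ s, G s = G (χ.shade c) ⊔ G (LocalColoring.shade ⟨χ.red.swap, χ.blue.swap⟩ c) := by
    intro χ c G
    apply le_antisymm
    · refine iSup_le fun s => ?_
      rcases χ with ⟨_ | _, _ | _⟩ <;> cases c <;> cases s <;>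
        first | exact le_sup_left | exact le_sup_right
    · exact sup_le (le_iSup G _) (le_iSup G _)
  simp only [wireGraph, shadedGraph, ← iSup_sup_eq]
  congr 1; ext1 t; congr 1; ext1 c
  exact aux (φ t) c _

theorem gadgetGraph_adj {t : Tile w h} {χ : LocalColoring} {x y : X.Vertex} :
    (X.gadgetGraph t χ).Adj x y ↔ x ≠ y ∧ ∃ ab ∈ (X.type t).coloredEdges χ,
      (X.cellVertex t ab.1 = some x ∧ X.cellVertex t ab.2 = some y) ∨
      (X.cellVertex t ab.1 = some y ∧ X.cellVertex t ab.2 = some x) := by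
  simp only [gadgetGraph, LocalColoring.colors, SimpleGraph.iSup_adj, colorGraph_adj,
    Set.mem_insert_iff, Set.mem_singleton_iff, exists_prop, TileType.coloredEdges, List.mem_append]
  constructor
  · rintro ⟨e, rfl | rfl | rfl, hne, ab, hab, h⟩
    · exact ⟨hne, ab, .inl (.inl hab), h⟩
    · exact ⟨hne, ab, .inl (.inr hab), h⟩
    · exact ⟨hne, ab, .inr hab, h⟩
  · rintro ⟨hne, ab, (hab | hab) | hab, h⟩
    · exact ⟨_, .inl rfl, hne, ab, hab, h⟩
    · exact ⟨_, .inr (.inl rfl), hne, ab, hab, h⟩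
    · exact ⟨_, .inr (.inr rfl), hne, ab, hab, h⟩

theorem framedGraph_eq_gadgets (hw : 0 < w) (hh : 0 < h) (φ : Tile w h → LocalColoring) :
    X.framedGraph φ = X.coneGraph ⊔ ⨆ t, X.gadgetGraph t (φ t) := by
  rw [framedGraph_eq hw hh, iSup_gadgetGraph, sup_assoc]

namespace FramePlacement

variable (P : X.FramePlacement)

/-! ### Noncrossing framed graphs. -/

theorem disjoint_cells (hw : 0 < w) (hh : 0 < h) {φ : Tile w h → LocalColoring}
    (hφ : ∀ t, ¬ ((X.type t).isCritical = true ∧ (φ t).red = .light ∧ (φ t).blue = .light))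
    {t t' : Tile w h} {e e' : CellVertex × CellVertex} {x y x' y' : X.Vertex}
    (he : e ∈ (X.type t).coloredEdges (φ t)) (he' : e' ∈ (X.type t').coloredEdges (φ t'))
    (hx : X.cellVertex t e.1 = some x) (hy : X.cellVertex t e.2 = some y)
    (hx' : X.cellVertex t' e'.1 = some x') (hy' : X.cellVertex t' e'.2 = some y')
    (hxx : x ≠ x') (hxy : x ≠ y') (hyx : y ≠ x') (hyy : y ≠ y') (hne : x ≠ y) (hne' : x' ≠ y') :
    Disjoint (openSegment ℝ (P.pos x) (P.pos y)) (openSegment ℝ (P.pos x') (P.pos y')) := by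
  have hs : s(x, y) ≠ s(x', y') := by
    rw [Ne, Sym2.eq_iff]; tauto
  -- Cells in different columns are separated by the west boundary of the eastern cell, whatever
  -- their rows; cells in one column by the south boundary of the upper one.
  rcases lt_trichotomy t.1 t'.1 with h₁ | h₁ | h₁
  · have : t.1.succ ≤ t'.1.castSucc := by simpa [Fin.le_def] using h₁
    exact P.disjoint_of_west hw hh (TileType.mem_boundaryEdges_of_mem _ _ he').1
      (P.x_le_corner hw hh hx this) (P.x_le_corner hw hh hy this) hx' hy' hne hs
  · rcases lt_trichotomy t.2 t'.2 with h₂ | h₂ | h₂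
    · have : t.2.succ ≤ t'.2.castSucc := by simpa [Fin.le_def] using h₂
      exact P.disjoint_of_south hw hh (TileType.mem_boundaryEdges_of_mem _ _ he').2
        (P.y_le_corner hw hh hx this) (P.y_le_corner hw hh hy this) hx' hy' hne hs
    · obtain rfl : t = t' := Prod.ext h₁ h₂
      have G := P.cellGeometry hw hh t
      have := G.disjoint_of_separated (by simp [hx]) (by simp [hy]) (by simp [hx'])
        (by simp [hy']) (TileType.separated_of_mem _ _ (hφ t) he he')
        (by rintro h; rw [h, hx'] at hx; exact hxx (Option.some_injective _ hx).symm)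
        (by rintro h; rw [h, hy'] at hx; exact hxy (Option.some_injective _ hx).symm)
        (by rintro h; rw [h, hx'] at hy; exact hyx (Option.some_injective _ hy).symm)
        (by rintro h; rw [h, hy'] at hy; exact hyy (Option.some_injective _ hy).symm)
      rwa [P.cellPos_eq hx, P.cellPos_eq hy, P.cellPos_eq hx', P.cellPos_eq hy'] at this
    · have : t'.2.succ ≤ t.2.castSucc := by simpa [Fin.le_def] using h₂
      exact (P.disjoint_of_south hw hh (TileType.mem_boundaryEdges_of_mem _ _ he).2
        (P.y_le_corner hw hh hx' this) (P.y_le_corner hw hh hy' this) hx hy hne' hs.symm).symm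
  · have : t'.1.succ ≤ t.1.castSucc := by simpa [Fin.le_def] using h₁
    exact (P.disjoint_of_west hw hh (TileType.mem_boundaryEdges_of_mem _ _ he).1
      (P.x_le_corner hw hh hx' this) (P.x_le_corner hw hh hy' this) hx hy hne' hs.symm).symm

theorem vertPath_zero_x_le (hw : 0 < w) (hh : 0 < h) (j : Fin h) (k : Fin 5) :
    (P.pos (X.vertPath 0 j k)).1 ≤ (P.pos (.corner 0 0)).1 := by
  have key : ∃ a, a.xRank ≤ v8.xRank ∧
      X.cellVertex (⟨0, hw⟩, j) a = some (X.vertPath 0 j k) := by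
    fin_cases k
    exacts [⟨b4, by decide, rfl⟩, ⟨b5, by decide, rfl⟩, ⟨b6, by decide, rfl⟩,
      ⟨b7, by decide, rfl⟩, ⟨v8, by decide, rfl⟩]
  obtain ⟨a, ha, h⟩ := key
  exact (P.x_le_of_xRank (b := v8) h rfl ha).trans (P.corner_x_le hw hh le_rfl _)

theorem horizPath_zero_y_le (hw : 0 < w) (hh : 0 < h) (i : Fin w) (k : Fin 5) :
    (P.pos (X.horizPath i 0 k)).2 ≤ (P.pos (.corner 0 0)).2 := by
  have key : ∃ a, a.yRank ≤ v8.yRank ∧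
      X.cellVertex (i, ⟨0, hh⟩) a = some (X.horizPath i 0 k) := by
    fin_cases k
    exacts [⟨v8, by decide, rfl⟩, ⟨v7, by decide, rfl⟩, ⟨v6, by decide, rfl⟩,
      ⟨v5, by decide, rfl⟩, ⟨v4, by decide, rfl⟩]
  obtain ⟨a, ha, h⟩ := key
  exact (P.y_le_of_yRank (b := v8) h rfl ha).trans (P.corner_y_le hw hh le_rfl _)

theorem disjoint_cone (hw : 0 < w) (hh : 0 < h) {χ : LocalColoring} {t : Tile w h}
    {e : CellVertex × CellVertex} {x y z : X.Vertex}
    (hz : (∃ j k, z = X.vertPath 0 j k) ∨ ∃ i k, z = X.horizPath i 0 k) (hzc : .cone ≠ z)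
    (he : e ∈ (X.type t).coloredEdges χ)
    (hx : X.cellVertex t e.1 = some x) (hy : X.cellVertex t e.2 = some y)
    (hne : s(.cone, z) ≠ s(x, y)) :
    Disjoint (openSegment ℝ (P.pos .cone) (P.pos z)) (openSegment ℝ (P.pos x) (P.pos y)) := by
  have hc := P.cone_place (.corner 0 0) (by simp)
  have h₁ := P.corner_x_le hw hh (Fin.zero_le t.1.castSucc) 0
  have h₂ := P.corner_y_le hw hh (Fin.zero_le t.2.castSucc) 0
  -- The cone lies beyond both the west and the south boundary of every cell. The other end of the
  -- edge decides which of the two is used.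
  rcases hz with ⟨j, k, rfl⟩ | ⟨i, k, rfl⟩
  · exact P.disjoint_of_west hw hh (TileType.mem_boundaryEdges_of_mem _ _ he).1
      (hc.1.le.trans h₁) ((P.vertPath_zero_x_le hw hh j k).trans h₁) hx hy hzc hne
  · exact P.disjoint_of_south hw hh (TileType.mem_boundaryEdges_of_mem _ _ he).2
      (hc.2.le.trans h₂) ((P.horizPath_zero_y_le hw hh i k).trans h₂) hx hy hzc hne

theorem noncrossing_framedGraph (hw : 0 < w) (hh : 0 < h) {φ : Tile w h → LocalColoring}
    (hφ : ∀ t, ¬ ((X.type t).isCritical = true ∧ (φ t).red = .light ∧ (φ t).blue = .light)) :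
    NoncrossingEdges P.pos (X.framedGraph φ) := by
  have cls : ∀ x y, (X.framedGraph φ).Adj x y → ∃ x' y', s(x', y') = s(x, y) ∧
      openSegment ℝ (P.pos x') (P.pos y') = openSegment ℝ (P.pos x) (P.pos y) ∧
      ((x' = .cone ∧ ((∃ j k, y' = X.vertPath 0 j k) ∨ ∃ i k, y' = X.horizPath i 0 k)) ∨
       ∃ t, ∃ e ∈ (X.type t).coloredEdges (φ t), X.cellVertex t e.1 = some x' ∧
          X.cellVertex t e.2 = some y') := by
    intro x y hxy
    rw [framedGraph_eq_gadgets hw hh] at hxy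
    simp only [SimpleGraph.sup_adj, SimpleGraph.iSup_adj, gadgetGraph_adj, coneGraph,
      SimpleGraph.fromRel_adj] at hxy
    rcases hxy with ⟨-, hr | hr⟩ | ⟨t, -, e, he, hs | hs⟩
    · exact ⟨x, y, rfl, rfl, .inl hr⟩
    · exact ⟨y, x, Sym2.eq_swap, openSegment_symm _ _ _, .inl hr⟩
    · exact ⟨x, y, rfl, rfl, .inr ⟨t, e, he, hs⟩⟩
    · exact ⟨y, x, Sym2.eq_swap, openSegment_symm _ _ _, .inr ⟨t, e, he, hs⟩⟩
  intro a b c d hab hcd hne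
  have nab := hab.ne
  have ncd := hcd.ne
  obtain ⟨a', b', e₁, s₁, h₁⟩ := cls a b hab
  obtain ⟨c', d', e₂, s₂, h₂⟩ := cls c d hcd
  rw [← s₁, ← s₂]
  rw [← e₁, ← e₂] at hne
  have nab' : a' ≠ b' := by
    rintro rfl
    rw [Sym2.eq_iff] at e₁
    rcases e₁ with ⟨rfl, h⟩ | ⟨rfl, h⟩
    exacts [nab h, nab h.symm]
  have ncd' : c' ≠ d' := by
    rintro rfl
    rw [Sym2.eq_iff] at e₂
    rcases e₂ with ⟨rfl, h⟩ | ⟨rfl, h⟩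
    exacts [ncd h, ncd h.symm]
  -- Edges with a common end are disjoint by general position. The separation lemmas are applied
  -- only to four distinct ends.
  by_cases hac : a' = c'
  · subst hac
    exact P.generalPosition.disjoint_of_common_end nab' ncd' (fun h => hne (by rw [h]))
  by_cases had : a' = d'
  · subst had
    rw [openSegment_symm ℝ (P.pos c')]
    exact P.generalPosition.disjoint_of_common_end nab' ncd'.symm
      (fun h => hne (by rw [h]; exact Sym2.eq_swap))
  by_cases hbc : b' = c'
  · subst hbc
    rw [openSegment_symm ℝ (P.pos a')]
    exact P.generalPosition.disjoint_of_common_end nab'.symm ncd'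
      (fun h => hne (by rw [h]; exact Sym2.eq_swap))
  by_cases hbd : b' = d'
  · subst hbd
    rw [openSegment_symm ℝ (P.pos a'), openSegment_symm ℝ (P.pos c')]
    exact P.generalPosition.disjoint_of_common_end nab'.symm ncd'.symm (fun h => hne (by rw [h]))
  rcases h₁ with ⟨rfl, hb⟩ | ⟨t, e, he, hx, hy⟩
  · rcases h₂ with ⟨rfl, hd⟩ | ⟨t', e', he', hx', hy'⟩
    · exact absurd rfl hac
    · exact P.disjoint_cone hw hh hb nab' he' hx' hy' hne
  · rcases h₂ with ⟨rfl, hd⟩ | ⟨t', e', he', hx', hy'⟩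
    · exact (P.disjoint_cone hw hh hd ncd' he hx hy hne.symm).symm
    · exact P.disjoint_cells hw hh hφ he he' hx hy hx' hy' hac had hbc hbd nab' ncd'

end FramePlacement

end Tiling

/-! ## Local degrees of the colored edges -/

theorem WireColor.mem_list (c : WireColor) : c ∈ [red, blue] := by cases c <;> decide

theorem Shade.mem_list (s : Shade) : s ∈ [light, dark] := by cases s <;> decide

theorem EdgeColor.mem_list (e : EdgeColor) :
    e ∈ [black, wire .red .light, wire .red .dark, wire .blue .light, wire .blue .dark] := by
  rcases e with _ | ⟨_ | _, _ | _⟩ <;> decide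

namespace CellVertex

/-- Twice the horizontal distance from the west boundary of the cell. -/
def colOffset : CellVertex → ℕ
  | b4 | b5 | b6 | b7 | v8 => 0
  | v0 | v1 | v2 | v3 | v4 => 2
  | _ => 1

/-- Twice the vertical distance from the south boundary of the cell. -/
def rowOffset : CellVertex → ℕ
  | v4 | v5 | v6 | v7 | v8 => 0
  | v0 | b1 | b2 | b3 | b4 => 2
  | _ => 1

/-- `b` comes after `a` from north-west to south-east (or before `a`, if `fwd` is false). -/
def ahead (fwd : Bool) (a b : CellVertex) : Bool :=
  if fwd then Nat.blt a.xRank b.xRank else Nat.blt b.xRank a.xRank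

/-- The vertices that the edges in `l` join to `a`, to the south-east or to the north-west. -/
def neighbors (l : List (CellVertex × CellVertex)) (fwd : Bool) (a : CellVertex) :
    List CellVertex :=
  l.filterMap fun e => if e.1 = a ∧ ahead fwd a e.2 = true then some e.2
    else if e.2 = a ∧ ahead fwd a e.1 = true then some e.1 else none

def all : List CellVertex :=
  [v0, v1, v2, v3, v4, v5, v6, v7, v8, b1, b2, b3, b4, b5, b6, b7, p, q]

theorem mem_all (a : CellVertex) : a ∈ all := by cases a <;> decide

end CellVertex

/-- The red and blue edges of `U^χ`. -/
def TileType.wires (τ : TileType) (χ : LocalColoring) : List (CellVertex × CellVertex) :=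
  wireEdges τ .red χ.red ++ wireEdges τ .blue χ.blue

/-- The number of red and blue edges of `U^χ` from `a` to the south-east or the north-west. -/
def TileType.wireDegree (τ : TileType) (χ : LocalColoring) (fwd : Bool) (a : CellVertex) : ℕ :=
  (neighbors (τ.wires χ) fwd a).length

def LocalColoring.opposite (χ : LocalColoring) : LocalColoring := ⟨χ.red.swap, χ.blue.swap⟩

/-- Apart from `v8`, the `x`-order of a cell is the reverse of its `y`-order. Between such vertices
east agrees with south and west with north, so one Boolean covers four directions. -/
def Direction.isForward : Direction → Bool
  | .south | .east => true
  | .north | .west => false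

/-- Decidable version of `TileType.Uses`. -/
def TileType.uses (τ : TileType) (c : WireColor) (d : Direction) : Bool :=
  match τ.route c with
  | none => false
  | some r => r.ends.contains d

theorem TileType.uses_iff {τ : TileType} {c : WireColor} {d : Direction} :
    τ.uses c d = true ↔ τ.Uses c d := by
  unfold uses Uses
  cases τ.route c <;> simp

namespace TileType

/-- `τ'` can be the east neighbour of `τ`. -/
def FitsEast (τ τ' : TileType) : Prop :=
  (∀ c ∈ [WireColor.red, .blue], τ.uses c .east = τ'.uses c .west) ∧
    (τ = .crossingII ↔ τ' = .crossingIII)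

/-- `τ'` can be the north neighbour of `τ`. -/
def FitsNorth (τ τ' : TileType) : Prop :=
  (∀ c ∈ [WireColor.red, .blue], τ.uses c .north = τ'.uses c .south) ∧
    (τ = .crossingIII ↔ τ' = .crossingI) ∧ (τ = .crossingIV ↔ τ' = .crossingII)

instance (τ τ' : TileType) : Decidable (FitsEast τ τ') := by unfold FitsEast; infer_instance
instance (τ τ' : TileType) : Decidable (FitsNorth τ τ') := by unfold FitsNorth; infer_instance

/-- Vertices on the common boundary of two cells, as vertices of the west and the east one. -/
def verticalSides : List (CellVertex × CellVertex) := [(v1, b5), (v2, b6), (v3, b7)]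

/-- Vertices on the common boundary of two cells, as vertices of the south and the north one. -/
def horizontalSides : List (CellVertex × CellVertex) := [(b3, v7), (b2, v6), (b1, v5)]

def bothLight (τ : TileType) (χ : LocalColoring) : Bool :=
  τ.isCritical && χ.red == .light && χ.blue == .light

/-- A curve through the side has, at each of its two vertices there, a light edge in one tile and a
dark edge in the other; equal shades choose exactly one. Other colored edges at these vertices come
as a light and a dark one of the same tile. -/
theorem balanced_vertical {τ τ' : TileType} (hfit : FitsEast τ τ') {χ χ' : LocalColoring}
    (hagree : ∀ c, τ.uses c .east = true → χ.shade c = χ'.shade c) (fwd : Bool)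
    {ab : CellVertex × CellVertex} (hab : ab ∈ verticalSides) :
    τ.wireDegree χ fwd ab.1 + τ'.wireDegree χ' fwd ab.2 =
      τ.wireDegree χ.opposite fwd ab.1 + τ'.wireDegree χ'.opposite fwd ab.2 := by
  have key : ∀ τ ∈ TileType.all, ∀ τ' ∈ TileType.all, FitsEast τ τ' →
      ∀ χ ∈ LocalColoring.all, ∀ χ' ∈ LocalColoring.all,
      (∀ c ∈ [WireColor.red, .blue], τ.uses c .east = true → χ.shade c = χ'.shade c) →
      ∀ fwd ∈ [true, false], ∀ ab ∈ verticalSides,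
      τ.wireDegree χ fwd ab.1 + τ'.wireDegree χ' fwd ab.2 =
      τ.wireDegree χ.opposite fwd ab.1 + τ'.wireDegree χ'.opposite fwd ab.2 := by
    decide +kernel
  exact key τ τ.mem_all τ' τ'.mem_all hfit χ χ.mem_all χ' χ'.mem_all (fun c _ => hagree c)
    fwd (by cases fwd <;> simp) ab hab

/-- The crossing conditions in `FitsNorth` matter: matching colors alone would also allow III below
II and IV below I, whose edges attach at incompatible vertices. -/
theorem balanced_horizontal {τ τ' : TileType} (hfit : FitsNorth τ τ') {χ χ' : LocalColoring}
    (hagree : ∀ c, τ.uses c .north = true → χ.shade c = χ'.shade c) (fwd : Bool)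
    {ab : CellVertex × CellVertex} (hab : ab ∈ horizontalSides) :
    τ.wireDegree χ fwd ab.1 + τ'.wireDegree χ' fwd ab.2 =
      τ.wireDegree χ.opposite fwd ab.1 + τ'.wireDegree χ'.opposite fwd ab.2 := by
  have key : ∀ τ ∈ TileType.all, ∀ τ' ∈ TileType.all, FitsNorth τ τ' →
      ∀ χ ∈ LocalColoring.all, ∀ χ' ∈ LocalColoring.all,
      (∀ c ∈ [WireColor.red, .blue], τ.uses c .north = true → χ.shade c = χ'.shade c) →
      ∀ fwd ∈ [true, false], ∀ ab ∈ horizontalSides,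
      τ.wireDegree χ fwd ab.1 + τ'.wireDegree χ' fwd ab.2 =
      τ.wireDegree χ.opposite fwd ab.1 + τ'.wireDegree χ'.opposite fwd ab.2 := by
    decide +kernel
  exact key τ τ.mem_all τ' τ'.mem_all hfit χ χ.mem_all χ' χ'.mem_all (fun c _ => hagree c)
    fwd (by cases fwd <;> simp) ab hab

/-- A side that no curve uses. -/
theorem balanced_border (τ : TileType) (χ : LocalColoring) (fwd : Bool) :
    ((∀ c, τ.uses c .east = false) → ∀ ab ∈ verticalSides,
      τ.wireDegree χ fwd ab.1 = τ.wireDegree χ.opposite fwd ab.1) ∧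
    ((∀ c, τ.uses c .west = false) → ∀ ab ∈ verticalSides,
      τ.wireDegree χ fwd ab.2 = τ.wireDegree χ.opposite fwd ab.2) ∧
    ((∀ c, τ.uses c .north = false) → ∀ ab ∈ horizontalSides,
      τ.wireDegree χ fwd ab.1 = τ.wireDegree χ.opposite fwd ab.1) ∧
    ((∀ c, τ.uses c .south = false) → ∀ ab ∈ horizontalSides,
      τ.wireDegree χ fwd ab.2 = τ.wireDegree χ.opposite fwd ab.2) := by
  have key : ∀ τ ∈ TileType.all, ∀ χ ∈ LocalColoring.all, ∀ fwd ∈ [true, false],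
      ((∀ c ∈ [WireColor.red, .blue], τ.uses c .east = false) → ∀ ab ∈ verticalSides,
        τ.wireDegree χ fwd ab.1 = τ.wireDegree χ.opposite fwd ab.1) ∧
      ((∀ c ∈ [WireColor.red, .blue], τ.uses c .west = false) → ∀ ab ∈ verticalSides,
        τ.wireDegree χ fwd ab.2 = τ.wireDegree χ.opposite fwd ab.2) ∧
      ((∀ c ∈ [WireColor.red, .blue], τ.uses c .north = false) → ∀ ab ∈ horizontalSides,
        τ.wireDegree χ fwd ab.1 = τ.wireDegree χ.opposite fwd ab.1) ∧
      ((∀ c ∈ [WireColor.red, .blue], τ.uses c .south = false) → ∀ ab ∈ horizontalSides,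
        τ.wireDegree χ fwd ab.2 = τ.wireDegree χ.opposite fwd ab.2) := by
    decide +kernel
  have := key τ τ.mem_all χ χ.mem_all fwd (by cases fwd <;> simp)
  exact ⟨fun h => this.1 fun c _ => h c, fun h => this.2.1 fun c _ => h c,
    fun h => this.2.2.1 fun c _ => h c, fun h => this.2.2.2 fun c _ => h c⟩

theorem balanced_other (τ : TileType) (χ : LocalColoring) (fwd : Bool) {a : CellVertex}
    (ha : a ∈ [v0, v4, v8, b4, p, q]) :
    τ.wireDegree χ fwd a = τ.wireDegree χ.opposite fwd a := by
  have key : ∀ τ ∈ TileType.all, ∀ χ ∈ LocalColoring.all, ∀ fwd ∈ [true, false],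
      ∀ a ∈ [v0, v4, v8, b4, p, q],
      τ.wireDegree χ fwd a = τ.wireDegree χ.opposite fwd a := by decide +kernel
  exact key τ τ.mem_all χ χ.mem_all fwd (by cases fwd <;> simp) a ha

theorem agree_of_vertical_le {τ τ' : TileType} (hfit : FitsEast τ τ') {χ χ' : LocalColoring}
    (hχ : τ.bothLight χ = false) (hχ' : τ'.bothLight χ' = false)
    (hle : ∀ ab ∈ verticalSides, τ.wireDegree χ true ab.1 + τ'.wireDegree χ' true ab.2 ≤
      τ.wireDegree χ.opposite true ab.1 + τ'.wireDegree χ'.opposite true ab.2)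
    {c : WireColor} (hc : τ.uses c .east = true) : χ.shade c = χ'.shade c := by
  have key : ∀ τ ∈ TileType.all, ∀ τ' ∈ TileType.all, FitsEast τ τ' →
      ∀ χ ∈ LocalColoring.all, ∀ χ' ∈ LocalColoring.all, τ.bothLight χ = false →
      τ'.bothLight χ' = false →
      (∀ ab ∈ verticalSides, τ.wireDegree χ true ab.1 + τ'.wireDegree χ' true ab.2 ≤
      τ.wireDegree χ.opposite true ab.1 + τ'.wireDegree χ'.opposite true ab.2) →
      ∀ c ∈ [WireColor.red, .blue], τ.uses c .east = true → χ.shade c = χ'.shade c := by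
    decide +kernel
  exact key τ τ.mem_all τ' τ'.mem_all hfit χ χ.mem_all χ' χ'.mem_all hχ hχ' hle c c.mem_list hc

/-- Two curves through a horizontal side share only its middle vertex. Each outer vertex gives one
implication for one color and the middle vertex turns both into equalities, so no condition on
critical tiles is needed. -/
theorem agree_of_horizontal_le {τ τ' : TileType} (hfit : FitsNorth τ τ') {χ χ' : LocalColoring}
    (hle : ∀ ab ∈ horizontalSides, τ.wireDegree χ false ab.1 + τ'.wireDegree χ' false ab.2 ≤
      τ.wireDegree χ.opposite false ab.1 + τ'.wireDegree χ'.opposite false ab.2)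
    {c : WireColor} (hc : τ.uses c .north = true) : χ.shade c = χ'.shade c := by
  have key : ∀ τ ∈ TileType.all, ∀ τ' ∈ TileType.all, FitsNorth τ τ' →
      ∀ χ ∈ LocalColoring.all, ∀ χ' ∈ LocalColoring.all,
      (∀ ab ∈ horizontalSides, τ.wireDegree χ false ab.1 + τ'.wireDegree χ' false ab.2 ≤
      τ.wireDegree χ.opposite false ab.1 + τ'.wireDegree χ'.opposite false ab.2) →
      ∀ c ∈ [WireColor.red, .blue], τ.uses c .north = true → χ.shade c = χ'.shade c := by
    decide +kernel
  exact key τ τ.mem_all τ' τ'.mem_all hfit χ χ.mem_all χ' χ'.mem_all hle c c.mem_list hc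

/-- An edge of `U` has only one color. -/
theorem color_unique (τ : TileType) {e e' : EdgeColor} (he : e ≠ .black)
    {a b : CellVertex} (h : (a, b) ∈ τ.gadgetEdges e)
    (h' : (a, b) ∈ τ.gadgetEdges e' ∨ (b, a) ∈ τ.gadgetEdges e') : e' = e := by
  have key : ∀ τ ∈ TileType.all, ∀ e ∈ [EdgeColor.wire .red .light, .wire .red .dark,
      .wire .blue .light, .wire .blue .dark],
      ∀ e' ∈ [EdgeColor.black, .wire .red .light, .wire .red .dark,
      .wire .blue .light, .wire .blue .dark], ∀ ab ∈ τ.gadgetEdges e,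
      (ab ∈ τ.gadgetEdges e' ∨ ab.swap ∈ τ.gadgetEdges e') → e' = e := by decide +kernel
  exact key τ τ.mem_all e (by have := e.mem_list; simp_all) e' e'.mem_list (a, b) h h'

/-- No colored edge runs along a side of its cell, so it determines the cell. Avoiding `v8` makes
its direction computable by `ahead`. -/
theorem wire_facts (τ : TileType) (c : WireColor) (s : Shade) {ab : CellVertex × CellVertex}
    (h : ab ∈ wireEdges τ c s) : ¬ (ab.1.colOffset = 0 ∧ ab.2.colOffset = 0) ∧
      ¬ (ab.1.colOffset = 2 ∧ ab.2.colOffset = 2) ∧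
      ¬ (ab.1.rowOffset = 0 ∧ ab.2.rowOffset = 0) ∧
      ¬ (ab.1.rowOffset = 2 ∧ ab.2.rowOffset = 2) ∧ ab.1 ≠ v8 ∧ ab.2 ≠ v8 ∧ ab.1 ≠ ab.2 ∧
      (ab.1 = p ∨ ab.2 = p → τ.hasP = true) ∧ (ab.1 = q ∨ ab.2 = q → τ.hasQ = true) := by
  have key : ∀ τ ∈ TileType.all, ∀ c ∈ [WireColor.red, .blue], ∀ s ∈ [Shade.light, .dark],
      ∀ ab ∈ wireEdges τ c s, ¬ (ab.1.colOffset = 0 ∧ ab.2.colOffset = 0) ∧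
      ¬ (ab.1.colOffset = 2 ∧ ab.2.colOffset = 2) ∧
      ¬ (ab.1.rowOffset = 0 ∧ ab.2.rowOffset = 0) ∧
      ¬ (ab.1.rowOffset = 2 ∧ ab.2.rowOffset = 2) ∧ ab.1 ≠ v8 ∧ ab.2 ≠ v8 ∧ ab.1 ≠ ab.2 ∧
      (ab.1 = p ∨ ab.2 = p → τ.hasP = true) ∧ (ab.1 = q ∨ ab.2 = q → τ.hasQ = true) := by
    decide +kernel
  exact key τ τ.mem_all c c.mem_list s s.mem_list ab h

/-- Makes the length of the list in `wireDegree` equal to a number of vertices. -/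
theorem nodup_neighbors (τ : TileType) (χ : LocalColoring) (fwd : Bool) (a : CellVertex) :
    (neighbors (τ.wires χ) fwd a).Nodup := by
  have key : ∀ τ ∈ TileType.all, ∀ χ ∈ LocalColoring.all, ∀ fwd ∈ [true, false],
      ∀ a ∈ CellVertex.all, (neighbors (τ.wires χ) fwd a).Nodup := by decide +kernel
  exact key τ τ.mem_all χ χ.mem_all fwd (by cases fwd <;> simp) a a.mem_all

theorem wireEdges_eq_nil_iff (τ : TileType) (c : WireColor) (s : Shade) :
    wireEdges τ c s = [] ↔ τ.route c = none := by
  have key : ∀ τ ∈ TileType.all, ∀ c ∈ [WireColor.red, .blue], ∀ s ∈ [Shade.light, .dark],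
    wireEdges τ c s = [] ↔ τ.route c = none := by decide +kernel
  exact key τ τ.mem_all c c.mem_list s s.mem_list

end TileType

/-! ## Cardinal degrees -/

section CardinalDegree

variable {V : Type} [Finite V] {pos : V → ℝ × ℝ}

theorem cardinalDegree_sup {G H : SimpleGraph V} (hGH : ∀ x y, G.Adj x y → ¬ H.Adj x y)
    (d : Direction) (v : V) :
    cardinalDegree pos (G ⊔ H) d v = cardinalDegree pos G d v + cardinalDegree pos H d v := by
  unfold cardinalDegree
  rw [← Set.ncard_union_eq]
  · congr 1
    ext u
    simp only [SimpleGraph.sup_adj, Set.mem_ofPred_eq, Set.mem_union]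
    tauto
  · rw [Set.disjoint_left]
    rintro u ⟨h, -⟩ ⟨h', -⟩
    exact hGH _ _ h h'

theorem cardinalDegree_iSup {ι : Type} [Fintype ι] {G : ι → SimpleGraph V}
    (hG : ∀ i j x y, (G i).Adj x y → (G j).Adj x y → i = j) (d : Direction) (v : V) :
    cardinalDegree pos (⨆ i, G i) d v = ∑ i, cardinalDegree pos (G i) d v := by
  classical
  have key : ∀ s : Finset ι, cardinalDegree pos (⨆ i ∈ s, G i) d v =
      ∑ i ∈ s, cardinalDegree pos (G i) d v := by
    intro s
    induction s using Finset.induction_on with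
    | empty => simp [cardinalDegree]
    | insert a s ha ih =>
      rw [Finset.iSup_insert, Finset.sum_insert ha, ← ih]
      apply cardinalDegree_sup
      intro x y h h'
      simp only [SimpleGraph.iSup_adj, exists_prop] at h'
      obtain ⟨j, hj, h'⟩ := h'
      exact ha (hG a j x y h h' ▸ hj)
  simpa using key Finset.univ

theorem cardinalDegree_pos_iff {G : SimpleGraph V} {d : Direction} {v : V} :
    0 < cardinalDegree pos G d v ↔ ∃ u, G.Adj v u ∧ d.Sees (pos v) (pos u) :=
  Set.ncard_pos (Set.toFinite _)

theorem cardinalDegree_mono {G H : SimpleGraph V} (h : G ≤ H) (d : Direction) (v : V) :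
    cardinalDegree pos G d v ≤ cardinalDegree pos H d v :=
  Set.ncard_le_ncard (fun _ hu => ⟨h hu.1, hu.2⟩) (Set.toFinite _)

/-- A star at the lowest vertex is determined by its cardinal degrees. -/
theorem eq_of_cardinalDegree_eq_of_star {R K : SimpleGraph V} {c : V}
    (hpos : Function.Injective fun v => (pos v).2) (hc : ∀ v, v ≠ c → (pos c).2 < (pos v).2)
    (hK : ∀ x y, K.Adj x y → x = c ∨ y = c)
    (hdeg : ∀ d v, cardinalDegree pos R d v = cardinalDegree pos K d v) : R = K := by
  have south : ∀ (v : V), v ≠ c → ∀ G : SimpleGraph V, G.Adj v c →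
      0 < cardinalDegree pos G .south v := fun v hv G h =>
    cardinalDegree_pos_iff.2 ⟨c, h, hc v hv⟩
  have southK : ∀ v, v ≠ c → 0 < cardinalDegree pos K .south v → K.Adj v c := by
    intro v hv h
    obtain ⟨u, hu, -⟩ := cardinalDegree_pos_iff.1 h
    rcases hK _ _ hu with h | rfl
    · exact absurd h hv
    · exact hu
  -- In the star only `c` has a neighbor to its north. Equal degrees make `c` the lower end of every
  -- edge of `R`, and the south-degree of the upper end shows that the star has this edge too.
  have low : ∀ x y, R.Adj x y → (pos x).2 < (pos y).2 → K.Adj x y := by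
    intro x y h hxy
    have h₁ : 0 < cardinalDegree pos R .north x := cardinalDegree_pos_iff.2 ⟨y, h, hxy⟩
    rw [hdeg] at h₁
    obtain ⟨u, hu, hxu⟩ := cardinalDegree_pos_iff.1 h₁
    have hxc : x = c := by
      by_contra hxc
      rcases hK _ _ hu with h | rfl
      · exact hxc h
      · exact lt_asymm hxu (hc x hxc)
    subst hxc
    have h₂ := south y h.ne' R h.symm
    rw [hdeg] at h₂
    exact (southK y h.ne' h₂).symm
  have hRK : R ≤ K := by
    intro x y h
    rcases lt_trichotomy (pos x).2 (pos y).2 with h' | h' | h'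
    · exact low x y h h'
    · exact absurd (hpos h') h.ne
    · exact (low y x h.symm h').symm
  have hKR : ∀ v, K.Adj v c → R.Adj v c := by
    intro v h
    have h₂ := south v h.ne K h
    rw [← hdeg] at h₂
    obtain ⟨u, hu, -⟩ := cardinalDegree_pos_iff.1 h₂
    rcases hK _ _ (hRK hu) with h' | rfl
    · exact absurd h' h.ne
    · exact hu
  refine le_antisymm hRK fun x y h => ?_
  rcases hK _ _ h with rfl | rfl
  · exact (hKR y h.symm).symm
  · exact hKR x h

end CardinalDegree

/-! ## Cardinal degrees of the colored edges -/

namespace Tiling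

variable {w h : ℕ} {X : Tiling w h}

/-- The column of a vertex, in half cells. -/
def Vertex.col : X.Vertex → ℕ
  | .corner i _ => 2 * i
  | .vert i _ _ => 2 * i
  | .horiz i _ _ => 2 * i + 1
  | .innerP t _ => 2 * t.1 + 1
  | .innerQ t _ => 2 * t.1 + 1
  | .cone => 0

/-- The row of a vertex, in half cells. -/
def Vertex.row : X.Vertex → ℕ
  | .corner _ j => 2 * j
  | .vert _ j _ => 2 * j + 1
  | .horiz _ j _ => 2 * j
  | .innerP t _ => 2 * t.2 + 1
  | .innerQ t _ => 2 * t.2 + 1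
  | .cone => 0

theorem col_row_eq {t : Tile w h} {a : CellVertex} {x : X.Vertex}
    (hx : X.cellVertex t a = some x) :
    x.col = 2 * t.1 + a.colOffset ∧ x.row = 2 * t.2 + a.rowOffset := by
  cases a
  case p =>
    simp only [cellVertex] at hx
    split at hx
    · obtain rfl := Option.some_injective _ hx; exact ⟨rfl, rfl⟩
    · cases hx
  case q =>
    simp only [cellVertex] at hx
    split at hx
    · obtain rfl := Option.some_injective _ hx; exact ⟨rfl, rfl⟩
    · cases hx
  all_goals
    obtain rfl := Option.some_injective _ hx
    constructor <;> simp [Vertex.col, Vertex.row, colOffset, rowOffset] <;> omega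

theorem cellVertex_ne_cone (t : Tile w h) (a : CellVertex) :
    X.cellVertex t a ≠ some .cone := by
  cases a <;> simp [cellVertex]

/-- In half-cell coordinates, two cells containing both ends of an edge would force these ends onto
a common side of the cell, which `wire_facts` forbids. Within one cell `color_unique` decides. -/
theorem FramePlacement.colorGraph_unique (P : X.FramePlacement) {t t' : Tile w h} {c : WireColor}
    {s : Shade} {e : EdgeColor} {x y : X.Vertex} (h : (X.colorGraph t (.wire c s)).Adj x y)
    (h' : (X.colorGraph t' e).Adj x y) : t' = t ∧ e = .wire c s := by
  have key : ∀ (x y : X.Vertex), ∀ ab ∈ (X.type t).gadgetEdges (.wire c s),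
      X.cellVertex t ab.1 = some x → X.cellVertex t ab.2 = some y →
      (X.colorGraph t' e).Adj x y → t' = t ∧ e = .wire c s := by
    intro x y ab hab hx hy h'
    obtain ⟨-, ab', hab', h'⟩ := X.colorGraph_adj.1 h'
    obtain ⟨f₁, f₂, f₃, f₄, -⟩ := TileType.wire_facts _ _ _ hab
    have ex := col_row_eq hx
    have ey := col_row_eq hy
    have off : ∀ a : CellVertex, a.colOffset ≤ 2 ∧ a.rowOffset ≤ 2 := by
      intro a; cases a <;> decide
    have o₁ := off ab.1
    have o₂ := off ab.2
    have o₃ := off ab'.1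
    have o₄ := off ab'.2
    have ht : t' = t := by
      rcases h' with ⟨hx', hy'⟩ | ⟨hx', hy'⟩ <;>
      · have ex' := col_row_eq hx'
        have ey' := col_row_eq hy'
        refine Prod.ext (Fin.ext ?_) (Fin.ext ?_) <;> omega
    subst ht
    refine ⟨rfl, TileType.color_unique (X.type t') (by simp) (a := ab.1) (b := ab.2) hab ?_⟩
    rcases h' with ⟨hx', hy'⟩ | ⟨hx', hy'⟩
    · left
      rw [P.cellVertex_injective hx hx', P.cellVertex_injective hy hy']; exact hab'
    · right
      rw [P.cellVertex_injective hx hy', P.cellVertex_injective hy hx']; exact hab'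
  obtain ⟨-, ab, hab, ⟨hx, hy⟩ | ⟨hx, hy⟩⟩ := X.colorGraph_adj.1 h
  · exact key x y ab hab hx hy h'
  · exact key y x ab hab hx hy h'.symm

/-- The red and blue edges of `U^χ` in the frame cell of `t`. -/
def tileWires (X : Tiling w h) (t : Tile w h) (χ : LocalColoring) : SimpleGraph X.Vertex :=
  ⨆ c, X.colorGraph t (.wire c (χ.shade c))

theorem tileWires_adj {t : Tile w h} {χ : LocalColoring} {x y : X.Vertex} :
    (X.tileWires t χ).Adj x y ↔ x ≠ y ∧ ∃ ab ∈ (X.type t).wires χ,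
      (X.cellVertex t ab.1 = some x ∧ X.cellVertex t ab.2 = some y) ∨
      (X.cellVertex t ab.1 = some y ∧ X.cellVertex t ab.2 = some x) := by
  simp only [tileWires, SimpleGraph.iSup_adj, colorGraph_adj, TileType.wires, List.mem_append]
  constructor
  · rintro ⟨_ | _, hne, ab, hab, h⟩
    · exact ⟨hne, ab, .inl hab, h⟩
    · exact ⟨hne, ab, .inr hab, h⟩
  · rintro ⟨hne, ab, hab | hab, h⟩
    · exact ⟨.red, hne, ab, hab, h⟩
    · exact ⟨.blue, hne, ab, hab, h⟩

theorem mem_wires {τ : TileType} {χ : LocalColoring} {ab : CellVertex × CellVertex}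
    (h : ab ∈ τ.wires χ) : ∃ c s, ab ∈ wireEdges τ c s := by
  rcases List.mem_append.1 h with h | h
  exacts [⟨_, _, h⟩, ⟨_, _, h⟩]

theorem isSome_of_mem_wires {t : Tile w h} {χ : LocalColoring} {ab : CellVertex × CellVertex}
    (h : ab ∈ (X.type t).wires χ) :
    (X.cellVertex t ab.1).isSome = true ∧ (X.cellVertex t ab.2).isSome = true := by
  obtain ⟨c, s, h⟩ := mem_wires h
  obtain ⟨-, -, -, -, -, -, -, hp, hq⟩ := TileType.wire_facts _ _ _ h
  have key : ∀ a, (a = p → (X.type t).hasP = true) → (a = q → (X.type t).hasQ = true) →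
      (X.cellVertex t a).isSome = true := by
    intro a hp hq
    cases a
    case p => simp [cellVertex, hp]
    case q => simp [cellVertex, hq]
    all_goals rfl
  exact ⟨key _ (fun e => hp (.inl e)) (fun e => hq (.inl e)),
    key _ (fun e => hp (.inr e)) (fun e => hq (.inr e))⟩

namespace FramePlacement

variable (P : X.FramePlacement)

theorem sees_iff {t : Tile w h} {a b : CellVertex} {x y : X.Vertex}
    (hx : X.cellVertex t a = some x) (hy : X.cellVertex t b = some y) (ha : a ≠ v8) (hb : b ≠ v8)
    (hab : a ≠ b) (d : Direction) :
    d.Sees (P.pos x) (P.pos y) ↔ ahead d.isForward a b = true := by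
  have anti : a.xRank < b.xRank → b.yRank < a.yRank := by
    cases a <;> cases b <;> first | exact absurd rfl ha | exact absurd rfl hb | decide
  have anti' : b.xRank < a.xRank → a.yRank < b.yRank := by
    cases a <;> cases b <;> first | exact absurd rfl ha | exact absurd rfl hb | decide
  rcases lt_trichotomy a.xRank b.xRank with hr | hr | hr
  · have h₁ := P.x_lt_of_xRank hx hy hr
    have h₂ := P.y_lt_of_yRank hy hx (anti hr)
    cases d <;> simp [Direction.Sees, ahead, Direction.isForward, Nat.blt_eq, hr, hr.not_gt, h₁, h₂,
      h₁.not_gt, h₂.not_gt]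
  · exact absurd (xRank_injective hr) hab
  · have h₁ := P.x_lt_of_xRank hy hx hr
    have h₂ := P.y_lt_of_yRank hx hy (anti' hr)
    cases d <;> simp [Direction.Sees, ahead, Direction.isForward, Nat.blt_eq, hr, hr.not_gt, h₁, h₂,
      h₁.not_gt, h₂.not_gt]

/-- Links the degrees in the plane to the counts on which the finite checks operate. -/
theorem cardinalDegree_tileWires {t : Tile w h} (χ : LocalColoring) {a : CellVertex}
    {x : X.Vertex} (hx : X.cellVertex t a = some x) (d : Direction) :
    cardinalDegree P.pos (X.tileWires t χ) d x =
      (X.type t).wireDegree χ d.isForward a := by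
  classical
  set l := neighbors ((X.type t).wires χ) d.isForward a with hl
  have hmem : ∀ b, b ∈ l ↔ ahead d.isForward a b = true ∧
      ((a, b) ∈ (X.type t).wires χ ∨ (b, a) ∈ (X.type t).wires χ) := by
    intro b
    simp only [hl, neighbors, List.mem_filterMap]
    constructor
    · rintro ⟨⟨e₁, e₂⟩, he, h⟩
      split_ifs at h with h₁ h₂
      · obtain rfl := Option.some_injective _ h
        obtain ⟨rfl, h₁⟩ := h₁
        exact ⟨h₁, .inl he⟩
      · obtain rfl := Option.some_injective _ h
        obtain ⟨rfl, h₂⟩ := h₂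
        exact ⟨h₂, .inr he⟩
    · rintro ⟨h, he | he⟩
      · exact ⟨_, he, by simp [h]⟩
      · refine ⟨_, he, ?_⟩
        rw [if_neg, if_pos ⟨rfl, h⟩]
        rintro ⟨h', -⟩
        obtain ⟨c, s, he⟩ := mem_wires he
        exact (TileType.wire_facts _ _ _ he).2.2.2.2.2.2.1 h'
  have hset : {u | (X.tileWires t χ).Adj x u ∧ d.Sees (P.pos x) (P.pos u)} =
      -- The default `.cone` is never reached, as all ends of colored edges are present.
      (fun b => (X.cellVertex t b).getD .cone) '' (l.toFinset : Set CellVertex) := by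
    ext u
    simp only [Set.mem_ofPred_eq, Set.mem_image, Finset.mem_coe, List.mem_toFinset, hmem,
      tileWires_adj]
    constructor
    · rintro ⟨⟨hne, ⟨e₁, e₂⟩, he, ⟨h₁, h₂⟩ | ⟨h₁, h₂⟩⟩, hs⟩
      · obtain rfl := P.cellVertex_injective hx h₁
        obtain ⟨c, s, he'⟩ := mem_wires he
        obtain ⟨-, -, -, -, f₁, f₂, f₃, -⟩ := TileType.wire_facts _ _ _ he'
        exact ⟨e₂, ⟨(P.sees_iff hx h₂ f₁ f₂ f₃ d).1 hs, .inl he⟩, by simp [h₂]⟩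
      · obtain rfl := P.cellVertex_injective hx h₂
        obtain ⟨c, s, he'⟩ := mem_wires he
        obtain ⟨-, -, -, -, f₁, f₂, f₃, -⟩ := TileType.wire_facts _ _ _ he'
        exact ⟨e₁, ⟨(P.sees_iff hx h₁ f₂ f₁ f₃.symm d).1 hs, .inr he⟩, by simp [h₁]⟩
    · rintro ⟨b, ⟨hb, he⟩, rfl⟩
      have hbs : (X.cellVertex t b).isSome = true := by
        rcases he with he | he
        exacts [(isSome_of_mem_wires he).2, (isSome_of_mem_wires he).1]
      obtain ⟨u, hu⟩ := Option.isSome_iff_exists.1 hbs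
      have facts : a ≠ v8 ∧ b ≠ v8 ∧ a ≠ b := by
        rcases he with he | he <;> obtain ⟨c, s, he'⟩ := mem_wires he <;>
          obtain ⟨-, -, -, -, f₁, f₂, f₃, -⟩ := TileType.wire_facts _ _ _ he'
        exacts [⟨f₁, f₂, f₃⟩, ⟨f₂, f₁, f₃.symm⟩]
      simp only [hu, Option.getD_some]
      refine ⟨⟨?_, ?_⟩, (P.sees_iff hx hu facts.1 facts.2.1 facts.2.2 d).2 hb⟩
      · rintro rfl
        exact facts.2.2 (P.cellVertex_injective hx hu)
      · rcases he with he | he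
        exacts [⟨_, he, .inl ⟨hx, hu⟩⟩, ⟨_, he, .inr ⟨hu, hx⟩⟩]
  rw [cardinalDegree, hset, Set.InjOn.ncard_image, Set.ncard_coe_finset,
    List.toFinset_card_of_nodup (TileType.nodup_neighbors _ _ _ _), TileType.wireDegree]
  intro b hb b' hb' hbb
  have some' : ∀ b ∈ (l.toFinset : Set CellVertex), (X.cellVertex t b).isSome = true := by
    intro b hb
    rw [Finset.mem_coe, List.mem_toFinset, hmem] at hb
    rcases hb.2 with he | he
    exacts [(isSome_of_mem_wires he).2, (isSome_of_mem_wires he).1]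
  obtain ⟨u, hu⟩ := Option.isSome_iff_exists.1 (some' b hb)
  obtain ⟨u', hu'⟩ := Option.isSome_iff_exists.1 (some' b' hb')
  simp only [hu, hu', Option.getD_some] at hbb
  subst hbb
  exact P.cellVertex_injective hu hu'

theorem cardinalDegree_tileWires_eq_zero {t : Tile w h} (χ : LocalColoring)
    {x : X.Vertex} (hx : ∀ a, X.cellVertex t a ≠ some x) (d : Direction) :
    cardinalDegree P.pos (X.tileWires t χ) d x = 0 := by
  rw [← Nat.le_zero, ← not_lt, cardinalDegree_pos_iff]
  rintro ⟨u, hu, -⟩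
  obtain ⟨-, ab, -, h | h⟩ := tileWires_adj.1 hu
  exacts [hx _ h.1, hx _ h.2]

theorem cardinalDegree_shadedGraph (φ : Tile w h → LocalColoring) (d : Direction) (x : X.Vertex) :
    cardinalDegree P.pos (X.shadedGraph φ) d x =
      ∑ t, cardinalDegree P.pos (X.tileWires t (φ t)) d x := by
  apply cardinalDegree_iSup
  intro t t' x y h₁ h₂
  simp only [SimpleGraph.iSup_adj] at h₁ h₂
  obtain ⟨c, h₁⟩ := h₁
  obtain ⟨c', h₂⟩ := h₂
  exact (P.colorGraph_unique h₁ h₂).1.symm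

theorem fits_east {t t' : Tile w h} (h₁ : (t.1 : ℕ) + 1 = t'.1) (h₂ : t.2 = t'.2) :
    (X.type t).FitsEast (X.type t') := by
  obtain ⟨i, j⟩ := t
  obtain ⟨i', j'⟩ := t'
  obtain rfl : j = j' := h₂
  refine ⟨fun c _ => ?_, X.crossing_II_III i i' j h₁⟩
  rw [Bool.eq_iff_iff, TileType.uses_iff, TileType.uses_iff]
  exact X.match_horizontal i i' j c h₁

theorem fits_north {t t' : Tile w h} (h₁ : t.1 = t'.1) (h₂ : (t.2 : ℕ) + 1 = t'.2) :
    (X.type t).FitsNorth (X.type t') := by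
  obtain ⟨i, j⟩ := t
  obtain ⟨i', j'⟩ := t'
  obtain rfl : i = i' := h₁
  refine ⟨fun c _ => ?_, X.crossing_III_I i j j' h₂, X.crossing_IV_II i j j' h₂⟩
  rw [Bool.eq_iff_iff, TileType.uses_iff, TileType.uses_iff]
  exact X.match_vertical i j j' c h₂

end FramePlacement

end Tiling

/-! ## Balanced local colorings -/

namespace Tiling

variable {w h : ℕ} {X : Tiling w h}

theorem exists_verticalSides (X : Tiling w h) (k : Fin 3) : ∃ ab ∈ TileType.verticalSides,
    ∀ t, X.cellVertex t ab.1 = some (.vert t.1.succ t.2 k) ∧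
      X.cellVertex t ab.2 = some (.vert t.1.castSucc t.2 k) := by
  fin_cases k
  exacts [⟨(v1, b5), by decide, fun _ => ⟨rfl, rfl⟩⟩, ⟨(v2, b6), by decide, fun _ => ⟨rfl, rfl⟩⟩,
    ⟨(v3, b7), by decide, fun _ => ⟨rfl, rfl⟩⟩]

theorem exists_horizontalSides (X : Tiling w h) (k : Fin 3) : ∃ ab ∈ TileType.horizontalSides,
    ∀ t, X.cellVertex t ab.1 = some (.horiz t.1 t.2.succ k) ∧
      X.cellVertex t ab.2 = some (.horiz t.1 t.2.castSucc k) := by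
  fin_cases k
  exacts [⟨(b3, v7), by decide, fun _ => ⟨rfl, rfl⟩⟩, ⟨(b2, v6), by decide, fun _ => ⟨rfl, rfl⟩⟩,
    ⟨(b1, v5), by decide, fun _ => ⟨rfl, rfl⟩⟩]

theorem exists_vert_of_verticalSides (X : Tiling w h) {ab : CellVertex × CellVertex}
    (hab : ab ∈ TileType.verticalSides) : ∃ k, ∀ t,
      X.cellVertex t ab.1 = some (.vert t.1.succ t.2 k) ∧
      X.cellVertex t ab.2 = some (.vert t.1.castSucc t.2 k) := by
  fin_cases hab
  exacts [⟨0, fun _ => ⟨rfl, rfl⟩⟩, ⟨1, fun _ => ⟨rfl, rfl⟩⟩, ⟨2, fun _ => ⟨rfl, rfl⟩⟩]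

theorem exists_horiz_of_horizontalSides (X : Tiling w h) {ab : CellVertex × CellVertex}
    (hab : ab ∈ TileType.horizontalSides) : ∃ k, ∀ t,
      X.cellVertex t ab.1 = some (.horiz t.1 t.2.succ k) ∧
      X.cellVertex t ab.2 = some (.horiz t.1 t.2.castSucc k) := by
  fin_cases hab
  exacts [⟨0, fun _ => ⟨rfl, rfl⟩⟩, ⟨1, fun _ => ⟨rfl, rfl⟩⟩, ⟨2, fun _ => ⟨rfl, rfl⟩⟩]

theorem tile_of_vert {t : Tile w h} {a : CellVertex} {i : Fin (w + 1)} {j : Fin h} {k : Fin 3}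
    (ha : X.cellVertex t a = some (.vert i j k)) :
    t.2 = j ∧ (t.1.succ = i ∨ t.1.castSucc = i) := by
  cases a <;> simp [cellVertex] at ha <;> tauto

theorem tile_of_horiz {t : Tile w h} {a : CellVertex} {i : Fin w} {j : Fin (h + 1)} {k : Fin 3}
    (ha : X.cellVertex t a = some (.horiz i j k)) :
    t.1 = i ∧ (t.2.succ = j ∨ t.2.castSucc = j) := by
  cases a <;> simp [cellVertex] at ha <;> tauto

namespace FramePlacement

variable (P : X.FramePlacement)

theorem cardinalDegree_shadedGraph_of_unique {t : Tile w h} {a : CellVertex} {x : X.Vertex}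
    (ha : X.cellVertex t a = some x) (hx : ∀ t' a', X.cellVertex t' a' = some x → t' = t)
    (φ : Tile w h → LocalColoring) (d : Direction) :
    cardinalDegree P.pos (X.shadedGraph φ) d x =
      (X.type t).wireDegree (φ t) d.isForward a := by
  rw [P.cardinalDegree_shadedGraph, Fintype.sum_eq_single t, P.cardinalDegree_tileWires _ ha]
  intro t' ht'
  exact P.cardinalDegree_tileWires_eq_zero _ (fun a' ha' => ht' (hx t' a' ha')) d

theorem cardinalDegree_shadedGraph_of_two {t t' : Tile w h} {a a' : CellVertex} {x : X.Vertex}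
    (htt : t ≠ t') (ha : X.cellVertex t a = some x) (ha' : X.cellVertex t' a' = some x)
    (hx : ∀ s b, X.cellVertex s b = some x → s = t ∨ s = t')
    (φ : Tile w h → LocalColoring) (d : Direction) :
    cardinalDegree P.pos (X.shadedGraph φ) d x =
      (X.type t).wireDegree (φ t) d.isForward a +
      (X.type t').wireDegree (φ t') d.isForward a' := by
  rw [P.cardinalDegree_shadedGraph, Fintype.sum_eq_add t t' htt, P.cardinalDegree_tileWires _ ha,
    P.cardinalDegree_tileWires _ ha']
  rintro s ⟨h₁, h₂⟩
  refine P.cardinalDegree_tileWires_eq_zero _ (fun b hb => ?_) d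
  rcases hx s b hb with h | h
  exacts [h₁ h, h₂ h]

theorem cardinalDegree_verticalSide {t t' : Tile w h} (h₁ : (t.1 : ℕ) + 1 = t'.1)
    (h₂ : t.2 = t'.2) {a a' : CellVertex} {k : Fin 3}
    (ha : X.cellVertex t a = some (.vert t.1.succ t.2 k))
    (ha' : X.cellVertex t' a' = some (.vert t'.1.castSucc t'.2 k))
    (φ : Tile w h → LocalColoring) (d : Direction) :
    cardinalDegree P.pos (X.shadedGraph φ) d (.vert t.1.succ t.2 k) =
      (X.type t).wireDegree (φ t) d.isForward a +
      (X.type t').wireDegree (φ t') d.isForward a' := by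
  have hi : t'.1.castSucc = t.1.succ := Fin.ext (by simp [← h₁])
  refine P.cardinalDegree_shadedGraph_of_two (by rintro rfl; omega) ha
    (by rw [ha', hi, h₂]) ?_ φ d
  intro s b hb
  obtain ⟨hs, hs' | hs'⟩ := tile_of_vert hb
  · exact .inl (Prod.ext (Fin.succ_injective _ hs') hs)
  · exact .inr (Prod.ext (Fin.castSucc_injective _ (hs'.trans hi.symm)) (hs.trans h₂))

theorem cardinalDegree_horizontalSide {t t' : Tile w h} (h₁ : t.1 = t'.1)
    (h₂ : (t.2 : ℕ) + 1 = t'.2) {a a' : CellVertex} {k : Fin 3}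
    (ha : X.cellVertex t a = some (.horiz t.1 t.2.succ k))
    (ha' : X.cellVertex t' a' = some (.horiz t'.1 t'.2.castSucc k))
    (φ : Tile w h → LocalColoring) (d : Direction) :
    cardinalDegree P.pos (X.shadedGraph φ) d (.horiz t.1 t.2.succ k) =
      (X.type t).wireDegree (φ t) d.isForward a +
      (X.type t').wireDegree (φ t') d.isForward a' := by
  have hj : t'.2.castSucc = t.2.succ := Fin.ext (by simp [← h₂])
  refine P.cardinalDegree_shadedGraph_of_two (by rintro rfl; omega) ha
    (by rw [ha', hj, h₁]) ?_ φ d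
  intro s b hb
  obtain ⟨hs, hs' | hs'⟩ := tile_of_horiz hb
  · exact .inl (Prod.ext hs (Fin.succ_injective _ hs'))
  · exact .inr (Prod.ext (hs.trans h₁) (Fin.castSucc_injective _ (hs'.trans hj.symm)))

theorem balanced_of_other {x : X.Vertex}
    (hx : ∀ t a, X.cellVertex t a = some x → a ∈ [v0, v4, v8, b4, p, q])
    (φ : Tile w h → LocalColoring) (d : Direction) :
    cardinalDegree P.pos (X.shadedGraph φ) d x =
      cardinalDegree P.pos (X.shadedGraph (oppositeShades φ)) d x := by
  rw [P.cardinalDegree_shadedGraph, P.cardinalDegree_shadedGraph]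
  refine Finset.sum_congr rfl fun t _ => ?_
  by_cases ha : ∃ a, X.cellVertex t a = some x
  · obtain ⟨a, ha⟩ := ha
    rw [P.cardinalDegree_tileWires _ ha, P.cardinalDegree_tileWires _ ha]
    exact TileType.balanced_other _ _ _ (hx t a ha)
  · push Not at ha
    rw [P.cardinalDegree_tileWires_eq_zero _ ha, P.cardinalDegree_tileWires_eq_zero _ ha]

/-- If the shades agree along the curves, then every vertex has as many chosen as unchosen
colored edges in each direction. -/
theorem balanced {φ : Tile w h → LocalColoring}
    (hφ : ∀ c t t', X.Linked c t t' → (φ t).shade c = (φ t').shade c) (d : Direction)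
    (x : X.Vertex) :
    cardinalDegree P.pos (X.shadedGraph φ) d x =
      cardinalDegree P.pos (X.shadedGraph (oppositeShades φ)) d x := by
  have notUses : ∀ {τ : TileType} {d}, (∀ c, ¬ τ.Uses c d) → ∀ c, τ.uses c d = false := by
    intro τ d hτ c
    rw [← Bool.not_eq_true, TileType.uses_iff]
    exact hτ c
  cases x with
  | corner i j =>
    exact P.balanced_of_other
      (fun t a ha => by cases a <;> (simp [cellVertex] at ha; try decide)) φ d
  | innerP t ht =>
    exact P.balanced_of_other
      (fun t a ha => by cases a <;> (simp [cellVertex] at ha; try decide)) φ d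
  | innerQ t ht =>
    exact P.balanced_of_other
      (fun t a ha => by cases a <;> (simp [cellVertex] at ha; try decide)) φ d
  | cone => exact P.balanced_of_other (fun t a ha => absurd ha (cellVertex_ne_cone t a)) φ d
  | vert i j k =>
    obtain ⟨ab, hab, hv⟩ := X.exists_verticalSides k
    by_cases hE : ∃ a : Fin w, a.succ = i
    · obtain ⟨a, rfl⟩ := hE
      by_cases hW : ∃ b : Fin w, b.castSucc = a.succ
      · obtain ⟨b, hb⟩ := hW
        have h₁ : (a : ℕ) + 1 = b := by simpa using (congrArg Fin.val hb).symm
        have key := P.cardinalDegree_verticalSide (t := (a, j)) (t' := (b, j)) h₁ rfl (hv _).1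
          (hv _).2
        rw [key, key]
        refine TileType.balanced_vertical (fits_east (t := (a, j)) (t' := (b, j)) h₁ rfl)
          (fun c hc => hφ c _ _ (.inl ?_)) _ hab
        exact ⟨h₁, rfl, TileType.uses_iff.1 hc⟩
      · have key := P.cardinalDegree_shadedGraph_of_unique (hv (a, j)).1 (by
          intro t' a' ha'
          obtain ⟨hs, hs' | hs'⟩ := tile_of_vert ha'
          · exact Prod.ext (Fin.succ_injective _ hs') hs
          · exact absurd ⟨_, hs'⟩ hW)
        rw [key, key]
        refine (TileType.balanced_border _ _ _).1 (notUses fun c => X.closed_east a j c ?_) _ hab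
        by_contra hne
        exact hW ⟨⟨a + 1, by omega⟩, rfl⟩
    · by_cases hW : ∃ b : Fin w, b.castSucc = i
      · obtain ⟨b, rfl⟩ := hW
        have key := P.cardinalDegree_shadedGraph_of_unique (hv (b, j)).2 (by
          intro t' a' ha'
          obtain ⟨hs, hs' | hs'⟩ := tile_of_vert ha'
          · exact absurd ⟨_, hs'⟩ hE
          · exact Prod.ext (Fin.castSucc_injective _ hs') hs)
        rw [key, key]
        refine (TileType.balanced_border _ _ _).2.1 (notUses fun c => X.closed_west b j c ?_) _ hab
        by_contra hne
        exact hE ⟨⟨b - 1, by omega⟩, Fin.ext (by simp; omega)⟩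
      -- Neither side of the path has a cell, so the grid has no columns and the claim is vacuous.
      · refine P.balanced_of_other (fun t a ha => ?_) φ d
        obtain ⟨-, hs' | hs'⟩ := tile_of_vert ha
        exacts [absurd ⟨_, hs'⟩ hE, absurd ⟨_, hs'⟩ hW]
  | horiz i j k =>
    obtain ⟨ab, hab, hv⟩ := X.exists_horizontalSides k
    by_cases hE : ∃ a : Fin h, a.succ = j
    · obtain ⟨a, rfl⟩ := hE
      by_cases hW : ∃ b : Fin h, b.castSucc = a.succ
      · obtain ⟨b, hb⟩ := hW
        have h₁ : (a : ℕ) + 1 = b := by simpa using (congrArg Fin.val hb).symm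
        have key := P.cardinalDegree_horizontalSide (t := (i, a)) (t' := (i, b)) rfl h₁ (hv _).1
          (hv _).2
        rw [key, key]
        refine TileType.balanced_horizontal (fits_north (t := (i, a)) (t' := (i, b)) rfl h₁)
          (fun c hc => hφ c _ _ (.inr ?_)) _ hab
        exact ⟨rfl, h₁, TileType.uses_iff.1 hc⟩
      · have key := P.cardinalDegree_shadedGraph_of_unique (hv (i, a)).1 (by
          intro t' a' ha'
          obtain ⟨hs, hs' | hs'⟩ := tile_of_horiz ha'
          · exact Prod.ext hs (Fin.succ_injective _ hs')
          · exact absurd ⟨_, hs'⟩ hW)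
        rw [key, key]
        refine (TileType.balanced_border _ _ _).2.2.1
          (notUses fun c => X.closed_north i a c ?_) _ hab
        by_contra hne
        exact hW ⟨⟨a + 1, by omega⟩, rfl⟩
    · by_cases hW : ∃ b : Fin h, b.castSucc = j
      · obtain ⟨b, rfl⟩ := hW
        have key := P.cardinalDegree_shadedGraph_of_unique (hv (i, b)).2 (by
          intro t' a' ha'
          obtain ⟨hs, hs' | hs'⟩ := tile_of_horiz ha'
          · exact absurd ⟨_, hs'⟩ hE
          · exact Prod.ext hs (Fin.castSucc_injective _ hs'))
        rw [key, key]
        refine (TileType.balanced_border _ _ _).2.2.2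
          (notUses fun c => X.closed_south i b c ?_) _ hab
        by_contra hne
        exact hE ⟨⟨b - 1, by omega⟩, Fin.ext (by simp; omega)⟩
      · refine P.balanced_of_other (fun t a ha => ?_) φ d
        obtain ⟨-, hs' | hs'⟩ := tile_of_horiz ha
        exacts [absurd ⟨_, hs'⟩ hE, absurd ⟨_, hs'⟩ hW]

/-! ## Degrees of the framed graphs -/

theorem shadedGraph_adj {φ : Tile w h → LocalColoring} {x y : X.Vertex} :
    (X.shadedGraph φ).Adj x y ↔ ∃ t c, (X.colorGraph t (.wire c ((φ t).shade c))).Adj x y := by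
  simp only [shadedGraph, SimpleGraph.iSup_adj]

theorem coneGraph_adj_cone {x y : X.Vertex} (hxy : X.coneGraph.Adj x y) :
    x = .cone ∨ y = .cone := by
  obtain ⟨-, h | h⟩ := (SimpleGraph.fromRel_adj _ _ _).1 hxy
  exacts [.inl h.1, .inr h.1]

theorem colorGraph_not_cone {t : Tile w h} {e : EdgeColor} {x y : X.Vertex}
    (hxy : (X.colorGraph t e).Adj x y) : x ≠ .cone ∧ y ≠ .cone := by
  obtain ⟨-, ab, -, ⟨h₁, h₂⟩ | ⟨h₁, h₂⟩⟩ := X.colorGraph_adj.1 hxy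
  · exact ⟨fun h => cellVertex_ne_cone t _ (h ▸ h₁), fun h => cellVertex_ne_cone t _ (h ▸ h₂)⟩
  · exact ⟨fun h => cellVertex_ne_cone t _ (h ▸ h₂), fun h => cellVertex_ne_cone t _ (h ▸ h₁)⟩

theorem not_coneGraph_adj {t : Tile w h} {e : EdgeColor} {x y : X.Vertex}
    (hxy : (X.colorGraph t e).Adj x y) : ¬ X.coneGraph.Adj x y := fun hc =>
  (coneGraph_adj_cone hc).elim (colorGraph_not_cone hxy).1 (colorGraph_not_cone hxy).2

theorem not_cellGraph_adj (P : X.FramePlacement) {φ : Tile w h → LocalColoring} {x y : X.Vertex}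
    (hxy : (X.shadedGraph φ).Adj x y) : ¬ X.cellGraph.Adj x y := by
  obtain ⟨t, c, hxy⟩ := shadedGraph_adj.1 hxy
  intro hc
  simp only [cellGraph, SimpleGraph.iSup_adj] at hc
  obtain ⟨t', hc⟩ := hc
  exact absurd (P.colorGraph_unique hxy hc).2 (by simp)

theorem cardinalDegree_wireGraph (φ : Tile w h → LocalColoring) (d : Direction) (x : X.Vertex) :
    cardinalDegree P.pos X.wireGraph d x = cardinalDegree P.pos (X.shadedGraph φ) d x +
      cardinalDegree P.pos (X.shadedGraph (oppositeShades φ)) d x := by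
  rw [wireGraph_eq φ, cardinalDegree_sup]
  intro x y h₁ h₂
  obtain ⟨t, c, h₁⟩ := shadedGraph_adj.1 h₁
  obtain ⟨t', c', h₂⟩ := shadedGraph_adj.1 h₂
  obtain ⟨rfl, he⟩ := P.colorGraph_unique h₁ h₂
  obtain ⟨rfl, he⟩ := EdgeColor.wire.injEq _ _ _ _ ▸ he
  -- A shade never equals its opposite.
  revert he
  generalize hχ : φ t' = χ
  simp only [oppositeShades, hχ]
  rcases χ with ⟨_ | _, _ | _⟩ <;> cases c' <;> simp [LocalColoring.shade, Shade.swap]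

theorem cardinalDegree_cone_cell (d : Direction) (x : X.Vertex) :
    cardinalDegree P.pos (X.coneGraph ⊔ X.cellGraph) d x =
      cardinalDegree P.pos X.coneGraph d x + cardinalDegree P.pos X.cellGraph d x := by
  apply cardinalDegree_sup
  intro x y h₁ h₂
  simp only [cellGraph, SimpleGraph.iSup_adj] at h₂
  obtain ⟨t, h₂⟩ := h₂
  exact not_coneGraph_adj h₂ h₁

theorem cardinalDegree_cell_shaded (φ : Tile w h → LocalColoring) (d : Direction) (x : X.Vertex) :
    cardinalDegree P.pos (X.cellGraph ⊔ X.shadedGraph φ) d x =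
      cardinalDegree P.pos X.cellGraph d x + cardinalDegree P.pos (X.shadedGraph φ) d x :=
  cardinalDegree_sup (fun _ _ h₁ h₂ => P.not_cellGraph_adj h₂ h₁) d x

theorem cardinalDegree_framedGraph (hw : 0 < w) (hh : 0 < h) (φ : Tile w h → LocalColoring)
    (d : Direction) (x : X.Vertex) :
    cardinalDegree P.pos (X.framedGraph φ) d x = cardinalDegree P.pos X.blackGraph d x +
      cardinalDegree P.pos (X.shadedGraph φ) d x := by
  rw [framedGraph_eq hw hh, blackGraph_eq hw hh]
  apply cardinalDegree_sup
  rintro x y (h₁ | h₁) h₂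
  · obtain ⟨t, c, h₂⟩ := shadedGraph_adj.1 h₂
    exact not_coneGraph_adj h₂ h₁
  · exact P.not_cellGraph_adj h₂ h₁

/-- By `balanced` the total colored degree is twice the chosen one, so the integer division in the
signature is exact. -/
theorem signature_eq (φ : Tile w h → LocalColoring)
    (hφ : ∀ c t t', X.Linked c t t' → (φ t).shade c = (φ t').shade c) (d : Direction)
    (x : X.Vertex) : X.signature P.pos d x = cardinalDegree P.pos X.blackGraph d x +
      cardinalDegree P.pos (X.shadedGraph φ) d x := by
  have := P.balanced hφ d x
  rw [signature, P.cardinalDegree_wireGraph φ]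
  omega

/-! ## Realizations and tile selections -/

theorem gadgetGraph_le (hw : 0 < w) (hh : 0 < h) (φ : Tile w h → LocalColoring) (t : Tile w h) :
    X.gadgetGraph t (φ t) ≤ X.framedGraph φ := by
  rw [framedGraph_eq_gadgets hw hh]
  exact (le_iSup (fun t => X.gadgetGraph t (φ t)) t).trans le_sup_right

theorem framedGraph_mem_intendedClass (hw : 0 < w) (hh : 0 < h) {φ : Tile w h → LocalColoring}
    (hlink : ∀ c t t', X.Linked c t t' → (φ t).shade c = (φ t').shade c)
    (hφ : ∀ t, (X.type t).bothLight (φ t) = false) :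
    X.framedGraph φ ∈ X.intendedClass P.pos := by
  have hnc : NoncrossingEdges P.pos (X.framedGraph φ) := P.noncrossing_framedGraph hw hh (by
    rintro t ⟨h₁, h₂, h₃⟩
    have := hφ t
    simp [TileType.bothLight, h₁, h₂, h₃] at this)
  refine ⟨⟨⟨P.generalPosition, hnc⟩, fun d x => ?_⟩, fun t => ⟨_, ⟨φ t, rfl, ?_⟩,
    gadgetGraph_le hw hh φ t⟩⟩
  · rw [P.cardinalDegree_framedGraph hw hh, P.signature_eq φ hlink]
  · intro a b c d hab hcd
    exact hnc a b c d (gadgetGraph_le hw hh φ t hab) (gadgetGraph_le hw hh φ t hcd)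

/-- In a doubly light tile II the edges `v2v5` and `v3v7` cross, in III the edges `b3b7` and `b1b6`;
the determined orientations prove it. -/
theorem bothLight_of_noncrossing (hw : 0 < w) (hh : 0 < h) {t : Tile w h} {χ : LocalColoring}
    (hnc : NoncrossingEdges P.pos (X.gadgetGraph t χ)) : (X.type t).bothLight χ = false := by
  have G := P.cellGeometry hw hh t
  by_contra hb
  rw [Bool.not_eq_false, TileType.bothLight, Bool.and_eq_true, Bool.and_eq_true, beq_iff_eq,
    beq_iff_eq] at hb
  obtain ⟨⟨hcrit, hr⟩, hbl⟩ := hb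
  obtain ⟨_, _⟩ := χ
  simp only at hr hbl
  subst hr hbl
  have key : ∀ e ∈ (X.type t).coloredEdges ⟨.light, .light⟩,
      ∀ f ∈ (X.type t).coloredEdges ⟨.light, .light⟩, ∀ x y x' y' : X.Vertex,
      X.cellVertex t e.1 = some x → X.cellVertex t e.2 = some y →
      X.cellVertex t f.1 = some x' → X.cellVertex t f.2 = some y' →
      side e.1 e.2 f.1 = some true → side e.1 e.2 f.2 = some false →
      side f.1 f.2 e.1 = some false → side f.1 f.2 e.2 = some true → False := by
    intro e he f hf x y x' y' hx hy hx' hy' s₁ s₂ s₃ s₄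
    have hd := G.not_disjoint_of_side (by simp [hx]) (by simp [hy]) (by simp [hx'])
      (by simp [hy']) s₁ s₂ s₃ s₄
    rw [P.cellPos_eq hx, P.cellPos_eq hy, P.cellPos_eq hx', P.cellPos_eq hy'] at hd
    have ne : ∀ {a b c : CellVertex} {x y : X.Vertex}, X.cellVertex t a = some x →
        X.cellVertex t b = some y → (∃ s, side a b c = some s) → x ≠ y := by
      rintro a b c x y ha hb ⟨s, hs⟩ rfl
      rw [P.cellVertex_injective ha hb] at hs
      simp [side] at hs
    refine hd (hnc _ _ _ _ (gadgetGraph_adj.2 ⟨ne hx hy ⟨_, s₁⟩, e, he, .inl ⟨hx, hy⟩⟩)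
      (gadgetGraph_adj.2 ⟨ne hx' hy' ⟨_, s₃⟩, f, hf, .inl ⟨hx', hy'⟩⟩) ?_)
    -- A triple with a repeated vertex has no determined sign, so the two edges are distinct.
    have none₁ : ∀ a b, side a b a ≠ some true := by
      intro a b; rw [side]; split_ifs <;> simp <;> omega
    have none₂ : ∀ a b, side a b a ≠ some false := by
      intro a b; rw [side]; split_ifs <;> simp <;> omega
    rw [Ne, Sym2.eq_iff]
    rintro (⟨rfl, -⟩ | ⟨rfl, -⟩)
    · exact none₁ _ _ (P.cellVertex_injective hx hx' ▸ s₁)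
    · exact none₂ _ _ (P.cellVertex_injective hx hy' ▸ s₂)
  have hτ : X.type t = .crossingII ∨ X.type t = .crossingIII := by
    revert hcrit
    cases X.type t <;> simp [TileType.isCritical]
  rcases hτ with hτ | hτ
  · exact key (v2, v5) (by rw [hτ]; decide) (v3, v7) (by rw [hτ]; decide) _ _ _ _ rfl rfl rfl rfl
      (by decide) (by decide) (by decide) (by decide)
  · exact key (b3, b7) (by rw [hτ]; decide) (b1, b6) (by rw [hτ]; decide) _ _ _ _ rfl rfl rfl rfl
      (by decide) (by decide) (by decide) (by decide)

/-- Vertical sides are tested towards the east and horizontal sides towards the north, the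
directions in which all their colored edges leave and in which there are no cone edges. -/
theorem shade_eq_of_le {φ : Tile w h → LocalColoring}
    (hφ : ∀ t, (X.type t).bothLight (φ t) = false)
    (hle : ∀ x, x ≠ .cone → ∀ d, d = .north ∨ d = .east →
      cardinalDegree P.pos (X.shadedGraph φ) d x ≤
        cardinalDegree P.pos (X.shadedGraph (oppositeShades φ)) d x)
    (c : WireColor) (t t' : Tile w h) (hl : X.Linked c t t') :
    (φ t).shade c = (φ t').shade c := by
  rcases hl with ⟨h₁, h₂, hc⟩ | ⟨h₁, h₂, hc⟩
  · refine TileType.agree_of_vertical_le (fits_east h₁ h₂) (hφ t) (hφ t') ?_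
      (TileType.uses_iff.2 hc)
    intro ab hab
    obtain ⟨k, hk⟩ := X.exists_vert_of_verticalSides hab
    have key := P.cardinalDegree_verticalSide h₁ h₂ (hk t).1 (hk t').2
    have := hle (.vert t.1.succ t.2 k) (by simp) .east (.inr rfl)
    rw [key, key] at this
    exact this
  · refine TileType.agree_of_horizontal_le (fits_north h₁ h₂) ?_ (TileType.uses_iff.2 hc)
    intro ab hab
    obtain ⟨k, hk⟩ := X.exists_horiz_of_horizontalSides hab
    have key := P.cardinalDegree_horizontalSide h₁ h₂ (hk t).1 (hk t').2
    have := hle (.horiz t.1 t.2.succ k) (by simp) .north (.inl rfl)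
    rw [key, key] at this
    exact this

theorem cardinalDegree_coneGraph_eq_zero {x : X.Vertex} (hx : x ≠ .cone) {d : Direction}
    (hd : d = .north ∨ d = .east) : cardinalDegree P.pos X.coneGraph d x = 0 := by
  rw [← Nat.le_zero, ← not_lt, cardinalDegree_pos_iff]
  rintro ⟨u, hu, hs⟩
  obtain rfl := (coneGraph_adj_cone hu).resolve_left hx
  have := P.cone_place x hx
  rcases hd with rfl | rfl
  · exact lt_asymm hs this.2
  · exact lt_asymm hs this.1

/-- A realization that contains the gadgets `U^χ` for some local colorings `χ` is a framed graph,
and the shades agree along the curves. -/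
theorem eq_framedGraph_of_isRealization (hw : 0 < w) (hh : 0 < h) {G : SimpleGraph X.Vertex}
    (hG : IsRealization P.pos (X.signature P.pos) G) {φ : Tile w h → LocalColoring}
    (hφ : ∀ t, (X.type t).bothLight (φ t) = false) (hle : ∀ t, X.gadgetGraph t (φ t) ≤ G) :
    (∀ c t t', X.Linked c t t' → (φ t).shade c = (φ t').shade c) ∧ G = X.framedGraph φ := by
  obtain ⟨H, hH⟩ : ∃ H, H = X.cellGraph ⊔ X.shadedGraph φ := ⟨_, rfl⟩
  have hHG : H ≤ G := by
    rw [hH, ← iSup_gadgetGraph]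
    exact iSup_le hle
  have hlink : ∀ c t t', X.Linked c t t' → (φ t).shade c = (φ t').shade c := by
    -- Northward and eastward the signature is the black cell degree plus half the colored degree.
    -- The chosen edges lie in `G`, so they number at most that half, hence at most as many as the
    -- unchosen ones.
    refine P.shade_eq_of_le hφ fun x hx d hd => ?_
    have h₁ := cardinalDegree_mono (pos := P.pos) hHG d x
    rw [hG.degree_eq, signature, P.cardinalDegree_wireGraph φ, blackGraph_eq hw hh,
      P.cardinalDegree_cone_cell, P.cardinalDegree_coneGraph_eq_zero hx hd, hH,
      P.cardinalDegree_cell_shaded] at h₁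
    omega
  refine ⟨hlink, ?_⟩
  -- With consistent shades `H` accounts for all of the signature except the degrees of the cone
  -- star, which are therefore those of `G \ H`.
  have hR : G \ H = X.coneGraph := by
    refine eq_of_cardinalDegree_eq_of_star P.generalPosition.y_injective
      (fun v hv => (P.cone_place v hv).2) (fun x y => coneGraph_adj_cone) fun d x => ?_
    have h₁ := cardinalDegree_sup (pos := P.pos) (G := H) (H := G \ H)
      (fun x y h₁ h₂ => h₂.2 h₁) d x
    rw [sup_sdiff_cancel_right hHG, hG.degree_eq, P.signature_eq φ hlink, blackGraph_eq hw hh,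
      P.cardinalDegree_cone_cell] at h₁
    have h₂ := P.cardinalDegree_cell_shaded φ d x
    rw [← hH] at h₂
    omega
  rw [framedGraph_eq hw hh, sup_assoc, ← hH, ← hR, sdiff_sup_cancel hHG]

/-! ### Dependence of the framed graph on the shades. -/

/-- A tile crossed by a curve has a colored edge of the chosen shade. In the other framed graph this
edge can only come from the same tile, color and shade. -/
theorem shade_eq_of_framedGraph_eq (P : X.FramePlacement) (hw : 0 < w) (hh : 0 < h)
    {φ φ' : Tile w h → LocalColoring}
    (heq : X.framedGraph φ = X.framedGraph φ') {t : Tile w h} {c : WireColor}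
    (ht : t ∈ X.tilesWith c) : (φ t).shade c = (φ' t).shade c := by
  obtain ⟨ab, hab⟩ := List.exists_mem_of_ne_nil _
    (mt (TileType.wireEdges_eq_nil_iff (X.type t) c ((φ t).shade c)).1 ht)
  have hsome : (X.cellVertex t ab.1).isSome = true ∧ (X.cellVertex t ab.2).isSome = true := by
    refine isSome_of_mem_wires (χ := φ t) (List.mem_append.2 ?_)
    cases c
    exacts [.inl hab, .inr hab]
  obtain ⟨x, hx⟩ := Option.isSome_iff_exists.1 hsome.1
  obtain ⟨y, hy⟩ := Option.isSome_iff_exists.1 hsome.2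
  have hxy : x ≠ y := by
    rintro rfl
    exact (TileType.wire_facts _ _ _ hab).2.2.2.2.2.2.1 (P.cellVertex_injective hx hy)
  have hadj : (X.colorGraph t (.wire c ((φ t).shade c))).Adj x y :=
    X.colorGraph_adj.2 ⟨hxy, ab, hab, .inl ⟨hx, hy⟩⟩
  have hs : (X.shadedGraph φ).Adj x y := shadedGraph_adj.2 ⟨t, c, hadj⟩
  have hF : (X.framedGraph φ).Adj x y := by
    rw [framedGraph_eq hw hh]; exact .inr hs
  rw [heq, framedGraph_eq hw hh] at hF
  rcases hF with (h | h) | h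
  · exact absurd h (not_coneGraph_adj hadj)
  · exact absurd h (P.not_cellGraph_adj hs)
  · obtain ⟨t', c', h⟩ := shadedGraph_adj.1 h
    obtain ⟨rfl, he⟩ := P.colorGraph_unique hadj h
    injection he with hc hs
    subst hc
    exact hs.symm

theorem framedGraph_congr {φ φ' : Tile w h → LocalColoring}
    (hφ : ∀ c, ∀ t ∈ X.tilesWith c, (φ t).shade c = (φ' t).shade c) :
    X.framedGraph φ = X.framedGraph φ' := by
  unfold framedGraph
  congr 2
  funext t
  rw [gadgetGraph_eq, gadgetGraph_eq]
  congr 2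
  funext c
  by_cases ht : (X.type t).route c = none
  · have key : ∀ s, X.colorGraph t (.wire c s) = ⊥ := by
      intro s
      ext x y
      simp [colorGraph_adj, TileType.gadgetEdges, (TileType.wireEdges_eq_nil_iff _ c s).2 ht]
    rw [key, key]
  · rw [hφ c t ht]

end FramePlacement

end Tiling

/-! ## Tile selections -/

theorem selectionColoring_light {w h : ℕ} {S : Set (Tile w h) × Set (Tile w h)} {t : Tile w h} :
    ((selectionColoring S t).red = .light ↔ t ∈ S.1) ∧
      ((selectionColoring S t).blue = .light ↔ t ∈ S.2) := by
  unfold selectionColoring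
  constructor
  · by_cases ht : t ∈ S.1 <;> simp [ht]
  · by_cases ht : t ∈ S.2 <;> simp [ht]

theorem Shade.eq_iff_light (s s' : Shade) : s = s' ↔ (s = .light ↔ s' = .light) := by
  cases s <;> cases s' <;> simp

theorem Tiling.Linked.mem_tilesWith {w h : ℕ} {X : Tiling w h} {c : WireColor} {t t' : Tile w h}
    (hl : X.Linked c t t') : t ∈ X.tilesWith c ∧ t' ∈ X.tilesWith c := by
  obtain ⟨i, j⟩ := t
  obtain ⟨i', j'⟩ := t'
  have key : ∀ {t d}, (X.type t).Uses c d → t ∈ X.tilesWith c := by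
    rintro t d ⟨r, hr, -⟩
    simp [tilesWith, hr]
  rcases hl with ⟨h₁, h₂, hc⟩ | ⟨h₁, h₂, hc⟩
  · obtain rfl : j = j' := h₂
    exact ⟨key hc, key ((X.match_horizontal i i' j c h₁).1 hc)⟩
  · obtain rfl : i = i' := h₁
    exact ⟨key hc, key ((X.match_vertical i j j' c h₂).1 hc)⟩

theorem mainTheorem3 (w h : ℕ) (hw : 0 < w) (hh : 0 < h) (X : Tiling w h)
    (P : X.FramePlacement) :
    Set.BijOn (fun S => X.framedGraph (selectionColoring S))
      {S : Set (Tile w h) × Set (Tile w h) | X.IsTileSelection S ∧ X.IsNoncrossing S}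
      (X.intendedClass P.pos) := by
  refine ⟨?_, ?_, ?_⟩
  · rintro S ⟨-, hS⟩
    refine P.framedGraph_mem_intendedClass hw hh ?_ ?_
    · rintro (_ | _) t t' hl <;> rw [Shade.eq_iff_light]
      · exact selectionColoring_light.1.trans ((hS.red_signal t t' hl).trans
          selectionColoring_light.1.symm)
      · exact selectionColoring_light.2.trans ((hS.blue_signal t t' hl).trans
          selectionColoring_light.2.symm)
    · intro t
      rw [← Bool.not_eq_true]
      simp only [TileType.bothLight, Bool.and_eq_true, beq_iff_eq, selectionColoring_light]
      rintro ⟨⟨hc, hr⟩, hb⟩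
      refine (hS.critical t ?_).elim (absurd hr) (absurd hb)
      revert hc
      cases X.type t <;> simp [TileType.isCritical, TileType.IsCritical]
  · rintro S ⟨hS, -⟩ S' ⟨hS', -⟩ heq
    have key : ∀ c t, t ∈ X.tilesWith c →
        (selectionColoring S t).shade c = (selectionColoring S' t).shade c := fun c t ht =>
      P.shade_eq_of_framedGraph_eq hw hh heq ht
    have red : ∀ t ∈ X.tilesWith .red, t ∈ S.1 ↔ t ∈ S'.1 := fun t ht => by
      have := (Shade.eq_iff_light _ _).1 (key .red t ht)
      exact selectionColoring_light.1.symm.trans (this.trans selectionColoring_light.1)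
    have blue : ∀ t ∈ X.tilesWith .blue, t ∈ S.2 ↔ t ∈ S'.2 := fun t ht => by
      have := (Shade.eq_iff_light _ _).1 (key .blue t ht)
      exact selectionColoring_light.2.symm.trans (this.trans selectionColoring_light.2)
    refine Prod.ext (Set.ext fun t => ?_) (Set.ext fun t => ?_)
    · exact ⟨fun ht => (red t (hS.1 ht)).1 ht, fun ht => (red t (hS'.1 ht)).2 ht⟩
    · exact ⟨fun ht => (blue t (hS.2 ht)).1 ht, fun ht => (blue t (hS'.2 ht)).2 ht⟩
  · rintro G ⟨hG, hU⟩
    choose H hH hHG using hU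
    choose φ hφ hnc using hH
    have hlight : ∀ t, (X.type t).bothLight (φ t) = false := fun t =>
      P.bothLight_of_noncrossing hw hh (hφ t ▸ hnc t)
    obtain ⟨hlink, rfl⟩ := P.eq_framedGraph_of_isRealization hw hh hG hlight
      (fun t => hφ t ▸ hHG t)
    -- A selection may only contain tiles met by a curve of the color. On other tiles the shade in
    -- `φ` is arbitrary and, by `framedGraph_congr`, irrelevant.
    let S : Set (Tile w h) × Set (Tile w h) :=
      ({t | t ∈ X.tilesWith .red ∧ (φ t).red = .light},
        {t | t ∈ X.tilesWith .blue ∧ (φ t).blue = .light})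
    refine ⟨S, ⟨⟨fun t ht => ht.1, fun t ht => ht.1⟩, ⟨?_, ?_, ?_⟩⟩, ?_⟩
    · intro t t' hl
      have := (Shade.eq_iff_light _ _).1 (hlink .red t t' hl)
      exact and_congr (iff_of_true hl.mem_tilesWith.1 hl.mem_tilesWith.2) this
    · intro t t' hl
      have := (Shade.eq_iff_light _ _).1 (hlink .blue t t' hl)
      exact and_congr (iff_of_true hl.mem_tilesWith.1 hl.mem_tilesWith.2) this
    · intro t ht
      by_contra! hcon
      have := hlight t
      rw [TileType.bothLight, hcon.1.2, hcon.2.2] at this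
      rcases ht with ht | ht <;> rw [ht] at this <;> simp [TileType.isCritical] at this
    · refine Tiling.FramePlacement.framedGraph_congr fun c t ht => ?_
      rw [Shade.eq_iff_light]
      cases c
      · exact selectionColoring_light.1.trans ⟨fun h => h.2, fun h => ⟨ht, h⟩⟩
      · exact selectionColoring_light.2.trans ⟨fun h => h.2, fun h => ⟨ht, h⟩⟩
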